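/- **Model.** Let $(\Omega,\mathcal F,(\mathcal F_t)_{t\ge0},\mathbb P)$ be a filtered probability space with $\mathcal F_0$ $\mathbb P$-trivial, let $P^0$ be a càdlàg $(\mathcal F_t)$-martingale (the unaffected price), and let $\gamma>0$ and $h(x)=\eta x$ with $\eta>0$ (an Almgren–Chriss model with linear temporary impact). Let $0<\tau_1<\tau_2<\cdots$ be random times such that $N_t=\max\{k\ge 0: k=0 \text{ or } \tau_k\le t\}$ is a Poisson process with parameter $\theta>0$, and let $\widetilde Y_1,\widetilde Y_2,\dots$ be i.i.d. $(0,\infty]$-valued random variables with law $\mu=\delta_\infty$ (the times and sizes of the incoming matching orders in a dark pool). Assume that the $\sigma$-algebra $\bigvee_t\mathcal F_t$, the process $(N_t)$ and the sequence $(\widetilde Y_i)$ are independent. **Strategies.** For $\widehat X\in\mathbb R$ and $\Xi\in[0,|\widehat X|]$, define recursively the executed amounts: if $\widetilde Y_i\ge\Xi$, then $Y_i=\operatorname{sgn}(\widehat X)\widetilde Y_i$ when $\sum_{j<i}|Y_j|+\widetilde Y_i\le|\widehat X|$ and $Y_i=\widehat X-\sum_{j<i}Y_j$ otherwise; if $\widetilde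 Y_i<\Xi$, then $Y_i=0$. Let $Z_t=\sum_{i=1}^{N_t}Y_i$, and let $(\mathcal G_t)$ be the right-continuous filtration generated by $(\mathcal F_t)$, $Z$ and the processes $(\tau_i\wedge t)_{t\ge0}$, $i\ge1$. A *round trip* with horizon $T>0$ is a quadruple $\chi=(\widehat X,\Xi,\xi,\rho)$ with $\widehat X,\Xi$ as above, a $(\mathcal G_t)$-stopping time $\rho$ with $\rho<T$ a.s., and a $(\mathcal G_t)$-predictable process $\xi$, a.s. integrable on $[0,T]$, such that $\int_0^t\xi_s\,ds$ is a.s. bounded uniformly in $t\in[0,T]$ and $\omega$, and such that $$\int_0^T\xi_t\,dt+Z_\rho=0\quad\text{a.s.}$$ **Costs.** In the case of no virtual permanent impact of dark-pool executions ($\alpha=0$), no slippage ($\beta=0$), and no temporary impact on dark-pool prices ($\kappa=0$), the costs of a round trip $\chi$ are $$\mathcal C_T^\chi=\int_0^T\xi_t\Big(P^0_t+\gamma\int_0^t\xi_s\,ds+\eta\,\xi_t\Big)dt+\sum_{i=1}^{N_\rho}Y_i\Big(P^0_{\tau_i}+\gamma\int_0^{\tau_i}\xi_s\,ds\Big)\in(-\infty,+\infty].$$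 There is *price manipulation* for the horizon $T$ if some round trip $\chi$ with horizon $T$ satisfies $\mathbb E[\mathcal C_T^\chi]<0$, that is, $\mathbb E[(\mathcal C_T^\chi)^+]<\mathbb E[(\mathcal C_T^\chi)^-]$. **Statement.** There is no price manipulation for every horizon $T>0$ if and only if $\dfrac{\gamma}{\eta}\le2\theta$. -/

import Mathlib

open MeasureTheory ProbabilityTheory Filter Topology
open scoped NNReal ENNReal

noncomputable section

namespace DarkPoolModel

/-! ### The Almgren–Chriss model -/

/-- An impact function: continuous, strictly increasing, vanishing at `0`, with `x * h x` convex. -/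
structure IsImpactFunction (h : ℝ → ℝ) : Prop where
  continuous : Continuous h
  strictMono : StrictMono h
  map_zero : h 0 = 0
  convexOn : ConvexOn ℝ Set.univ (fun x => x * h x)

/-- All paths are right-continuous with finite left-hand limits. -/
def IsCadlag {Ω : Type*} (X : ℝ≥0 → Ω → ℝ) : Prop :=
  ∀ ω t, ContinuousWithinAt (fun s => X s ω) (Set.Ici t) t ∧
    ∃ l, Tendsto (fun s => X s ω) (𝓝[<] t) (𝓝 l)

/-- An Almgren–Chriss model `(γ, h, P⁰)` on a filtered probability space. -/
structure AlmgrenChriss {Ω : Type*} [mΩ : MeasurableSpace Ω] (P : Measure Ω) where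
  /-- the filtration `(ℱ_t)` -/
  filtration : Filtration ℝ≥0 mΩ
  /-- `ℱ_0` is `P`-trivial -/
  trivial_zero : ∀ A, MeasurableSet[filtration 0] A → P A = 0 ∨ P A = 1
  /-- the unaffected stock price process `P⁰` -/
  price : ℝ≥0 → Ω → ℝ
  price_martingale : Martingale price filtration P
  price_cadlag : IsCadlag price
  /-- the permanent-impact parameter -/
  γ : ℝ
  γ_pos : 0 < γ
  /-- the temporary-impact function -/
  h : ℝ → ℝ
  h_impact : IsImpactFunction h

/-! ### The dark-pool extension -/

/-- The parameters `(α, β, κ, (τ_i), (Ỹ_i))` of a dark-pool extension. Indices start at `0`: `τ i`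
and `Y i` are the arrival time and the size of the `(i+1)`-st incoming matching order. The
slippage `β` is an impact function, or zero. -/
structure DarkPool (Ω : Type*) [MeasurableSpace Ω] where
  α : ℝ
  α_mem : α ∈ Set.Icc (0 : ℝ) 1
  β : ℝ → ℝ
  β_impact : IsImpactFunction β ∨ β = 0
  κ : ℝ
  κ_nonneg : 0 ≤ κ
  τ : ℕ → Ω → ℝ≥0
  τ_measurable : ∀ i, Measurable (τ i)
  τ_pos : ∀ ω, 0 < τ 0 ω
  τ_strictMono : ∀ ω, StrictMono (fun i => τ i ω)
  Y : ℕ → Ω → ℝ≥0∞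
  Y_measurable : ∀ i, Measurable (Y i)
  Y_pos : ∀ i ω, 0 < Y i ω

/-- The (signed) part of an incoming order of size `y` that is executed against the remainder of a
dark-pool order `x` with minimum quantity level `Ξ`, when the amount `z` (with the sign of `x`)
has already been executed. -/
def fill (x Ξ z : ℝ) (y : ℝ≥0∞) : ℝ :=
  if ENNReal.ofReal Ξ ≤ y then
    if ENNReal.ofReal |z| + y ≤ ENNReal.ofReal |x| then Real.sign x * y.toReal else x - z
  else 0

/-- The signed amount executed against the first `n` incoming orders of sizes `y 0, y 1, …`. -/
def cumFill (x Ξ : ℝ) (y : ℕ → ℝ≥0∞) : ℕ → ℝ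
  | 0 => 0
  | n + 1 => cumFill x Ξ y n + fill x Ξ (cumFill x Ξ y n) (y n)

namespace DarkPool

variable {Ω : Type*} [mΩ : MeasurableSpace Ω] (D : DarkPool Ω)

/-- `N_t`: the largest `k` such that the first `k` orders have arrived by time `t`. -/
def count (t : ℝ≥0) (ω : Ω) : ℕ := sSup {k | ∀ i < k, D.τ i ω ≤ t}

/-- The executed part of the `(i+1)`-st incoming order, given the dark-pool order `x` and the
minimum quantity level `Ξ`. -/
def executed (x Ξ : ℝ) (i : ℕ) (ω : Ω) : ℝ :=
  fill x Ξ (cumFill x Ξ (fun j => D.Y j ω) i) (D.Y i ω)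

/-- `Z_t = ∑_{i ≤ N_t} Y_i`, the amount executed in the dark pool until time `t`. -/
def Z (x Ξ : ℝ) (t : ℝ≥0) (ω : Ω) : ℝ :=
  ∑ i ∈ Finset.range (D.count t ω), D.executed x Ξ i ω

theorem cumFill_eq_sum (x Ξ : ℝ) (n : ℕ) (ω : Ω) :
    cumFill x Ξ (fun j => D.Y j ω) n = ∑ i ∈ Finset.range n, D.executed x Ξ i ω := by
  induction n with
  | zero => simp [cumFill]
  | succ n ih => rw [Finset.sum_range_succ, ← ih]; rfl

theorem measurable_fill (x Ξ : ℝ) : Measurable (fun p : ℝ × ℝ≥0∞ => fill x Ξ p.1 p.2) := by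
  unfold fill
  refine Measurable.ite (measurableSet_le measurable_const measurable_snd)
    (Measurable.ite (measurableSet_le ?_ measurable_const) ?_ ?_) measurable_const
  · fun_prop
  · fun_prop
  · fun_prop

theorem measurable_cumFill (x Ξ : ℝ) (n : ℕ) :
    Measurable (fun ω => cumFill x Ξ (fun j => D.Y j ω) n) := by
  induction n with
  | zero => exact measurable_const
  | succ n ih => exact ih.add ((measurable_fill x Ξ).comp (ih.prodMk (D.Y_measurable n)))

theorem measurable_executed (x Ξ : ℝ) (i : ℕ) : Measurable (D.executed x Ξ i) :=
  (measurable_fill x Ξ).comp ((D.measurable_cumFill x Ξ i).prodMk (D.Y_measurable i))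

theorem count_eq_succ_iff (t : ℝ≥0) (ω : Ω) (k : ℕ) :
    D.count t ω = k + 1 ↔ D.τ k ω ≤ t ∧ t < D.τ (k + 1) ω := by
  have hS : ∀ n, (∀ i < n + 1, D.τ i ω ≤ t) ↔ D.τ n ω ≤ t := fun n =>
    ⟨fun h => h n n.lt_succ_self,
      fun h i hi => ((D.τ_strictMono ω).monotone (Nat.lt_succ_iff.1 hi)).trans h⟩
  constructor
  · intro h
    have hne : {k | ∀ i < k, D.τ i ω ≤ t}.Nonempty := ⟨0, by simp⟩
    have hb : BddAbove {k | ∀ i < k, D.τ i ω ≤ t} := by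
      by_contra hb
      have := Nat.sSup_of_not_bddAbove hb
      unfold count at h
      omega
    have hm := Nat.sSup_mem hne hb
    have h' : sSup {k | ∀ i < k, D.τ i ω ≤ t} = k + 1 := h
    rw [h'] at hm
    refine ⟨(hS k).1 hm, ?_⟩
    by_contra! hc
    have := le_csSup hb ((hS (k + 1)).2 hc)
    omega
  · rintro ⟨h1, h2⟩
    have : IsGreatest {k | ∀ i < k, D.τ i ω ≤ t} (k + 1) := by
      refine ⟨(hS k).2 h1, fun n hn => ?_⟩
      by_contra! hc
      exact absurd (hn (k + 1) hc) (not_le.2 h2)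
    exact this.csSup_eq

theorem measurable_count (t : ℝ≥0) : Measurable (D.count t) := by
  have hsucc : ∀ k, MeasurableSet (D.count t ⁻¹' {k + 1}) := by
    intro k
    have : D.count t ⁻¹' {k + 1} = {ω | D.τ k ω ≤ t} ∩ {ω | t < D.τ (k + 1) ω} := by
      ext ω
      simpa using D.count_eq_succ_iff t ω k
    rw [this]
    exact (measurableSet_le (D.τ_measurable _) measurable_const).inter
      (measurableSet_lt measurable_const (D.τ_measurable _))
  refine measurable_to_countable' fun k => ?_
  cases k with
  | succ k => exact hsucc k
  | zero =>
    have : D.count t ⁻¹' {0} = (⋃ k, D.count t ⁻¹' {k + 1})ᶜ := by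
      ext ω
      simp only [Set.mem_preimage, Set.mem_singleton_iff, Set.mem_compl_iff, Set.mem_iUnion,
        not_exists]
      constructor
      · intro h k
        omega
      · intro h
        by_contra hc
        obtain ⟨k, hk⟩ := Nat.exists_eq_succ_of_ne_zero hc
        exact h k hk
    rw [this]
    exact (MeasurableSet.iUnion hsucc).compl

theorem measurable_Z (x Ξ : ℝ) (t : ℝ≥0) : Measurable (D.Z x Ξ t) := by
  have h : Measurable (fun p : ℕ × Ω => ∑ i ∈ Finset.range p.1, D.executed x Ξ i p.2) :=
    measurable_from_prod_countable_right fun n =>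
      Finset.measurable_sum (Finset.range n) fun i _ => D.measurable_executed x Ξ i
  exact h.comp ((D.measurable_count t).prodMk measurable_id)

/-- `(𝒢_t)`: the right-continuous filtration generated by `(ℱ_t)`, the process `Z`, and the
processes `(τ_i ∧ t)_{t ≥ 0}`. -/
def enlarged (ℱ : Filtration ℝ≥0 mΩ) (x Ξ : ℝ) : Filtration ℝ≥0 mΩ :=
  (ℱ ⊔ Filtration.natural (D.Z x Ξ) (fun t => (D.measurable_Z x Ξ t).stronglyMeasurable) ⊔
    ⨆ i, Filtration.natural (fun t ω => min (D.τ i ω) t)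
      (fun _ => ((D.τ_measurable i).min measurable_const).stronglyMeasurable)).rightCont

end DarkPool

/-! ### Strategies and their costs -/

/-- A quadruple `(X̂, Ξ, ξ, ρ)`: size of the dark-pool order, minimum quantity level, speed of
trading at the exchange, cancellation time. -/
structure Strategy (Ω : Type*) where
  x : ℝ
  Ξ : ℝ
  ξ : ℝ≥0 → Ω → ℝ
  ρ : Ω → ℝ≥0

/-- `∫_0^t ξ_s ds` -/
def Strategy.traded {Ω : Type*} (χ : Strategy Ω) (t : ℝ≥0) (ω : Ω) : ℝ :=
  ∫ s in (0 : ℝ)..t, χ.ξ s.toNNReal ω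

section Costs

variable {Ω : Type*} [MeasurableSpace Ω] {P : Measure Ω}
  (M : AlmgrenChriss P) (D : DarkPool Ω)

/-- The admissible strategies `𝒳(X₀, T)`. -/
structure IsAdmissible (X₀ : ℝ) (T : ℝ≥0) (χ : Strategy Ω) : Prop where
  level_mem : χ.Ξ ∈ Set.Icc 0 |χ.x|
  stopping : IsStoppingTime (D.enlarged M.filtration χ.x χ.Ξ) (fun ω => (χ.ρ ω : WithTop ℝ≥0))
  cancel_lt : ∀ᵐ ω ∂P, χ.ρ ω < T
  predictable : IsStronglyPredictable (D.enlarged M.filtration χ.x χ.Ξ) χ.ξ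
  integrable : ∀ᵐ ω ∂P,
    IntervalIntegrable (fun s : ℝ => χ.ξ s.toNNReal ω) volume 0 T
  bounded : ∃ K : ℝ, ∀ᵐ ω ∂P, ∀ t ≤ T, |χ.traded t ω| ≤ K
  liquidation : ∀ᵐ ω ∂P, X₀ + χ.traded T ω + D.Z χ.x χ.Ξ (χ.ρ ω) ω = 0

/-- The price at the exchange, `P_t = P⁰_t + γ ∫_0^t ξ_s ds + h(ξ_t)`. -/
def exchangePrice (χ : Strategy Ω) (t : ℝ≥0) (ω : Ω) : ℝ :=
  M.price t ω + M.γ * χ.traded t ω + M.h (χ.ξ t ω)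

/-- The price for executions in the dark pool at time `t`,
`P⁰_t + γ ∫_0^t ξ_s ds + κ h(ξ_t)`. -/
def darkPrice (χ : Strategy Ω) (t : ℝ≥0) (ω : Ω) : ℝ :=
  M.price t ω + M.γ * χ.traded t ω + D.κ * M.h (χ.ξ t ω)

open Classical in
/-- The costs `C_T` of a strategy. For an admissible strategy, almost every path of `ξ_t P_t` is
the sum of an integrable function and the nonnegative function `ξ_t h(ξ_t)`; where it fails to be
integrable on `[0, T]`, its integral, and hence the costs, are therefore `+∞`. The sum
`∑_{j < i} Y_j` is `Z` just before the arrival of the order with index `i`. -/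
def cost (X₀ : ℝ) (T : ℝ≥0) (χ : Strategy Ω) (ω : Ω) : EReal :=
  if IntervalIntegrable
      (fun t : ℝ => χ.ξ t.toNNReal ω * exchangePrice M χ t.toNNReal ω) volume 0 T then
    ((X₀ * M.price 0 ω
      + (∫ t in (0 : ℝ)..T, χ.ξ t.toNNReal ω * exchangePrice M χ t.toNNReal ω)
      + D.α * M.γ *
          (∫ t in (0 : ℝ)..T, D.Z χ.x χ.Ξ (min (χ.ρ ω) t.toNNReal) ω * χ.ξ t.toNNReal ω)
      + ∑ i ∈ Finset.range (D.count (χ.ρ ω) ω), D.executed χ.x χ.Ξ i ω *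
          (darkPrice M D χ (D.τ i ω) ω
            + D.α * M.γ * (∑ j ∈ Finset.range i, D.executed χ.x χ.Ξ j ω)
            + D.β (D.executed χ.x χ.Ξ i ω)) : ℝ) : EReal)
  else ⊤

/-- `E[C] < 0`, in `[-∞, ∞)`: the integral of the positive part is smaller than that of the
negative part (in particular, it is finite). -/
def NegativeExpectation (P : Measure Ω) (C : Ω → EReal) : Prop :=
  ∫⁻ ω, (C ω).toENNReal ∂P < ∫⁻ ω, (-(C ω)).toENNReal ∂P

/-- A price manipulation strategy with horizon `T`: a round trip, that is, an admissible strategy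
with `X₀ = 0`, with strictly negative expected costs. -/
def IsPriceManipulation (T : ℝ≥0) (χ : Strategy Ω) : Prop :=
  IsAdmissible M D 0 T χ ∧ NegativeExpectation P (cost M D 0 T χ)

end Costs

/-! ### Poisson arrivals -/

/-- `N` is a Poisson process with parameter `θ`. -/
structure IsPoissonProcess {Ω : Type*} [MeasurableSpace Ω] (P : Measure Ω) (θ : ℝ≥0)
    (N : ℝ≥0 → Ω → ℕ) : Prop where
  zero : ∀ᵐ ω ∂P, N 0 ω = 0
  indep : HasIndepIncrements N P
  law : ∀ s t, s ≤ t → P.map (fun ω => N t ω - N s ω) = poissonMeasure (θ * (t - s))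

/-- No slippage, Poisson arrivals with parameter `θ > 0`, i.i.d. sizes of the incoming orders with
law `ν` on `(0, ∞]` that is unbounded from above, and independence of the filtration of the
Almgren–Chriss model, the arrivals, and the sizes. -/
structure PoissonAssumption {Ω : Type*} [MeasurableSpace Ω] {P : Measure Ω}
    (M : AlmgrenChriss P) (D : DarkPool Ω) (θ : ℝ≥0) (ν : Measure ℝ≥0∞) : Prop where
  β_zero : D.β = 0
  θ_pos : 0 < θ
  poisson : IsPoissonProcess P θ D.count
  Y_indep : iIndepFun D.Y P
  Y_law : ∀ i, P.map (D.Y i) = ν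
  unbounded : ∀ x : ℝ, 0 < x → 0 < ν (Set.Ici (ENNReal.ofReal x))
  indep : iIndep ![⨆ t, (M.filtration t : MeasurableSpace Ω),
    ⨆ t, MeasurableSpace.comap (D.count t) inferInstance,
    ⨆ i, MeasurableSpace.comap (D.Y i) inferInstance] P

end DarkPoolModel

end

noncomputable section

namespace DarkPoolModel

/-! ### A maximal-type estimate for martingale transforms -/

/-! Incoming orders are almost surely infinite, so the first arrival τ = `D.τ 0` fills the whole
dark-pool order x if τ ≤ ρ, and later ones fill nothing. With X_t = ∫_0^t ξ, liquidation reads X_T =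
-x·1{τ ≤ ρ}, and the costs split as A + B + η∫ξ², where A = ∫ξP⁰ dt + x·1{τ ≤ ρ}P⁰_τ
(`unaffectedCost`) and B = 1{τ ≤ ρ}(γx²/2 + γxX_τ) (`permanentCost`), as in `cost_eq`.

A contributes nothing. Integration by parts turns it into a martingale transform of P⁰ with a
bounded integrand, the inventory, which vanishes at 0 and T; P⁰ remains a martingale for the
enlarged filtration because the added information is independent of ℱ
(`martingale_rightCont_of_indep`). As P⁰ is only an L¹ martingale, A need not be integrable a
priori. Instead, the expectation of A truncated at level m tends to 0
(`tendsto_integral_truncation_stieltjes`, resting on `abs_integral_arctan_transform_le`). If E[A⁺] <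
∞, Fatou's lemma then makes A integrable with mean 0, and negative expected costs do force E[A⁺] <
∞.

For the impact terms, until τ the strategy can use only ℱ: up to time τ the rate ξ agrees with an
ℱ_∞-measurable g, and τ ≤ ρ means τ ≤ r with r ℱ_∞-measurable (`exists_eq_of_predictable`,
`exists_eq_of_stoppingTime`). Since τ is exponential and independent of ℱ_∞, averaging over τ leaves
at each time t < r the quadratic γxy(e^{-θt} - e^{-θr}) + ηy²e^{-θt} in y = g_t, which is at least
-(γx)²e^{-θt}/(4η). Integrating over t and adding γx²/2·P(τ ≤ r) gives at least γx²(2θη -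
γ)/(4ηθ)·P(τ ≤ r), nonnegative when γ ≤ 2θη (`integral_impactRate_ge`, `impact_prod_nonneg`).

Conversely, the quadratic for r = ∞ is minimised by the constant rate y = -γx/(2η). Selling at rate
γ/(2η) against a buy order for one share until τ or a late time r, then unwinding slowly, has
negative expected costs as soon as γ > 2θη (`exists_isPriceManipulation`). -/

theorem abs_arctan_sub_le (x y : ℝ) :
    |Real.arctan y - Real.arctan x - (1 + x ^ 2)⁻¹ * (y - x)| ≤ |y - x| * min |y - x| 1 := by
  -- By the mean value theorem the remainder is y - x times a difference of two values of the
  -- derivative 1/(1 + z²). This derivative is 1-Lipschitz and has values in (0, 1], whence the two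
  -- bounds |y - x| and 1.
  have key : ∃ c, |c - x| ≤ |y - x| ∧
      Real.arctan y - Real.arctan x = (1 + c ^ 2)⁻¹ * (y - x) := by
    have hd : ∀ z, HasDerivAt Real.arctan ((1 + z ^ 2)⁻¹) z := fun z => by
      simpa using Real.hasDerivAt_arctan z
    rcases lt_trichotomy x y with h | h | h
    · obtain ⟨c, hc, h'⟩ := exists_hasDerivAt_eq_slope Real.arctan (fun z => (1 + z ^ 2)⁻¹) h
        Real.continuous_arctan.continuousOn (fun z _ => hd z)
      refine ⟨c, ?_, ?_⟩
      · rw [abs_of_pos (by linarith [hc.1]), abs_of_pos (by linarith)]; linarith [hc.2]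
      · have : y - x ≠ 0 := by linarith
        rw [h']; field_simp
    · exact ⟨x, by simp [h], by simp [h]⟩
    · obtain ⟨c, hc, h'⟩ := exists_hasDerivAt_eq_slope Real.arctan (fun z => (1 + z ^ 2)⁻¹) h
        Real.continuous_arctan.continuousOn (fun z _ => hd z)
      refine ⟨c, ?_, ?_⟩
      · rw [abs_of_neg (by linarith [hc.2]), abs_of_neg (by linarith)]; linarith [hc.1]
      · have : x - y ≠ 0 := by linarith
        rw [h']; field_simp; ring
  obtain ⟨c, hc, h⟩ := key
  have hb : |(1 + c ^ 2)⁻¹ - (1 + x ^ 2)⁻¹| ≤ min |y - x| 1 := by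
    have h1 : 0 < 1 + c ^ 2 := by positivity
    have h2 : 0 < 1 + x ^ 2 := by positivity
    refine le_min (le_trans ?_ hc) ?_
    · have e : (1 + c ^ 2)⁻¹ - (1 + x ^ 2)⁻¹ =
          (c - x) * (-(c + x) / ((1 + c ^ 2) * (1 + x ^ 2))) := by field_simp; ring
      rw [e, abs_mul]
      refine mul_le_of_le_one_right (abs_nonneg _) ?_
      rw [abs_div, abs_of_pos (mul_pos h1 h2), div_le_one (mul_pos h1 h2)]
      refine abs_le.2 ⟨?_, ?_⟩ <;>
        nlinarith [sq_nonneg (c - 1), sq_nonneg (x - 1), sq_nonneg (c + 1), sq_nonneg (x + 1),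
          mul_nonneg (sq_nonneg c) (sq_nonneg x)]
    · have a1 : (1 + c ^ 2)⁻¹ ≤ 1 := inv_le_one_of_one_le₀ (by nlinarith [sq_nonneg c])
      have a2 : (1 + x ^ 2)⁻¹ ≤ 1 := inv_le_one_of_one_le₀ (by nlinarith [sq_nonneg x])
      have b1 : 0 < (1 + c ^ 2)⁻¹ := inv_pos.2 h1
      have b2 : 0 < (1 + x ^ 2)⁻¹ := inv_pos.2 h2
      exact abs_le.2 ⟨by linarith, by linarith⟩
  have e : Real.arctan y - Real.arctan x - (1 + x ^ 2)⁻¹ * (y - x)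
      = (y - x) * ((1 + c ^ 2)⁻¹ - (1 + x ^ 2)⁻¹) := by rw [h]; ring
  rw [e, abs_mul]
  exact mul_le_mul_of_nonneg_left hb (abs_nonneg _)

/-- A smooth convex substitute for the absolute value, quadratic at the origin. -/
def softAbs (x : ℝ) : ℝ := √(1 + x ^ 2) - 1

/-- The derivative of `softAbs`. -/
def softSign (x : ℝ) : ℝ := x / √(1 + x ^ 2)

theorem one_le_sqrt_one_add_sq (x : ℝ) : 1 ≤ √(1 + x ^ 2) :=
  Real.one_le_sqrt.2 (by nlinarith [sq_nonneg x])

theorem softAbs_nonneg (x : ℝ) : 0 ≤ softAbs x := sub_nonneg.2 (one_le_sqrt_one_add_sq x)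

theorem sqrt_one_add_sq_le (x : ℝ) : √(1 + x ^ 2) ≤ 1 + |x| := by
  refine Real.sqrt_le_iff.2 ⟨by positivity, ?_⟩
  nlinarith [abs_nonneg x, sq_abs x]

theorem softAbs_le_abs (x : ℝ) : softAbs x ≤ |x| := by
  have := sqrt_one_add_sq_le x
  unfold softAbs; linarith

theorem softAbs_le_sq (x : ℝ) : softAbs x ≤ x ^ 2 := by
  have : √(1 + x ^ 2) ≤ 1 + x ^ 2 := by
    refine Real.sqrt_le_iff.2 ⟨by positivity, ?_⟩
    nlinarith [sq_nonneg x, sq_nonneg (x ^ 2)]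
  unfold softAbs; linarith

theorem abs_softSign_le (x : ℝ) : |softSign x| ≤ 1 := by
  have h := one_le_sqrt_one_add_sq x
  unfold softSign
  rw [abs_div, abs_of_pos (by linarith : 0 < √(1 + x ^ 2)), div_le_one (by linarith)]
  refine Real.le_sqrt_of_sq_le ?_
  rw [sq_abs]; linarith

@[fun_prop]
theorem continuous_softAbs : Continuous softAbs := by unfold softAbs; fun_prop

@[fun_prop]
theorem continuous_softSign : Continuous softSign := by
  unfold softSign
  refine Continuous.div continuous_id (by fun_prop) fun x => ?_
  linarith [one_le_sqrt_one_add_sq x]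

/-- The convexity gap is the Cauchy–Schwarz defect of the vectors (1, a) and (1, b), divided by √(1
+ a²). Its sign gives the tangent inequality, its size the quantitative version. -/
theorem softAbs_sub_eq (a b : ℝ) : softAbs b - softAbs a - softSign a * (b - a) =
    (√(1 + a ^ 2) * √(1 + b ^ 2) - (1 + a * b)) / √(1 + a ^ 2) := by
  have h := one_le_sqrt_one_add_sq a
  have hs : √(1 + a ^ 2) ^ 2 = 1 + a ^ 2 := Real.sq_sqrt (by positivity)
  have h0 : √(1 + a ^ 2) ≠ 0 := by linarith
  rw [eq_div_iff h0]
  unfold softAbs softSign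
  have e : a / √(1 + a ^ 2) * (b - a) * √(1 + a ^ 2) = a * (b - a) := by field_simp
  linear_combination -hs - e

theorem one_add_mul_le_sqrt_mul_sqrt (a b : ℝ) :
    1 + a * b ≤ √(1 + a ^ 2) * √(1 + b ^ 2) := by
  rw [← Real.sqrt_mul (by positivity)]
  refine Real.le_sqrt_of_sq_le ?_
  nlinarith [sq_nonneg (a - b)]

theorem softAbs_tangent_le (a b : ℝ) : 0 ≤ softAbs b - softAbs a - softSign a * (b - a) := by
  rw [softAbs_sub_eq]
  exact div_nonneg (sub_nonneg.2 (one_add_mul_le_sqrt_mul_sqrt a b)) (Real.sqrt_nonneg _)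

/-- This compares the remainder in `abs_arctan_sub_le` with a quantity whose expectation telescopes
along a martingale. With s = √(1 + a²), t = √(1 + b²), d = |b - a|, Lagrange's identity (st)² - (1 +
ab)² = d² bounds the gap D from below: s² ≤ 2 and t ≤ 2 + d give d² ≤ 4D(2 + d). The cases d ≤ 1 and
d ≥ 1 both lead to the constant 12. -/
theorem abs_mul_min_le_softAbs {a : ℝ} (ha : |a| ≤ 1) (b : ℝ) :
    |b - a| * min |b - a| 1 ≤ 12 * (softAbs b - softAbs a - softSign a * (b - a)) := by
  rw [softAbs_sub_eq]
  have hab := one_add_mul_le_sqrt_mul_sqrt a b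
  have h1 := one_le_sqrt_one_add_sq a
  have h2 := one_le_sqrt_one_add_sq b
  have hs : √(1 + a ^ 2) ^ 2 = 1 + a ^ 2 := Real.sq_sqrt (by positivity)
  have ht : √(1 + b ^ 2) ^ 2 = 1 + b ^ 2 := Real.sq_sqrt (by positivity)
  have hb := sqrt_one_add_sq_le b
  set s := √(1 + a ^ 2)
  set t := √(1 + b ^ 2)
  have hs2 : s ^ 2 ≤ 2 := by
    have : a ^ 2 ≤ 1 := by rw [← sq_abs]; nlinarith [abs_nonneg a]
    linarith
  set d := |b - a| with hd
  have hd0 : 0 ≤ d := abs_nonneg _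
  have htd : t ≤ 2 + d := by
    have : |b| ≤ |b - a| + |a| := by simpa using abs_add_le (b - a) a
    linarith
  have hprod : (s * t - (1 + a * b)) * (s * t + (1 + a * b)) = d ^ 2 := by
    rw [hd, sq_abs]
    have : (s * t) ^ 2 = (1 + a ^ 2) * (1 + b ^ 2) := by rw [mul_pow, hs, ht]
    nlinarith
  have hD : d ^ 2 ≤ (s * t - (1 + a * b)) * (2 * (s * t)) := by
    rw [← hprod]
    exact mul_le_mul_of_nonneg_left (by linarith) (by linarith)
  set D := (s * t - (1 + a * b)) / s with hDdef
  have hDs : s * t - (1 + a * b) = D * s := by rw [hDdef]; field_simp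
  have hD0 : 0 ≤ D := div_nonneg (by linarith) (by linarith)
  have hD2 : d ^ 2 ≤ 4 * D * (2 + d) := by
    rw [hDs] at hD
    have e1 : D * s * (2 * (s * t)) = 2 * D * t * s ^ 2 := by ring
    have e2 : 2 * D * t * s ^ 2 ≤ 2 * D * t * 2 :=
      mul_le_mul_of_nonneg_left hs2 (by positivity)
    have e3 : 2 * D * t * 2 ≤ 2 * D * (2 + d) * 2 := by gcongr
    linarith
  rcases le_total d 1 with h | h
  · rw [min_eq_left h]; nlinarith
  · rw [min_eq_right h]; nlinarith

section Transform

variable {Ω : Type*} {m0 : MeasurableSpace Ω} {P : Measure Ω}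

theorem integrable_softAbs {f : Ω → ℝ} (hf : Integrable f P) :
    Integrable (fun ω => softAbs (f ω)) P := by
  refine hf.mono (continuous_softAbs.comp_aestronglyMeasurable hf.1) (ae_of_all _ fun ω => ?_)
  simpa [abs_of_nonneg (softAbs_nonneg _)] using softAbs_le_abs (f ω)

theorem integral_sub_sub {f g h : Ω → ℝ} (hf : Integrable f P) (hg : Integrable g P)
    (hh : Integrable h P) :
    ∫ ω, (f ω - g ω - h ω) ∂P = ∫ ω, f ω ∂P - ∫ ω, g ω ∂P - ∫ ω, h ω ∂P := by
  have h1 : Integrable (fun ω => f ω - g ω) P := hf.sub hg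
  rw [integral_sub h1 hh, integral_sub hf hg]

variable [IsProbabilityMeasure P]

theorem integral_mul_martingale_sub_eq_zero {ι : Type*} [Preorder ι] {𝒢 : Filtration ι m0}
    {M : ι → Ω → ℝ} (hM : Martingale M 𝒢 P) {i j : ι} (hij : i ≤ j) {W : Ω → ℝ}
    (hW : StronglyMeasurable[𝒢 i] W) {K : ℝ} (hK : ∀ᵐ ω ∂P, |W ω| ≤ K) :
    ∫ ω, W ω * (M j ω - M i ω) ∂P = 0 := by
  have hint : Integrable (fun ω => M j ω - M i ω) P := (hM.integrable j).sub (hM.integrable i)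
  have hWint : Integrable (fun ω => W ω * (M j ω - M i ω)) P :=
    hint.bdd_mul (hW.mono (𝒢.le i)).aestronglyMeasurable (c := K) (by simpa using hK)
  have h1 : P[fun ω => W ω * (M j ω - M i ω) | 𝒢 i] =ᵐ[P]
      fun ω => W ω * (P[fun ω => M j ω - M i ω | 𝒢 i]) ω :=
    condExp_mul_of_stronglyMeasurable_left hW hWint hint
  have h2 : P[fun ω => M j ω - M i ω | 𝒢 i] =ᵐ[P] 0 := by
    have a := condExp_sub (hM.integrable j) (hM.integrable i) (𝒢 i)
    filter_upwards [a, hM.condExp_ae_eq hij, hM.condExp_ae_eq (le_refl i)] with ω h h' h''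
    have : (P[M j - M i | 𝒢 i]) ω = 0 := by rw [h, Pi.sub_apply, h', h'', sub_self]
    exact this
  rw [← integral_condExp (𝒢.le i)]
  refine (integral_congr_ae (h1.trans ?_)).trans (integral_zero _ _)
  filter_upwards [h2] with ω h
  rw [h]; simp

/-- The tangent inequality is integrated over s; its linear term has zero mean by the martingale
property, since `softSign` is bounded. -/
theorem submartingale_softAbs {𝒢 : Filtration ℕ m0} {M : ℕ → Ω → ℝ} (hM : Martingale M 𝒢 P) :
    Submartingale (fun k ω => softAbs (M k ω)) 𝒢 P := by
  refine submartingale_of_setIntegral_le_succ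
    (fun k => continuous_softAbs.comp_stronglyMeasurable (hM.stronglyAdapted k))
    (fun k => integrable_softAbs (hM.integrable k)) fun k s hs => ?_
  have hs' := 𝒢.le k s hs
  have hW : StronglyMeasurable[𝒢 k] (s.indicator fun ω => softSign (M k ω)) :=
    (continuous_softSign.comp_stronglyMeasurable (hM.stronglyAdapted k)).indicator hs
  have hb : ∀ ω, |s.indicator (fun ω => softSign (M k ω)) ω| ≤ 1 := fun ω => by
    by_cases h : ω ∈ s
    · simpa [h] using abs_softSign_le _
    · simp [h]
  have h0 := integral_mul_martingale_sub_eq_zero hM k.le_succ hW (ae_of_all _ hb)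
  have hint : Integrable (fun ω => s.indicator (fun ω => softSign (M k ω)) ω *
      (M (k + 1) ω - M k ω)) P :=
    ((hM.integrable _).sub (hM.integrable _)).bdd_mul
      (hW.mono (𝒢.le k)).aestronglyMeasurable (c := 1) (ae_of_all _ (by simpa using hb))
  have h1 := integral_sub_sub ((integrable_softAbs (hM.integrable (k + 1))).indicator hs')
    ((integrable_softAbs (hM.integrable k)).indicator hs') hint
  have h2 : 0 ≤ ∫ ω, (s.indicator (fun ω => softAbs (M (k + 1) ω)) ω -
      s.indicator (fun ω => softAbs (M k ω)) ω -
      s.indicator (fun ω => softSign (M k ω)) ω * (M (k + 1) ω - M k ω)) ∂P := by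
    refine integral_nonneg fun ω => ?_
    by_cases h : ω ∈ s
    · simpa [h] using softAbs_tangent_le (M k ω) (M (k + 1) ω)
    · simp [h]
  rw [← integral_indicator hs', ← integral_indicator hs']
  simp only [Nat.succ_eq_add_one] at h0
  linarith

/-- Doob's maximal inequality: |x| > 1 implies `softAbs x` > √2 - 1 > 1/3. -/
theorem measureReal_exists_abs_gt_one_le {𝒢 : Filtration ℕ m0} {M : ℕ → Ω → ℝ}
    (hM : Martingale M 𝒢 P) (n : ℕ) :
    P.real {ω | ∃ k ≤ n, 1 < |M k ω|} ≤ 3 * ∫ ω, softAbs (M n ω) ∂P := by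
  have hmax := maximal_ineq (submartingale_softAbs hM) (fun _ _ => softAbs_nonneg _)
    (ε := 1 / 3) n
  set S := {ω | (((1 / 3 : ℝ≥0)) : ℝ) ≤ (Finset.range (n + 1)).sup' Finset.nonempty_range_add_one
    fun k => softAbs (M k ω)} with hS
  have hsub : {ω | ∃ k ≤ n, 1 < |M k ω|} ⊆ S := by
    rintro ω ⟨k, hk, h⟩
    have h1 : (1 / 3 : ℝ) ≤ softAbs (M k ω) := by
      have : (4 / 3 : ℝ) ≤ √(1 + M k ω ^ 2) := by
        refine Real.le_sqrt_of_sq_le ?_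
        rw [← sq_abs (M k ω)]; nlinarith
      unfold softAbs; linarith
    rw [hS, Set.mem_ofPred_eq]
    refine le_trans ?_ (Finset.le_sup' (fun k => softAbs (M k ω))
      (Finset.mem_range.2 (Nat.lt_succ_of_le hk)))
    simpa using h1
  have h2 : ∫ ω in S, softAbs (M n ω) ∂P ≤ ∫ ω, softAbs (M n ω) ∂P :=
    setIntegral_le_integral (integrable_softAbs (hM.integrable n))
      (ae_of_all _ fun _ => softAbs_nonneg _)
  have h3 : (1 / 3 : ℝ) * P.real S ≤ ∫ ω in S, softAbs (M n ω) ∂P := by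
    have := ENNReal.toReal_mono ENNReal.ofReal_ne_top hmax
    rw [ENNReal.toReal_mul, ENNReal.toReal_ofReal
      (integral_nonneg fun _ => softAbs_nonneg _)] at this
    simpa [measureReal_def] using this
  have h4 : P.real {ω | ∃ k ≤ n, 1 < |M k ω|} ≤ P.real S := measureReal_mono hsub
  linarith

theorem abs_arctan_le_two (x : ℝ) : |Real.arctan x| ≤ 2 := by
  have := Real.pi_le_four
  exact abs_le.2 ⟨by linarith [Real.neg_pi_div_two_lt_arctan x],
    by linarith [Real.arctan_lt_pi_div_two x]⟩

/-- The transform is stopped once |M| exceeds 1. Before that, the linear part of each arctan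
increment has mean zero and its remainder is dominated by the convexity gap of `softAbs`, whose
expectations telescope to at most E[`softAbs` M_n]. Stopping changes the result only on an event of
probability at most 3·E[`softAbs` M_n]. The bound is uniform in the mesh, and no square
integrability is needed. -/
theorem abs_integral_arctan_transform_le {𝒢 : Filtration ℕ m0} {M : ℕ → Ω → ℝ}
    (hM : Martingale M 𝒢 P) {H : ℕ → Ω → ℝ} (hH : ∀ k, StronglyMeasurable[𝒢 k] (H k)) {K : ℝ}
    (hK : ∀ᵐ ω ∂P, ∀ k, |H k ω| ≤ K) (n : ℕ) :
    |∫ ω, Real.arctan (∑ k ∈ Finset.range n, H k ω * (M (k + 1) ω - M k ω)) ∂P| ≤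
      12 * ((K + 1) ^ 2 + 1) * ∫ ω, softAbs (M n ω) ∂P := by
  have hK0 : 0 ≤ K := by
    obtain ⟨ω, hω⟩ := hK.exists
    exact (abs_nonneg _).trans (hω 0)
  -- The event that M has not left [-1, 1] by time k. It is known at time k, so cutting the
  -- integrand off with it keeps adaptedness.
  set S : ℕ → Set Ω := fun k => {ω | ∀ j ≤ k, |M j ω| ≤ 1} with hSdef
  have hS : ∀ k, MeasurableSet[𝒢 k] (S k) := fun k => by
    have : S k = ⋂ j ∈ Set.Iic k, {ω | |M j ω| ≤ 1} := by ext; simp [hSdef]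
    rw [this]
    refine MeasurableSet.biInter (Set.to_countable _) fun j hj => ?_
    have hj' : Measurable[𝒢 k] (M j) := ((hM.stronglyAdapted j).mono (𝒢.mono hj)).measurable
    exact (continuous_abs.measurable.comp hj') measurableSet_Iic
  set H' : ℕ → Ω → ℝ := fun k => (S k).indicator (H k) with hH'def
  have hH' : ∀ k, StronglyMeasurable[𝒢 k] (H' k) := fun k => (hH k).indicator (hS k)
  have hK' : ∀ᵐ ω ∂P, ∀ k, |H' k ω| ≤ K := by
    filter_upwards [hK] with ω h k
    by_cases hk : ω ∈ S k
    · simpa [hH'def, hk] using h k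
    · simpa [hH'def, hk] using hK0
  set a : ℕ → Ω → ℝ := fun m ω => ∑ k ∈ Finset.range m, H' k ω * (M (k + 1) ω - M k ω) with hadef
  have ha : ∀ m, StronglyMeasurable[𝒢 m] (a m) := fun m => by
    refine Finset.stronglyMeasurable_fun_sum _ fun k hk => ?_
    have hk' := Finset.mem_range.1 hk
    exact ((hH' k).mono (𝒢.mono hk'.le)).mul
      (((hM.stronglyAdapted (k + 1)).mono (𝒢.mono hk')).sub
        ((hM.stronglyAdapted k).mono (𝒢.mono hk'.le)))
  have hatan : ∀ m, Integrable (fun ω => Real.arctan (a m ω)) P := fun m =>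
    (integrable_const (2 : ℝ)).mono
      (Real.continuous_arctan.comp_aestronglyMeasurable
        ((ha m).mono (𝒢.le m)).aestronglyMeasurable)
      (ae_of_all _ fun ω => by simpa using abs_arctan_le_two _)
  -- one step
  set D : ℕ → Ω → ℝ := fun k ω => softAbs (M (k + 1) ω) - softAbs (M k ω)
    - softSign (M k ω) * (M (k + 1) ω - M k ω) with hDdef
  have hsmul : ∀ k, Integrable (fun ω => softSign (M k ω) * (M (k + 1) ω - M k ω)) P := fun k =>
    ((hM.integrable _).sub (hM.integrable _)).bdd_mul
      ((continuous_softSign.comp_stronglyMeasurable (hM.stronglyAdapted k)).mono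
        (𝒢.le k)).aestronglyMeasurable (c := 1) (ae_of_all _ fun ω => by
          simpa using abs_softSign_le _)
  have hDint : ∀ k, Integrable (D k) P := fun k =>
    ((integrable_softAbs (hM.integrable _)).sub (integrable_softAbs (hM.integrable _))).sub
      (hsmul k)
  have hDeq : ∀ k, ∫ ω, D k ω ∂P = ∫ ω, softAbs (M (k + 1) ω) ∂P - ∫ ω, softAbs (M k ω) ∂P := by
    intro k
    have h0 := integral_mul_martingale_sub_eq_zero hM k.le_succ
      (continuous_softSign.comp_stronglyMeasurable (hM.stronglyAdapted k)) (K := 1)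
      (ae_of_all _ fun ω => abs_softSign_le _)
    have h1 := integral_sub_sub (integrable_softAbs (hM.integrable (k + 1)))
      (integrable_softAbs (hM.integrable k)) (hsmul k)
    simp only [Nat.succ_eq_add_one] at h0
    rw [h0, sub_zero] at h1
    exact h1
  have hstep : ∀ k, |∫ ω, Real.arctan (a (k + 1) ω) ∂P - ∫ ω, Real.arctan (a k ω) ∂P| ≤
      12 * (K + 1) ^ 2 * ∫ ω, D k ω ∂P := by
    intro k
    set W : Ω → ℝ := fun ω => (1 + a k ω ^ 2)⁻¹ * H' k ω with hWdef
    have hW : StronglyMeasurable[𝒢 k] W := by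
      refine StronglyMeasurable.mul ?_ (hH' k)
      exact Continuous.comp_stronglyMeasurable (g := fun x : ℝ => (1 + x ^ 2)⁻¹)
        (Continuous.inv₀ (by fun_prop) fun x => by positivity) (ha k)
    have hWK : ∀ᵐ ω ∂P, |W ω| ≤ K := by
      filter_upwards [hK'] with ω h
      rw [hWdef, abs_mul, abs_of_pos (by positivity)]
      refine (mul_le_of_le_one_left (abs_nonneg _) ?_).trans (h k)
      exact inv_le_one_of_one_le₀ (by nlinarith [sq_nonneg (a k ω)])
    have h0 := integral_mul_martingale_sub_eq_zero hM k.le_succ hW hWK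
    have hWint : Integrable (fun ω => W ω * (M (k + 1) ω - M k ω)) P :=
      ((hM.integrable _).sub (hM.integrable _)).bdd_mul
        (hW.mono (𝒢.le k)).aestronglyMeasurable (c := K) (by simpa using hWK)
    have e : ∫ ω, Real.arctan (a (k + 1) ω) ∂P - ∫ ω, Real.arctan (a k ω) ∂P =
        ∫ ω, (Real.arctan (a (k + 1) ω) - Real.arctan (a k ω)
          - W ω * (M (k + 1) ω - M k ω)) ∂P := by
      rw [integral_sub_sub (hatan (k + 1)) (hatan k) hWint]
      simp only [Nat.succ_eq_add_one] at h0
      rw [h0, sub_zero]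
    rw [e, ← integral_const_mul]
    refine (abs_integral_le_integral_abs).trans (integral_mono_ae
      (((hatan _).sub (hatan _)).sub hWint).abs ((hDint k).const_mul _) ?_)
    filter_upwards [hK'] with ω h
    have hk := h k
    have e1 : a (k + 1) ω = a k ω + H' k ω * (M (k + 1) ω - M k ω) := by
      simp only [hadef]; rw [Finset.sum_range_succ]
    have e2 : a (k + 1) ω - a k ω = H' k ω * (M (k + 1) ω - M k ω) := by rw [e1]; ring
    have b1 := abs_arctan_sub_le (a k ω) (a (k + 1) ω)
    rw [e2] at b1
    have e3 : W ω * (M (k + 1) ω - M k ω) =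
        (1 + a k ω ^ 2)⁻¹ * (H' k ω * (M (k + 1) ω - M k ω)) := by rw [hWdef]; ring
    rw [e3]
    refine b1.trans ?_
    by_cases hω : ω ∈ S k
    · have hMk : |M k ω| ≤ 1 := hω k le_rfl
      have b2 := abs_mul_min_le_softAbs hMk (M (k + 1) ω)
      set d := |M (k + 1) ω - M k ω| with hd
      have hd0 : 0 ≤ d := abs_nonneg _
      rw [abs_mul, ← hd]
      set q := |H' k ω| with hq
      have hq0 : 0 ≤ q := abs_nonneg _
      -- The factor K + 1 rather than K covers integrands smaller than 1, for which min(qd, 1) is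
      -- still compared with min(d, 1).
      have hmin : min (q * d) 1 ≤ (K + 1) * min d 1 := by
        rcases le_total d 1 with hd1 | hd1
        · rw [min_eq_left hd1]
          exact (min_le_left _ _).trans (by nlinarith)
        · rw [min_eq_right hd1]
          exact (min_le_right _ _).trans (by linarith)
      have hm0 : 0 ≤ min d 1 := le_min hd0 zero_le_one
      calc q * d * min (q * d) 1 ≤ ((K + 1) * d) * ((K + 1) * min d 1) := by
            refine mul_le_mul (by nlinarith) hmin (le_min (by positivity) zero_le_one)
              (by positivity)
        _ = (K + 1) ^ 2 * (d * min d 1) := by ring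
        _ ≤ (K + 1) ^ 2 * (12 * D k ω) := mul_le_mul_of_nonneg_left b2 (by positivity)
        _ = 12 * (K + 1) ^ 2 * D k ω := by ring
    · have : H' k ω = 0 := by simp [hH'def, hω]
      rw [this]
      simp only [zero_mul, abs_zero]
      exact mul_nonneg (by positivity) (softAbs_tangent_le _ _)
  have hsum : ∀ m, |∫ ω, Real.arctan (a m ω) ∂P| ≤
      12 * (K + 1) ^ 2 * (∫ ω, softAbs (M m ω) ∂P - ∫ ω, softAbs (M 0 ω) ∂P) := by
    intro m
    induction m with
    | zero => simp [hadef]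
    | succ m ih =>
      have h1 := hstep m
      rw [hDeq] at h1
      have h2 := abs_add_le (∫ ω, Real.arctan (a m ω) ∂P)
        (∫ ω, Real.arctan (a (m + 1) ω) ∂P - ∫ ω, Real.arctan (a m ω) ∂P)
      rw [add_sub_cancel] at h2
      linarith
  have hM0 : 0 ≤ ∫ ω, softAbs (M 0 ω) ∂P := integral_nonneg fun _ => softAbs_nonneg _
  set b : Ω → ℝ := fun ω => ∑ k ∈ Finset.range n, H k ω * (M (k + 1) ω - M k ω) with hbdef
  have hb : StronglyMeasurable b := by
    refine Finset.stronglyMeasurable_fun_sum _ fun k hk => ?_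
    exact ((hH k).mono (𝒢.le k)).mul
      (((hM.stronglyAdapted (k + 1)).mono (𝒢.le _)).sub ((hM.stronglyAdapted k).mono (𝒢.le _)))
  have hbint : Integrable (fun ω => Real.arctan (b ω)) P :=
    (integrable_const (2 : ℝ)).mono
      (Real.continuous_arctan.comp_aestronglyMeasurable hb.aestronglyMeasurable)
      (ae_of_all _ fun ω => by simpa using abs_arctan_le_two _)
  set E : Set Ω := {ω | ∃ k ≤ n, 1 < |M k ω|} with hEdef
  have hE : MeasurableSet E := by
    have : E = (S n)ᶜ := by ext ω; simp [hEdef, hSdef]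
    rw [this]; exact (𝒢.le n _ (hS n)).compl
  -- The original and the stopped sums agree off E; on E the two arctangents, each at most 2 in
  -- absolute value, differ by at most 4.
  have hdiff : |∫ ω, Real.arctan (b ω) ∂P - ∫ ω, Real.arctan (a n ω) ∂P| ≤ 4 * P.real E := by
    rw [← integral_sub hbint (hatan n)]
    refine abs_integral_le_integral_abs.trans ?_
    have : ∫ ω, E.indicator (fun _ => (4 : ℝ)) ω ∂P = 4 * P.real E := by
      rw [integral_indicator_const _ hE]; simp [mul_comm]
    rw [← this]
    refine integral_mono_ae (hbint.sub (hatan n)).abs ((integrable_const _).indicator hE)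
      (ae_of_all _ fun ω => ?_)
    by_cases h : ω ∈ E
    · have h1 := abs_arctan_le_two (b ω)
      have h2 := abs_arctan_le_two (a n ω)
      have h3 := abs_sub (Real.arctan (b ω)) (Real.arctan (a n ω))
      simp only [h, Set.indicator_of_mem]
      linarith
    · have hn : ∀ k ≤ n, |M k ω| ≤ 1 := by simpa [hEdef] using h
      have : b ω = a n ω := by
        refine Finset.sum_congr rfl fun k hk => ?_
        have : ω ∈ S k := fun j hj => hn j (hj.trans (Finset.mem_range.1 hk).le)
        simp [hH'def, this]
      simp [h, this]
  have hP := measureReal_exists_abs_gt_one_le hM n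
  have h1 := hsum n
  have h2 := abs_add_le (∫ ω, Real.arctan (a n ω) ∂P)
    (∫ ω, Real.arctan (b ω) ∂P - ∫ ω, Real.arctan (a n ω) ∂P)
  rw [add_sub_cancel] at h2
  have h3 : 12 * (K + 1) ^ 2 * (∫ ω, softAbs (M n ω) ∂P - ∫ ω, softAbs (M 0 ω) ∂P) ≤
      12 * (K + 1) ^ 2 * ∫ ω, softAbs (M n ω) ∂P :=
    mul_le_mul_of_nonneg_left (by linarith) (by positivity)
  calc _ ≤ _ := h2
    _ ≤ 12 * (K + 1) ^ 2 * ∫ ω, softAbs (M n ω) ∂P + 4 * (3 * ∫ ω, softAbs (M n ω) ∂P) := by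
        linarith
    _ = _ := by ring

end Transform

/-! ### Riemann–Stieltjes sums against a martingale -/

theorem abs_arctan_le_abs (x : ℝ) : |Real.arctan x| ≤ |x| := by
  have h : LipschitzWith 1 Real.arctan := by
    refine lipschitzWith_of_nnnorm_deriv_le Real.differentiable_arctan fun z => ?_
    have e : deriv Real.arctan z = (1 + z ^ 2)⁻¹ := by simp [Real.deriv_arctan]
    rw [e, ← NNReal.coe_le_coe, coe_nnnorm, Real.norm_eq_abs,
      abs_of_pos (by positivity), NNReal.coe_one]
    exact inv_le_one_of_one_le₀ (by nlinarith [sq_nonneg z])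
  simpa [Real.dist_eq] using h.dist_le_mul x 0

/-- A bounded smooth truncation of the identity at level `m + 1`. -/
def truncation (m : ℕ) (x : ℝ) : ℝ := (m + 1) * Real.arctan (x / (m + 1))

@[fun_prop]
theorem continuous_truncation (m : ℕ) : Continuous (truncation m) := by
  unfold truncation
  exact continuous_const.mul (Real.continuous_arctan.comp (by fun_prop))

theorem abs_truncation_le (m : ℕ) (x : ℝ) : |truncation m x| ≤ |x| := by
  have hm : (0 : ℝ) < m + 1 := by positivity
  unfold truncation
  rw [abs_mul, abs_of_pos hm]
  have := mul_le_mul_of_nonneg_left (abs_arctan_le_abs (x / (m + 1))) hm.le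
  rwa [abs_div, abs_of_pos hm, mul_div_cancel₀ _ hm.ne'] at this

theorem abs_truncation_le_const (m : ℕ) (x : ℝ) : |truncation m x| ≤ (m + 1) * 2 := by
  have hm : (0 : ℝ) < m + 1 := by positivity
  unfold truncation
  rw [abs_mul, abs_of_pos hm]
  exact mul_le_mul_of_nonneg_left (abs_arctan_le_two _) hm.le

theorem truncation_le_max (m : ℕ) (x : ℝ) : truncation m x ≤ max x 0 := by
  rcases le_total 0 x with h | h
  · rw [max_eq_left h]
    exact (le_abs_self _).trans ((abs_truncation_le m x).trans_eq (abs_of_nonneg h))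
  · rw [max_eq_right h]
    refine mul_nonpos_of_nonneg_of_nonpos (by positivity) ?_
    rw [← Real.arctan_zero]
    exact Real.arctan_mono (div_nonpos_of_nonpos_of_nonneg h (by positivity))

theorem tendsto_inv_nat_mul (c : ℝ) : Tendsto (fun m : ℕ => c / ((m : ℝ) + 1)) atTop (𝓝 0) := by
  have := (tendsto_one_div_add_atTop_nhds_zero_nat (𝕜 := ℝ)).const_mul c
  simpa [div_eq_mul_inv] using this

theorem tendsto_truncation (x : ℝ) : Tendsto (fun m => truncation m x) atTop (𝓝 x) := by
  rw [tendsto_iff_norm_sub_tendsto_zero]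
  refine squeeze_zero (fun _ => norm_nonneg _) (fun m => ?_) (tendsto_inv_nat_mul (x ^ 2))
  have hm : (0 : ℝ) < m + 1 := by positivity
  have h := abs_arctan_sub_le 0 (x / (m + 1))
  simp only [Real.arctan_zero, sub_zero, ne_eq, OfNat.ofNat_ne_zero, not_false_eq_true,
    zero_pow, add_zero, inv_one, one_mul] at h
  have e : truncation m x - x = (m + 1) * (Real.arctan (x / (m + 1)) - x / (m + 1)) := by
    unfold truncation; field_simp
  rw [Real.norm_eq_abs, e, abs_mul, abs_of_pos hm]
  calc _ ≤ (m + 1) * (|x / (m + 1)| * |x / (m + 1)|) :=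
        mul_le_mul_of_nonneg_left (h.trans (mul_le_mul_of_nonneg_left (min_le_left _ _)
          (abs_nonneg _))) hm.le
    _ = _ := by rw [abs_mul_abs_self]; field_simp

section Integral

variable {Ω : Type*} {m0 : MeasurableSpace Ω} {P : Measure Ω}

/-- Linear growth of `softAbs` gives the dominating function |f|, and its quadratic behaviour at 0
gives the pointwise bound f²/(m + 1). Thus integrability of f is enough. -/
theorem tendsto_integral_scaled_softAbs {f : Ω → ℝ} (hf : Integrable f P) :
    Tendsto (fun m : ℕ => (m + 1 : ℝ) * ∫ ω, softAbs (((m : ℝ) + 1)⁻¹ * f ω) ∂P) atTop (𝓝 0) := by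
  simp_rw [← integral_const_mul]
  rw [← integral_zero Ω ℝ (μ := P)]
  refine tendsto_integral_of_dominated_convergence (fun ω => |f ω|)
    (fun m => ?_) hf.abs (fun m => ae_of_all _ fun ω => ?_) (ae_of_all _ fun ω => ?_)
  · exact (continuous_softAbs.comp_aestronglyMeasurable (hf.1.const_mul _)).const_mul _
  · have hm : (0 : ℝ) < m + 1 := by positivity
    rw [Real.norm_eq_abs, abs_of_nonneg (mul_nonneg hm.le (softAbs_nonneg _))]
    have := mul_le_mul_of_nonneg_left (softAbs_le_abs (((m : ℝ) + 1)⁻¹ * f ω)) hm.le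
    rwa [abs_mul, abs_of_pos (inv_pos.2 hm), mul_inv_cancel_left₀ hm.ne'] at this
  · refine squeeze_zero (fun m => mul_nonneg (by positivity) (softAbs_nonneg _)) (fun m => ?_)
      (tendsto_inv_nat_mul ((f ω) ^ 2))
    have hm : (0 : ℝ) < m + 1 := by positivity
    have := mul_le_mul_of_nonneg_left (softAbs_le_sq (((m : ℝ) + 1)⁻¹ * f ω)) hm.le
    refine this.trans_eq ?_
    field_simp

variable [IsProbabilityMeasure P]

theorem integrable_truncation {A : Ω → ℝ} (hA : AEStronglyMeasurable A P) (m : ℕ) :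
    Integrable (fun ω => truncation m (A ω)) P :=
  (integrable_const ((m + 1 : ℝ) * 2)).mono
    ((continuous_truncation m).comp_aestronglyMeasurable hA)
    (ae_of_all _ fun ω => by
      rw [Real.norm_eq_abs, Real.norm_eq_abs]
      exact (abs_truncation_le_const m _).trans (le_abs_self _))

theorem integral_eq_zero_of_tendsto_truncation {A : Ω → ℝ} (hA : Integrable A P)
    (h0 : Tendsto (fun m => ∫ ω, truncation m (A ω) ∂P) atTop (𝓝 0)) : ∫ ω, A ω ∂P = 0 := by
  refine tendsto_nhds_unique ?_ h0
  refine tendsto_integral_of_dominated_convergence (fun ω => |A ω|)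
    (fun m => (integrable_truncation hA.1 m).1) hA.abs
    (fun m => ae_of_all _ fun ω => abs_truncation_le m _)
    (ae_of_all _ fun ω => tendsto_truncation _)

/-- Truncation never exceeds A⁺, and the truncated expectations are bounded below because they
converge. So the negative parts of the truncations have bounded integrals, and Fatou's lemma passes
this bound to A⁻. -/
theorem integrable_of_tendsto_truncation {A : Ω → ℝ} (hA : AEStronglyMeasurable A P)
    (h0 : Tendsto (fun m => ∫ ω, truncation m (A ω) ∂P) atTop (𝓝 0))
    (hpos : ∫⁻ ω, ENNReal.ofReal (A ω) ∂P ≠ ∞) : Integrable A P := by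
  obtain ⟨B, hB⟩ := h0.abs.bddAbove_range
  have hneg : ∫⁻ ω, ENNReal.ofReal (-A ω) ∂P ≤
      ENNReal.ofReal ((∫⁻ ω, ENNReal.ofReal (A ω) ∂P).toReal + B) := by
    have hlim : ∀ ω, Tendsto (fun m => ENNReal.ofReal (-truncation m (A ω))) atTop
        (𝓝 (ENNReal.ofReal (-A ω))) := fun ω =>
      ENNReal.tendsto_ofReal (tendsto_truncation (A ω)).neg
    calc ∫⁻ ω, ENNReal.ofReal (-A ω) ∂P
        = ∫⁻ ω, liminf (fun m => ENNReal.ofReal (-truncation m (A ω))) atTop ∂P :=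
          lintegral_congr fun ω => (hlim ω).liminf_eq.symm
      _ ≤ liminf (fun m => ∫⁻ ω, ENNReal.ofReal (-truncation m (A ω)) ∂P) atTop :=
          lintegral_liminf_le' fun m =>
            ((integrable_truncation hA m).1.aemeasurable.neg).ennreal_ofReal
      _ ≤ _ := by
        refine liminf_le_of_le (by isBoundedDefault) fun b hb => ?_
        obtain ⟨m, hm⟩ := hb.exists
        refine hm.trans ?_
        have hint := integrable_truncation hA m
        have e := integral_eq_lintegral_pos_part_sub_lintegral_neg_part hint
        have hfin : ∫⁻ ω, ENNReal.ofReal (-truncation m (A ω)) ∂P ≠ ∞ := by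
          have := hint.neg.lintegral_lt_top
          exact this.ne
        have hle : ∫⁻ ω, ENNReal.ofReal (truncation m (A ω)) ∂P ≤
            ∫⁻ ω, ENNReal.ofReal (A ω) ∂P := lintegral_mono fun ω => by
          have := ENNReal.ofReal_le_ofReal (truncation_le_max m (A ω))
          rwa [ENNReal.ofReal_max, ENNReal.ofReal_zero, max_eq_left zero_le] at this
        have hle' := ENNReal.toReal_mono hpos hle
        have hBm := hB ⟨m, rfl⟩
        rw [← ENNReal.ofReal_toReal hfin]
        refine ENNReal.ofReal_le_ofReal ?_
        have := (abs_le.1 hBm).1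
        linarith
  refine ⟨hA, ?_⟩
  rw [hasFiniteIntegral_iff_norm]
  have : ∀ ω, ENNReal.ofReal ‖A ω‖ ≤ ENNReal.ofReal (A ω) + ENNReal.ofReal (-A ω) := fun ω => by
    rcases le_total 0 (A ω) with h | h
    · rw [Real.norm_of_nonneg h]; exact le_self_add
    · rw [Real.norm_of_nonpos h]; exact le_add_self
  refine (lintegral_mono this).trans_lt ?_
  rw [lintegral_add_left' hA.aemeasurable.ennreal_ofReal]
  exact ENNReal.add_lt_top.2 ⟨hpos.lt_top, hneg.trans_lt ENNReal.ofReal_lt_top⟩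

/-- The `k`-th point of the partition of `[0, T]` into `n` intervals of equal length. -/
def grid (T : ℝ≥0) (n k : ℕ) : ℝ≥0 := T * k / n

theorem grid_mono (T : ℝ≥0) (n : ℕ) : Monotone (grid T n) := fun i j h => by
  unfold grid; gcongr

@[simp] theorem grid_zero (T : ℝ≥0) (n : ℕ) : grid T n 0 = 0 := by simp [grid]

theorem grid_self (T : ℝ≥0) {n : ℕ} (hn : n ≠ 0) : grid T n n = T := by
  have : (n : ℝ≥0) ≠ 0 := by exact_mod_cast hn
  unfold grid; field_simp

theorem grid_le (T : ℝ≥0) {n k : ℕ} (hk : k ≤ n) : grid T n k ≤ T := by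
  rcases eq_or_ne n 0 with rfl | hn
  · simp [grid]
  · exact (grid_mono T n hk).trans_eq (grid_self T hn)

/-- The Riemann–Stieltjes sum of `X` (evaluated at the right end points) against `H`. -/
def stieltjesSum (H X : ℝ≥0 → Ω → ℝ) (T : ℝ≥0) (n : ℕ) (ω : Ω) : ℝ :=
  ∑ k ∈ Finset.range n, (H (grid T n (k + 1)) ω - H (grid T n k) ω) * X (grid T n (k + 1)) ω

/-- A filtration sampled along a monotone sequence of times. -/
def sampled (𝒢 : Filtration ℝ≥0 m0) {t : ℕ → ℝ≥0} (ht : Monotone t) : Filtration ℕ m0 where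
  seq k := 𝒢 (t k)
  mono' _ _ h := 𝒢.mono (ht h)
  le' k := 𝒢.le (t k)

variable {𝒢 : Filtration ℝ≥0 m0} {X H : ℝ≥0 → Ω → ℝ} {T : ℝ≥0} {K : ℝ} {A : Ω → ℝ}

/-- Summation by parts: the boundary terms vanish with H at 0 and T, which leaves a martingale
transform with integrand -H at the left end points. The arctan estimate is applied to the rescaled
martingale X/(m + 1). -/
theorem abs_integral_truncation_stieltjesSum_le (hX : Martingale X 𝒢 P)
    (hH : ∀ t, StronglyMeasurable[𝒢 t] (H t)) (hK : ∀ᵐ ω ∂P, ∀ t ≤ T, |H t ω| ≤ K)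
    (hK0 : 0 ≤ K)
    (h0 : ∀ᵐ ω ∂P, H 0 ω = 0) (hT : ∀ᵐ ω ∂P, H T ω = 0) {n : ℕ} (hn : n ≠ 0) (m : ℕ) :
    |∫ ω, truncation m (stieltjesSum H X T n ω) ∂P| ≤ 12 * ((K + 1) ^ 2 + 1) *
      ((m + 1) * ∫ ω, softAbs (((m : ℝ) + 1)⁻¹ * X T ω) ∂P) := by
  have hm : (0 : ℝ) < m + 1 := by positivity
  set M : ℕ → Ω → ℝ := fun k ω => ((m : ℝ) + 1)⁻¹ * X (grid T n k) ω with hMdef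
  have hM : Martingale M (sampled 𝒢 (grid_mono T n)) P := by
    have h1 := hX.smul ((m : ℝ) + 1)⁻¹
    exact ⟨fun k => h1.1 (grid T n k), fun i j hij => h1.2 _ _ (grid_mono T n hij)⟩
  -- H is bounded only up to T, so the integrand is set to 0 beyond the last grid interval.
  set H' : ℕ → Ω → ℝ := fun k ω => if k < n then -H (grid T n k) ω else 0 with hH'def
  have hH' : ∀ k, StronglyMeasurable[sampled 𝒢 (grid_mono T n) k] (H' k) := fun k => by
    by_cases hk : k < n
    · simp only [hH'def, hk, if_true]; exact (hH (grid T n k)).neg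
    · simp only [hH'def, hk, if_false]; exact stronglyMeasurable_const
  have hK' : ∀ᵐ ω ∂P, ∀ k, |H' k ω| ≤ K := by
    filter_upwards [hK] with ω h k
    by_cases hk : k < n
    · simpa [hH'def, hk] using h _ (grid_le T hk.le)
    · simpa [hH'def, hk] using hK0
  have key := abs_integral_arctan_transform_le hM hH' hK' n
  have e : ∫ ω, truncation m (stieltjesSum H X T n ω) ∂P = (m + 1) * ∫ ω, Real.arctan
      (∑ k ∈ Finset.range n, H' k ω * (M (k + 1) ω - M k ω)) ∂P := by
    rw [← integral_const_mul]
    refine integral_congr_ae ?_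
    filter_upwards [h0, hT] with ω h0 hT
    have parts : ∀ j ≤ n, ∑ k ∈ Finset.range j, (H (grid T n (k + 1)) ω - H (grid T n k) ω) *
        X (grid T n (k + 1)) ω = H (grid T n j) ω * X (grid T n j) ω - H 0 ω * X 0 ω +
        (m + 1) * ∑ k ∈ Finset.range j, H' k ω * (M (k + 1) ω - M k ω) := by
      intro j
      induction j with
      | zero => simp
      | succ j ih =>
        intro hj
        rw [Finset.sum_range_succ, Finset.sum_range_succ, ih (by omega), mul_add]
        have : (m + 1) * (H' j ω * (M (j + 1) ω - M j ω)) =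
            -H (grid T n j) ω * (X (grid T n (j + 1)) ω - X (grid T n j) ω) := by
          have hj' : j < n := by omega
          simp only [hH'def, hMdef, hj', if_true]
          field_simp
        rw [this]; ring
    have := parts n le_rfl
    rw [grid_self T hn, hT, h0, zero_mul, zero_mul, sub_zero, zero_add] at this
    rw [stieltjesSum, truncation, this, mul_div_cancel_left₀ _ hm.ne']
  have hMn : ∫ ω, softAbs (M n ω) ∂P = ∫ ω, softAbs (((m : ℝ) + 1)⁻¹ * X T ω) ∂P := by
    simp only [hMdef, grid_self T hn]
  rw [e, abs_mul, abs_of_pos hm, ← hMn]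
  calc _ ≤ (m + 1) * (12 * ((K + 1) ^ 2 + 1) * ∫ ω, softAbs (M n ω) ∂P) :=
        mul_le_mul_of_nonneg_left key hm.le
    _ = _ := by ring

theorem stronglyMeasurable_stieltjesSum (hX : ∀ t, StronglyMeasurable (X t))
    (hH : ∀ t, StronglyMeasurable (H t)) (n : ℕ) : StronglyMeasurable (stieltjesSum H X T n) := by
  unfold stieltjesSum
  exact Finset.stronglyMeasurable_fun_sum _ fun k _ => ((hH _).sub (hH _)).mul (hX _)

theorem aestronglyMeasurable_of_tendsto_stieltjesSum (hX : ∀ t, StronglyMeasurable (X t))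
    (hH : ∀ t, StronglyMeasurable (H t))
    (hA : ∀ᵐ ω ∂P, Tendsto (fun n => stieltjesSum H X T n ω) atTop (𝓝 (A ω))) :
    AEStronglyMeasurable A P :=
  aestronglyMeasurable_of_tendsto_ae atTop
    (fun n => (stronglyMeasurable_stieltjesSum hX hH n).aestronglyMeasurable) hA

/-- The bound on the grid does not depend on n, so it survives the limit n → ∞ at fixed m; then m →
∞. -/
theorem tendsto_integral_truncation_stieltjes (hX : Martingale X 𝒢 P)
    (hH : ∀ t, StronglyMeasurable[𝒢 t] (H t)) (hK : ∀ᵐ ω ∂P, ∀ t ≤ T, |H t ω| ≤ K)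
    (h0 : ∀ᵐ ω ∂P, H 0 ω = 0) (hT : ∀ᵐ ω ∂P, H T ω = 0)
    (hA : ∀ᵐ ω ∂P, Tendsto (fun n => stieltjesSum H X T n ω) atTop (𝓝 (A ω))) :
    Tendsto (fun m => ∫ ω, truncation m (A ω) ∂P) atTop (𝓝 0) := by
  have hK0 : 0 ≤ K := by
    obtain ⟨ω, hω⟩ := hK.exists
    exact (abs_nonneg _).trans (hω 0 zero_le)
  have hX' : ∀ t, StronglyMeasurable (X t) := fun t => (hX.stronglyAdapted t).mono (𝒢.le t)
  have hH' : ∀ t, StronglyMeasurable (H t) := fun t => (hH t).mono (𝒢.le t)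
  have hbound : ∀ m : ℕ, |∫ ω, truncation m (A ω) ∂P| ≤ 12 * ((K + 1) ^ 2 + 1) *
      ((m + 1) * ∫ ω, softAbs (((m : ℝ) + 1)⁻¹ * X T ω) ∂P) := by
    intro m
    have hlim : Tendsto (fun n => ∫ ω, truncation m (stieltjesSum H X T n ω) ∂P) atTop
        (𝓝 (∫ ω, truncation m (A ω) ∂P)) := by
      refine tendsto_integral_of_dominated_convergence (fun _ => (m + 1 : ℝ) * 2)
        (fun n => (integrable_truncation
          (stronglyMeasurable_stieltjesSum hX' hH' n).aestronglyMeasurable m).1)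
        (integrable_const _) (fun n => ae_of_all _ fun ω => abs_truncation_le_const m _) ?_
      filter_upwards [hA] with ω h
      exact ((continuous_truncation m).tendsto _).comp h
    refine le_of_tendsto hlim.abs ?_
    filter_upwards [eventually_ne_atTop 0] with n hn
    exact abs_integral_truncation_stieltjesSum_le hX hH hK hK0 h0 hT hn m
  refine squeeze_zero_norm hbound ?_
  simpa using (tendsto_integral_scaled_softAbs (hX.integrable T)).const_mul
    (12 * ((K + 1) ^ 2 + 1))

/-- The submartingale property of |X| against the weight |W|: multiplying |W| by the sign of X_s
gives a bounded weight known at time s, for which the martingale property is an equality. -/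
theorem integral_mul_abs_martingale_le (hX : Martingale X 𝒢 P) {s t : ℝ≥0} (hst : s ≤ t)
    {W : Ω → ℝ} (hW : StronglyMeasurable[𝒢 s] W) (hK : ∀ᵐ ω ∂P, |W ω| ≤ K) :
    ∫ ω, |W ω| * |X s ω| ∂P ≤ ∫ ω, |W ω| * |X t ω| ∂P := by
  set V : Ω → ℝ := fun ω => |W ω| * SignType.sign (X s ω) with hV
  have hsign : StronglyMeasurable[𝒢 s] fun ω => ((SignType.sign (X s ω) : SignType) : ℝ) := by
    have : Measurable fun x : ℝ => ((SignType.sign x : SignType) : ℝ) := by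
      have : (fun x : ℝ => ((SignType.sign x : SignType) : ℝ)) =
          fun x => if 0 < x then 1 else if x < 0 then -1 else 0 := by
        funext x; simp only [sign_apply]; split_ifs <;> simp
      rw [this]
      exact Measurable.ite measurableSet_Ioi measurable_const
        (Measurable.ite measurableSet_Iio measurable_const measurable_const)
    exact (this.comp (hX.stronglyAdapted s).measurable).stronglyMeasurable
  have hVm : StronglyMeasurable[𝒢 s] V :=
    (continuous_abs.comp_stronglyMeasurable hW).mul hsign
  have hs1 : ∀ x : ℝ, |((SignType.sign x : SignType) : ℝ)| ≤ 1 := fun x => by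
    rcases lt_trichotomy x 0 with h | h | h <;> simp [h]
  have hVK : ∀ᵐ ω ∂P, |V ω| ≤ K := by
    filter_upwards [hK] with ω h
    rw [hV, abs_mul, abs_abs]
    exact (mul_le_of_le_one_right (abs_nonneg _) (hs1 _)).trans h
  have hz := integral_mul_martingale_sub_eq_zero hX hst hVm hVK
  have hint : ∀ u, Integrable (fun ω => V ω * X u ω) P := fun u =>
    (hX.integrable u).bdd_mul (hVm.mono (𝒢.le s)).aestronglyMeasurable (c := K)
      (by simpa using hVK)
  have hint' : Integrable (fun ω => |W ω| * |X t ω|) P :=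
    (hX.integrable t).abs.bdd_mul (c := K)
      (continuous_abs.comp_stronglyMeasurable (hW.mono (𝒢.le s))).aestronglyMeasurable
      (by simpa using hK)
  have e : ∫ ω, V ω * X t ω ∂P = ∫ ω, V ω * X s ω ∂P := by
    rw [← sub_eq_zero, ← integral_sub (hint t) (hint s), ← hz]
    exact integral_congr_ae (ae_of_all _ fun ω => by ring)
  have e2 : ∀ ω, |W ω| * |X s ω| = V ω * X s ω := fun ω => by
    rw [hV]; simp only; rw [mul_assoc, sign_mul_self]
  simp_rw [e2]
  rw [← e]
  refine integral_mono (hint t) hint' fun ω => ?_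
  simp only [hV]
  rw [mul_assoc]
  refine mul_le_mul_of_nonneg_left ((le_abs_self _).trans ?_) (abs_nonneg _)
  rw [abs_mul]
  exact mul_le_of_le_one_left (abs_nonneg _) (hs1 _)

/-- Each increment of H is known at the right end point of its interval, where X is evaluated, so
|X| there may be replaced by |X_T| in expectation. Hence every sum has L¹ norm at most V·E|X_T|, and
Fatou's lemma applies. This serves the explicit strategy, for which integrability must be shown
directly. -/
theorem integrable_of_tendsto_stieltjesSum_of_variation_le (hX : Martingale X 𝒢 P)
    (hH : ∀ t, StronglyMeasurable[𝒢 t] (H t)) {V : ℝ}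
    (hV : ∀ᵐ ω ∂P, ∀ n, ∑ k ∈ Finset.range n,
      |H (grid T n (k + 1)) ω - H (grid T n k) ω| ≤ V)
    (hA : ∀ᵐ ω ∂P, Tendsto (fun n => stieltjesSum H X T n ω) atTop (𝓝 (A ω))) :
    Integrable A P := by
  have hX' : ∀ t, StronglyMeasurable (X t) := fun t => (hX.stronglyAdapted t).mono (𝒢.le t)
  have hH' : ∀ t, StronglyMeasurable (H t) := fun t => (hH t).mono (𝒢.le t)
  have hAm := aestronglyMeasurable_of_tendsto_stieltjesSum hX' hH' hA
  refine ⟨hAm, ?_⟩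
  have hbound : ∀ n, ∫⁻ ω, ENNReal.ofReal ‖stieltjesSum H X T n ω‖ ∂P ≤
      ENNReal.ofReal (V * ∫ ω, |X T ω| ∂P) := by
    intro n
    set W : ℕ → Ω → ℝ := fun k ω => H (grid T n (k + 1)) ω - H (grid T n k) ω with hW
    have hWm : ∀ k, StronglyMeasurable[𝒢 (grid T n (k + 1))] (W k) := fun k =>
      (hH _).sub ((hH _).mono (𝒢.mono (grid_mono T n k.le_succ)))
    have hWV : ∀ k < n, ∀ᵐ ω ∂P, |W k ω| ≤ V := fun k hk => by
      filter_upwards [hV] with ω h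
      exact (Finset.single_le_sum (f := fun k => |W k ω|) (fun _ _ => abs_nonneg _)
        (Finset.mem_range.2 hk)).trans (h n)
    have hint : ∀ k < n, ∀ u, Integrable (fun ω => |W k ω| * |X u ω|) P := fun k hk u =>
      (hX.integrable u).abs.bdd_mul (c := V) (continuous_abs.comp_stronglyMeasurable
        ((hWm k).mono (𝒢.le _))).aestronglyMeasurable (by simpa using hWV k hk)
    have hsumint : ∀ u : ℕ → ℝ≥0, Integrable
        (fun ω => ∑ k ∈ Finset.range n, |W k ω| * |X (u k) ω|) P := fun u =>
      integrable_finsetSum _ fun k hk => hint k (Finset.mem_range.1 hk) _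
    calc ∫⁻ ω, ENNReal.ofReal ‖stieltjesSum H X T n ω‖ ∂P
        ≤ ∫⁻ ω, ENNReal.ofReal (∑ k ∈ Finset.range n,
            |W k ω| * |X (grid T n (k + 1)) ω|) ∂P := by
          refine lintegral_mono fun ω => ENNReal.ofReal_le_ofReal ?_
          refine (norm_sum_le _ _).trans (Finset.sum_le_sum fun k _ => ?_)
          rw [norm_mul, Real.norm_eq_abs, Real.norm_eq_abs]
      _ = ENNReal.ofReal (∫ ω, ∑ k ∈ Finset.range n,
            |W k ω| * |X (grid T n (k + 1)) ω| ∂P) :=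
          (ofReal_integral_eq_lintegral_ofReal (hsumint _) (ae_of_all _ fun ω =>
            Finset.sum_nonneg fun k _ => by positivity)).symm
      _ ≤ ENNReal.ofReal (∫ ω, ∑ k ∈ Finset.range n, |W k ω| * |X T ω| ∂P) := by
          refine ENNReal.ofReal_le_ofReal ?_
          rw [integral_finsetSum _ fun k hk => hint k (Finset.mem_range.1 hk) _,
            integral_finsetSum _ fun k hk => hint k (Finset.mem_range.1 hk) _]
          exact Finset.sum_le_sum fun k hk => integral_mul_abs_martingale_le hX
            (grid_le T (Finset.mem_range.1 hk)) (hWm k) (hWV k (Finset.mem_range.1 hk))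
      _ ≤ _ := by
          refine ENNReal.ofReal_le_ofReal ?_
          rw [← integral_const_mul]
          refine integral_mono_ae (hsumint fun _ => T) ((hX.integrable T).abs.const_mul _) ?_
          filter_upwards [hV] with ω h
          rw [← Finset.sum_mul]
          exact mul_le_mul_of_nonneg_right (h n) (abs_nonneg _)
  rw [hasFiniteIntegral_iff_norm]
  refine lt_of_le_of_lt ?_ (ENNReal.ofReal_lt_top (r := V * ∫ ω, |X T ω| ∂P))
  calc ∫⁻ ω, ENNReal.ofReal ‖A ω‖ ∂P
      = ∫⁻ ω, liminf (fun n => ENNReal.ofReal ‖stieltjesSum H X T n ω‖) atTop ∂P := by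
        refine lintegral_congr_ae ?_
        filter_upwards [hA] with ω h
        exact (ENNReal.tendsto_ofReal h.norm).liminf_eq.symm
    _ ≤ liminf (fun n => ∫⁻ ω, ENNReal.ofReal ‖stieltjesSum H X T n ω‖ ∂P) atTop :=
        lintegral_liminf_le' fun n => ((stronglyMeasurable_stieltjesSum hX' hH'
          n).aestronglyMeasurable.norm.aemeasurable).ennreal_ofReal
    _ ≤ _ := by
        refine liminf_le_of_le (by isBoundedDefault) fun b hb => ?_
        obtain ⟨n, hn⟩ := hb.exists
        exact hn.trans (hbound n)

end Integral

/-! ### Measurability with respect to an arbitrary σ-algebra. -/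

theorem measurable_of_preimage_Iic {Ω : Type*} {m : MeasurableSpace Ω} {f : Ω → ℝ≥0}
    (h : ∀ t, MeasurableSet (f ⁻¹' Set.Iic t)) : Measurable f := measurable_of_Iic h

theorem measurable_ite_le {Ω : Type*} {m : MeasurableSpace Ω} {f : Ω → ℝ≥0} (hf : Measurable f)
    (t : ℝ≥0) (x : ℝ) : Measurable fun ω => if f ω ≤ t then x else 0 :=
  Measurable.ite (measurableSet_le hf measurable_const) measurable_const measurable_const

open Classical in
theorem measurable_iInf_ite {Ω ι : Type*} [Countable ι] {m : MeasurableSpace Ω} {B : ι → Set Ω}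
    (hB : ∀ i, MeasurableSet (B i)) (c : ι → ℝ≥0∞) :
    Measurable fun ω => ⨅ i, if ω ∈ B i then c i else ∞ :=
  Measurable.iInf fun i => Measurable.ite (hB i) measurable_const measurable_const

theorem measurableSet_limsup_nat {Ω : Type*} {m : MeasurableSpace Ω} {B : ℕ → Set Ω}
    (hB : ∀ i, MeasurableSet (B i)) : MeasurableSet (limsup B atTop) :=
  MeasurableSet.measurableSet_limsup hB

/-! ### Enlargement by independent information -/

section Enlargement

variable {Ω : Type*} {m0 : MeasurableSpace Ω} {P : Measure Ω}

/-- The measurable sets that agree almost surely with a set of `m`. -/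
@[reducible]
def aeCompletion (P : Measure Ω) (m : MeasurableSpace Ω) : MeasurableSpace Ω :=
  eventuallyMeasurableSpace m (ae P) ⊓ m0

theorem aeCompletion_le (m : MeasurableSpace Ω) : aeCompletion P m ≤ m0 := inf_le_right

theorem measurableSet_aeCompletion {m : MeasurableSpace Ω} {s t : Set Ω}
    (hs : MeasurableSet[m0] s) (ht : MeasurableSet[m] t) (hst : s =ᵐ[P] t) :
    MeasurableSet[aeCompletion P m] s :=
  MeasurableSpace.measurableSet_inf.2 ⟨⟨t, ht, hst⟩, hs⟩

theorem measurable_aeCompletion_congr {m : MeasurableSpace Ω} {β : Type*} [MeasurableSpace β]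
    {f g : Ω → β} (hf : Measurable[m0] f) (hg : Measurable[aeCompletion P m] g) (hfg : f =ᵐ[P] g) :
    Measurable[aeCompletion P m] f := by
  intro s hs
  obtain ⟨⟨t, ht, hgt⟩, -⟩ := MeasurableSpace.measurableSet_inf.1 (hg hs)
  refine measurableSet_aeCompletion (hf hs) ht (EventuallyEq.trans ?_ hgt)
  filter_upwards [hfg] with ω h
  exact congrArg s h

theorem indep_aeCompletion {m₁ m₂ : MeasurableSpace Ω} (h : Indep m₁ m₂ P) :
    Indep m₁ (aeCompletion P m₂) P := by
  rw [Indep_iff] at h ⊢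
  intro A B hA hB
  obtain ⟨⟨B', hB', hBB'⟩, -⟩ := MeasurableSpace.measurableSet_inf.1 hB
  rw [measure_congr hBB', ← h A B' hA hB']
  exact measure_congr ((EventuallyEq.refl _ A).inter hBB')

variable [IsProbabilityMeasure P] {ι : Type*} [Preorder ι]

/-- On a rectangle A ∩ B independence factors the integral into P(B) and an integral over A, to
which the martingale property applies; rectangles form a π-system generating the join. -/
theorem setIntegral_martingale_eq_of_indep {m' : MeasurableSpace Ω} (hm' : m' ≤ m0)
    {ℱ : Filtration ι m0} (hind : Indep (⨆ t, ℱ t : MeasurableSpace Ω) m' P) {X : ι → Ω → ℝ}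
    (hX : Martingale X ℱ P) {s u : ι} (hsu : s ≤ u) {A : Set Ω}
    (hA : MeasurableSet[ℱ s ⊔ m'] A) : ∫ ω in A, X u ω ∂P = ∫ ω in A, X s ω ∂P := by
  have hle : (⨆ t, ℱ t : MeasurableSpace Ω) ≤ m0 := iSup_le ℱ.le
  have hgen : ℱ s ⊔ m' = MeasurableSpace.generateFrom
      {C | ∃ A B, MeasurableSet[ℱ s] A ∧ MeasurableSet[m'] B ∧ C = A ∩ B} := by
    refine le_antisymm (sup_le (fun A hA => ?_) fun B hB => ?_)
      (MeasurableSpace.generateFrom_le ?_)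
    · exact MeasurableSpace.measurableSet_generateFrom
        ⟨A, Set.univ, hA, MeasurableSet.univ, by simp⟩
    · exact MeasurableSpace.measurableSet_generateFrom
        ⟨Set.univ, B, MeasurableSet.univ, hB, by simp⟩
    · rintro _ ⟨A, B, hA, hB, rfl⟩
      exact @MeasurableSet.inter _ (ℱ s ⊔ m') _ _
        (le_sup_left (a := ℱ s) (b := m') _ hA) (le_sup_right (a := ℱ s) (b := m') _ hB)
  have hpi : IsPiSystem {C | ∃ A B, MeasurableSet[ℱ s] A ∧ MeasurableSet[m'] B ∧ C = A ∩ B} := by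
    rintro _ ⟨A, B, hA, hB, rfl⟩ _ ⟨A', B', hA', hB', rfl⟩ -
    exact ⟨A ∩ A', B ∩ B', @MeasurableSet.inter _ (ℱ s) _ _ hA hA',
      @MeasurableSet.inter _ m' _ _ hB hB', by
      rw [Set.inter_inter_inter_comm]⟩
  have hsup : ℱ s ⊔ m' ≤ m0 := sup_le (ℱ.le s) hm'
  have hprod : ∀ v, s ≤ v → ∀ A B, MeasurableSet[ℱ s] A → MeasurableSet[m'] B →
      ∫ ω in A ∩ B, X v ω ∂P = (∫ ω in A, X s ω ∂P) * P.real B := by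
    intro v hv A B hA hB
    have hXA : StronglyMeasurable[⨆ t, ℱ t] (A.indicator (X v)) :=
      ((hX.stronglyAdapted v).mono (le_iSup (fun t => (ℱ t : MeasurableSpace Ω)) v)).indicator
        (le_iSup (fun t => (ℱ t : MeasurableSpace Ω)) s _ hA)
    have hc := condExp_indep_eq hle hm' hXA hind
    have hint : Integrable (A.indicator (X v)) P := (hX.integrable v).indicator (ℱ.le s _ hA)
    rw [Set.inter_comm, ← setIntegral_indicator (ℱ.le s _ hA), ← setIntegral_condExp hm' hint hB,
      setIntegral_congr_ae (g := fun _ => ∫ ω, A.indicator (X v) ω ∂P) (hm' _ hB)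
        (hc.mono fun ω h _ => h), setIntegral_const, integral_indicator (ℱ.le s _ hA),
      hX.setIntegral_eq hv hA, smul_eq_mul, mul_comm]
  induction A, hA using MeasurableSpace.induction_on_inter hgen hpi with
  | empty => simp
  | basic C hC =>
    obtain ⟨A, B, hA, hB, rfl⟩ := hC
    rw [hprod u hsu A B hA hB, hprod s le_rfl A B hA hB]
  | compl C hC ih =>
    have h1 := integral_add_compl (hsup _ hC) (hX.integrable u)
    have h2 := integral_add_compl (hsup _ hC) (hX.integrable s)
    -- Passing to complements requires equality of the total expectations, which is the case A = B =
    -- Ω.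
    have h3 := hprod u hsu Set.univ Set.univ MeasurableSet.univ MeasurableSet.univ
    have h4 := hprod s le_rfl Set.univ Set.univ MeasurableSet.univ MeasurableSet.univ
    simp only [Set.inter_self, setIntegral_univ, probReal_univ, mul_one] at h3 h4
    linarith
  | iUnion C hd hC ih =>
    rw [integral_iUnion (fun n => hsup _ (hC n)) hd (hX.integrable u).integrableOn,
      integral_iUnion (fun n => hsup _ (hC n)) hd (hX.integrable s).integrableOn]
    exact tsum_congr ih

/-- All X at times s n are conditional expectations of X_u, hence uniformly integrable, so pointwise
convergence improves to L¹ convergence. -/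
theorem tendsto_setIntegral_martingale {ℱ : Filtration ℝ≥0 m0} {X : ℝ≥0 → Ω → ℝ}
    (hX : Martingale X ℱ P) {s : ℕ → ℝ≥0} {t u : ℝ≥0} (hs : ∀ n, s n ≤ u)
    (hlim : ∀ ω, Tendsto (fun n => X (s n) ω) atTop (𝓝 (X t ω))) (A : Set Ω) :
    Tendsto (fun n => ∫ ω in A, X (s n) ω ∂P) atTop (𝓝 (∫ ω in A, X t ω ∂P)) := by
  refine tendsto_setIntegral_of_L1' _ (hX.integrable t).1
    (Eventually.of_forall fun n => hX.integrable (s n)) ?_ A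
  have hui : UnifIntegrable (fun n => X (s n)) 1 P := by
    have := ((hX.integrable u).uniformIntegrable_condExp
      (ℱ := fun n => ℱ (s n)) fun n => ℱ.le _).2.1
    exact this.ae_eq fun n => hX.condExp_ae_eq (hs n)
  exact tendsto_Lp_finite_of_tendsto_ae le_rfl ENNReal.one_ne_top
    (fun n => (hX.integrable (s n)).1) (memLp_one_iff_integrable.2 (hX.integrable t)) hui
    (ae_of_all _ hlim)

/-- An event of the right limit at t belongs to ℱ_s ∨ m' for every s > t, so the integrals of X_s
and X_u over it agree for t < s ≤ u. Right continuity of the paths lets s decrease to t. -/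
theorem martingale_rightCont_of_indep {m' : MeasurableSpace Ω} (hm' : m' ≤ m0)
    {ℱ 𝒢 : Filtration ℝ≥0 m0} (hind : Indep (⨆ t, ℱ t : MeasurableSpace Ω) m' P)
    (hle : ℱ ≤ 𝒢) (h𝒢 : ∀ t, 𝒢 t ≤ ℱ t ⊔ m') {X : ℝ≥0 → Ω → ℝ} (hX : Martingale X ℱ P)
    (hright : ∀ ω t, ContinuousWithinAt (fun s => X s ω) (Set.Ici t) t) :
    Martingale X 𝒢.rightCont P := by
  have hle' : ∀ t, ℱ t ≤ 𝒢.rightCont t := fun t => (hle t).trans (𝒢.le_rightCont t)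
  refine ⟨fun t => (hX.stronglyAdapted t).mono (hle' t), fun t u htu => ?_⟩
  refine (ae_eq_condExp_of_forall_setIntegral_eq (𝒢.rightCont.le t) (hX.integrable u)
    (fun _ _ _ => (hX.integrable t).integrableOn) (fun A hA _ => ?_)
    ((hX.stronglyAdapted t).mono (hle' t)).aestronglyMeasurable).symm
  rcases htu.eq_or_lt with rfl | htu
  · rfl
  rw [Filtration.rightCont_eq] at hA
  have hA' : ∀ s, t < s → MeasurableSet[ℱ s ⊔ m'] A := fun s hs =>
    h𝒢 s _ ((iInf₂_le (f := fun j (_ : j > t) => (𝒢 j : MeasurableSpace Ω)) s hs) A hA)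
  have hconst : ∀ s, t < s → s ≤ u → ∫ ω in A, X s ω ∂P = ∫ ω in A, X u ω ∂P := fun s hs hsu =>
    (setIntegral_martingale_eq_of_indep hm' hind hX hsu (hA' s hs)).symm
  set s : ℕ → ℝ≥0 := fun n => min u (t + 1 / ((n : ℝ≥0) + 1)) with hsdef
  have hts : ∀ n, t < s n := fun n => lt_min htu (lt_add_of_pos_right _ (by positivity))
  have hs0 : Tendsto s atTop (𝓝 t) := by
    have h1 : Tendsto (fun n : ℕ => t + 1 / ((n : ℝ≥0) + 1)) atTop (𝓝 (t + 0)) :=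
      tendsto_const_nhds.add tendsto_one_div_add_atTop_nhds_zero_nat
    rw [add_zero] at h1
    have h2 := (tendsto_const_nhds (x := u)).min h1
    rwa [min_eq_right htu.le] at h2
  have hlim : ∀ ω, Tendsto (fun n => X (s n) ω) atTop (𝓝 (X t ω)) := fun ω =>
    (hright ω t).tendsto.comp (tendsto_nhdsWithin_iff.2
      ⟨hs0, Eventually.of_forall fun n => (hts n).le⟩)
  have h := tendsto_setIntegral_martingale hX (u := u) (fun n => min_le_left _ _) hlim A
  have h' : (fun n => ∫ ω in A, X (s n) ω ∂P) = fun _ => ∫ ω in A, X u ω ∂P :=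
    funext fun n => hconst _ (hts n) (min_le_left _ _)
  rw [h'] at h
  exact tendsto_nhds_unique h tendsto_const_nhds

end Enlargement

/-! ### Arrival of the first order -/

namespace DarkPool

variable {Ω : Type*} [mΩ : MeasurableSpace Ω] (D : DarkPool Ω)

theorem count_le_of_lt {t : ℝ≥0} {ω : Ω} {k : ℕ} (h : t < D.τ k ω) : D.count t ω ≤ k := by
  refine csSup_le ⟨0, by simp⟩ fun n hn => ?_
  by_contra! hc
  exact absurd (hn k hc) (not_le.2 h)

theorem lt_count_iff {t : ℝ≥0} {ω : Ω} (h : ∃ k, t < D.τ k ω) (i : ℕ) :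
    i < D.count t ω ↔ D.τ i ω ≤ t := by
  obtain ⟨k, hk⟩ := h
  have hb : BddAbove {k | ∀ i < k, D.τ i ω ≤ t} := by
    refine ⟨k, fun n hn => ?_⟩
    by_contra! hc
    exact absurd (hn k hc) (not_le.2 hk)
  constructor
  · intro hi
    exact Nat.sSup_mem ⟨0, by simp⟩ hb i hi
  · intro hi
    refine Nat.lt_of_succ_le (le_csSup hb fun j hj => ?_)
    exact ((D.τ_strictMono ω).monotone (Nat.lt_succ_iff.1 hj)).trans hi

/-- The supremum of an unbounded set of naturals is 0 by convention, so an accumulation of arrivals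
shows up as a zero count. -/
theorem count_eq_zero_of_forall_le {t : ℝ≥0} {ω : Ω} (h : ∀ k, D.τ k ω ≤ t) :
    D.count t ω = 0 := by
  refine Nat.sSup_of_not_bddAbove fun ⟨b, hb⟩ => ?_
  exact absurd (hb (fun i _ => h i : ∀ i < b + 1, D.τ i ω ≤ t)) (by omega)

theorem count_eq_zero_iff {t : ℝ≥0} {ω : Ω} (h : ∃ k, t < D.τ k ω) :
    D.count t ω = 0 ↔ t < D.τ 0 ω := by
  rw [← not_le, ← D.lt_count_iff h 0]; omega

/-- The arrivals do not accumulate, and all incoming orders are infinite. -/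
def Regular (ω : Ω) : Prop := (∀ t, ∃ k, t < D.τ k ω) ∧ ∀ i, D.Y i ω = ∞

theorem fill_top (x Ξ z : ℝ) : fill x Ξ z ∞ = x - z := by simp [fill]

variable {D} in
theorem Regular.cumFill_succ {ω : Ω} (h : D.Regular ω) (x Ξ : ℝ) (n : ℕ) :
    cumFill x Ξ (fun j => D.Y j ω) (n + 1) = x := by
  rw [cumFill, h.2 n, fill_top]; ring

variable {D} in
theorem Regular.executed_zero {ω : Ω} (h : D.Regular ω) (x Ξ : ℝ) :
    D.executed x Ξ 0 ω = x := by
  rw [executed, h.2 0, fill_top, cumFill, sub_zero]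

variable {D} in
theorem Regular.executed_succ {ω : Ω} (h : D.Regular ω) (x Ξ : ℝ) (i : ℕ) :
    D.executed x Ξ (i + 1) ω = 0 := by
  rw [executed, h.2 _, fill_top, h.cumFill_succ, sub_self]

variable {D} in
theorem Regular.sum_executed {ω : Ω} (h : D.Regular ω) (x Ξ : ℝ) (t : ℝ≥0) (g : ℕ → ℝ) :
    ∑ i ∈ Finset.range (D.count t ω), D.executed x Ξ i ω * g i =
      if D.τ 0 ω ≤ t then x * g 0 else 0 := by
  split_ifs with ht
  · have h0 := (D.lt_count_iff (h.1 t) 0).2 ht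
    obtain ⟨n, hn⟩ := Nat.exists_eq_succ_of_ne_zero h0.ne'
    rw [hn, Finset.sum_range_succ', h.executed_zero, Finset.sum_eq_zero, zero_add]
    intro i _
    rw [h.executed_succ, zero_mul]
  · rw [(D.count_eq_zero_iff (h.1 t)).2 (not_le.1 ht), Finset.sum_range_zero]

variable {D} in
theorem Regular.Z_eq {ω : Ω} (h : D.Regular ω) (x Ξ : ℝ) (t : ℝ≥0) :
    D.Z x Ξ t ω = if D.τ 0 ω ≤ t then x else 0 := by
  have := h.sum_executed x Ξ t fun _ => 1
  simpa [DarkPool.Z] using this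

theorem Z_eq_zero_of_lt (x Ξ : ℝ) {t : ℝ≥0} {ω : Ω} (h : t < D.τ 0 ω) : D.Z x Ξ t ω = 0 := by
  have := D.count_le_of_lt h
  rw [DarkPool.Z, Nat.le_zero.1 this, Finset.sum_range_zero]

variable {P : Measure Ω} {θ : ℝ≥0}

theorem measureReal_count_eq_zero (hN : IsPoissonProcess P θ D.count) (t : ℝ≥0) :
    P.real {ω | D.count t ω = 0} = Real.exp (-(θ * t)) := by
  have h := hN.law 0 t zero_le
  rw [tsub_zero] at h
  have hm : Measurable fun ω => D.count t ω - D.count 0 ω :=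
    (D.measurable_count t).sub (D.measurable_count 0)
  have h1 : P.real {ω | D.count t ω = 0} =
      P.real ((fun ω => D.count t ω - D.count 0 ω) ⁻¹' {0}) := by
    refine measureReal_congr ?_
    filter_upwards [hN.zero] with ω h0
    refine propext ?_
    change D.count t ω = 0 ↔ D.count t ω - D.count 0 ω = 0
    rw [h0]; simp
  rw [h1, ← map_measureReal_apply hm (measurableSet_singleton 0), h, poissonMeasure_real_singleton]
  simp

variable [IsProbabilityMeasure P]

/-- If all arrivals lie before n, the convention for unbounded suprema makes the count zero at every
time m ≥ n. This has probability e^{-θm} for each such m, hence the event is null. -/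
theorem ae_forall_exists_lt (hN : IsPoissonProcess P θ D.count) (hθ : 0 < θ) :
    ∀ᵐ ω ∂P, ∀ t, ∃ k, t < D.τ k ω := by
  have hn : ∀ n : ℕ, ∀ᵐ ω ∂P, ∃ k, (n : ℝ≥0) < D.τ k ω := by
    intro n
    rw [ae_iff]
    push Not
    have hle : ∀ m ≥ n, P.real {ω | ∀ k, D.τ k ω ≤ n} ≤ Real.exp (-(θ * m)) := by
      intro m hm
      rw [show (m : ℝ) = ((m : ℝ≥0) : ℝ) by simp, ← D.measureReal_count_eq_zero hN]
      refine measureReal_mono fun ω hω => ?_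
      exact D.count_eq_zero_of_forall_le fun k => (hω k).trans (by exact_mod_cast hm)
    have hlim : Tendsto (fun m : ℕ => Real.exp (-(θ * m : ℝ))) atTop (𝓝 0) := by
      refine Real.tendsto_exp_neg_atTop_nhds_zero.comp ?_
      exact tendsto_natCast_atTop_atTop.const_mul_atTop (by exact_mod_cast hθ)
    have h0 : P.real {ω | ∀ k, D.τ k ω ≤ n} ≤ 0 :=
      ge_of_tendsto hlim ((eventually_ge_atTop n).mono hle)
    exact (measureReal_eq_zero_iff).1 (le_antisymm h0 measureReal_nonneg)
  filter_upwards [ae_all_iff.2 hn] with ω h t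
  obtain ⟨n, hn⟩ := exists_nat_ge t
  obtain ⟨k, hk⟩ := h n
  exact ⟨k, hn.trans_lt hk⟩

theorem measureReal_lt_arrival (hN : IsPoissonProcess P θ D.count) (hθ : 0 < θ) (t : ℝ≥0) :
    P.real {ω | t < D.τ 0 ω} = Real.exp (-(θ * t)) := by
  rw [← D.measureReal_count_eq_zero hN]
  refine measureReal_congr ?_
  filter_upwards [D.ae_forall_exists_lt hN hθ] with ω h
  exact propext (D.count_eq_zero_iff (h t)).symm

variable {M : AlmgrenChriss P} {ν : Measure ℝ≥0∞}

theorem ae_regular (hD : PoissonAssumption M D θ ν) (hν : ν = Measure.dirac ∞) :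
    ∀ᵐ ω ∂P, D.Regular ω := by
  have hY : ∀ i, ∀ᵐ ω ∂P, D.Y i ω = ∞ := fun i => by
    have h : ∀ᵐ y ∂(P.map (D.Y i)), y = ∞ := by
      rw [hD.Y_law i, hν, ae_dirac_eq]; simp
    exact ae_of_ae_map (D.Y_measurable i).aemeasurable h
  filter_upwards [D.ae_forall_exists_lt hD.poisson hD.θ_pos, ae_all_iff.2 hY] with ω h1 h2
  exact ⟨h1, h2⟩

/-- The σ-algebra generated by the arrivals, up to null sets. -/
@[reducible]
def arrivals (P : Measure Ω) : MeasurableSpace Ω :=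
  aeCompletion P (⨆ t, MeasurableSpace.comap (D.count t) inferInstance)

theorem indep_arrivals (hD : PoissonAssumption M D θ ν) :
    Indep (⨆ t, M.filtration t : MeasurableSpace Ω) (D.arrivals P) P :=
  indep_aeCompletion (hD.indep.indep (i := 0) (j := 1) (by simp))

/-- The arrival times are recovered from the counts by τ_i ≤ t ⇔ i < N_t, valid only when arrivals
do not accumulate. This is why `arrivals` is completed by null sets. -/
theorem measurable_arrivals_τ (hD : PoissonAssumption M D θ ν) (i : ℕ) :
    Measurable[D.arrivals P] (D.τ i) := by
  refine measurable_of_preimage_Iic fun t => ?_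
  have hc : Measurable[⨆ t, MeasurableSpace.comap (D.count t) inferInstance] (D.count t) :=
    (comap_measurable (D.count t)).mono
      (le_iSup (fun t => MeasurableSpace.comap (D.count t) inferInstance) t) le_rfl
  refine measurableSet_aeCompletion (D.τ_measurable i measurableSet_Iic)
    (hc (measurableSet_Ioi (a := i))) ?_
  filter_upwards [D.ae_forall_exists_lt hD.poisson hD.θ_pos] with ω h
  exact propext (D.lt_count_iff (h t) i).symm

theorem measurable_arrivals_Z (hD : PoissonAssumption M D θ ν) (hν : ν = Measure.dirac ∞)
    (x Ξ : ℝ) (t : ℝ≥0) : Measurable[D.arrivals P] (D.Z x Ξ t) := by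
  have hg : Measurable[D.arrivals P] fun ω => if D.τ 0 ω ≤ t then x else 0 :=
    measurable_ite_le (D.measurable_arrivals_τ hD 0) t x
  refine measurable_aeCompletion_congr (D.measurable_Z x Ξ t) hg ?_
  filter_upwards [D.ae_regular hD hν] with ω h
  exact h.Z_eq x Ξ t

/-- The filtration whose right-continuous version is `DarkPool.enlarged`. -/
def preEnlarged (ℱ : Filtration ℝ≥0 mΩ) (x Ξ : ℝ) : Filtration ℝ≥0 mΩ :=
  ℱ ⊔ Filtration.natural (D.Z x Ξ) (fun t => (D.measurable_Z x Ξ t).stronglyMeasurable) ⊔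
    ⨆ i, Filtration.natural (fun t ω => min (D.τ i ω) t)
      (fun _ => ((D.τ_measurable i).min measurable_const).stronglyMeasurable)

theorem preEnlarged_apply (ℱ : Filtration ℝ≥0 mΩ) (x Ξ : ℝ) (t : ℝ≥0) :
    (D.preEnlarged ℱ x Ξ t : MeasurableSpace Ω) =
      ℱ t ⊔ (⨆ s ≤ t, MeasurableSpace.comap (D.Z x Ξ s) inferInstance) ⊔
        ⨆ i, ⨆ s ≤ t, MeasurableSpace.comap (fun ω => min (D.τ i ω) s) inferInstance := by
  have h : ∀ f : ℕ → Filtration ℝ≥0 mΩ, ((⨆ i, f i : Filtration ℝ≥0 mΩ) t : MeasurableSpace Ω)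
      = ⨆ i, (f i t : MeasurableSpace Ω) := fun f => by
    rw [iSup, Filtration.sSup_def, ← Set.range_comp, sSup_range]; rfl
  unfold preEnlarged
  change _ ⊔ _ ⊔ _ = _
  rw [h]
  rfl

theorem enlarged_eq (ℱ : Filtration ℝ≥0 mΩ) (x Ξ : ℝ) :
    D.enlarged ℱ x Ξ = (D.preEnlarged ℱ x Ξ).rightCont := rfl

theorem measurableSet_enlarged_iff {ℱ : Filtration ℝ≥0 mΩ} {x Ξ : ℝ} {t : ℝ≥0} {A : Set Ω} :
    MeasurableSet[D.enlarged ℱ x Ξ t] A ↔ ∀ s > t, MeasurableSet[D.preEnlarged ℱ x Ξ s] A := by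
  rw [enlarged_eq, Filtration.rightCont_eq]
  simp only [MeasurableSpace.measurableSet_iInf]

/-- As the sizes are almost surely infinite, Z is almost surely a function of the first arrival. So
the enlargement adds only information from the arrivals, which is independent of ℱ. -/
theorem martingale_price (hD : PoissonAssumption M D θ ν) (hν : ν = Measure.dirac ∞) (x Ξ : ℝ) :
    Martingale M.price (D.enlarged M.filtration x Ξ) P := by
  rw [enlarged_eq]
  refine martingale_rightCont_of_indep (aeCompletion_le _) (D.indep_arrivals hD)
    (fun t => ?_) (fun t => ?_) M.price_martingale fun ω t => (M.price_cadlag ω t).1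
  · rw [preEnlarged_apply]
    exact le_sup_left.trans le_sup_left
  · rw [preEnlarged_apply]
    refine sup_le (sup_le le_sup_left ?_) ?_
    · refine iSup₂_le fun s _ => (Measurable.comap_le ?_).trans le_sup_right
      exact D.measurable_arrivals_Z hD hν x Ξ s
    · refine iSup_le fun i => iSup₂_le fun s _ => (Measurable.comap_le ?_).trans le_sup_right
      have hmin : Measurable fun y : ℝ≥0 => min y s := measurable_id.min measurable_const
      exact hmin.comp (D.measurable_arrivals_τ hD i)

/-- The process τ_i ∧ s decides whether τ_i ≤ t only for s > t, so the right-continuous filtration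
is needed. -/
theorem isStoppingTime_τ (ℱ : Filtration ℝ≥0 mΩ) (x Ξ : ℝ) (i : ℕ) :
    IsStoppingTime (D.enlarged ℱ x Ξ) fun ω => (D.τ i ω : WithTop ℝ≥0) := by
  intro t
  rw [measurableSet_enlarged_iff]
  intro s hs
  have hm : Measurable[D.preEnlarged ℱ x Ξ s] fun ω => min (D.τ i ω) s := by
    rw [preEnlarged_apply]
    refine Measurable.mono (comap_measurable _) (le_trans ?_ le_sup_right) le_rfl
    exact le_iSup_of_le i (le_iSup₂_of_le s le_rfl le_rfl)
  have : {ω | (D.τ i ω : WithTop ℝ≥0) ≤ t} = (fun ω => min (D.τ i ω) s) ⁻¹' Set.Iic t := by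
    ext ω
    simp only [Set.mem_ofPred_eq, WithTop.coe_le_coe, Set.mem_preimage, Set.mem_Iic, min_le_iff,
      not_le.2 hs, or_false]
  rw [this]
  exact hm measurableSet_Iic

/-! ### The information before the first arrival -/

/-- Before the first arrival Z is 0 and every τ_i ∧ u is u. All added generators are constant there,
so on {s < τ_0} the enlarged σ-algebra and ℱ_s have the same trace. -/
theorem exists_inter_eq_of_preEnlarged {ℱ : Filtration ℝ≥0 mΩ} {x Ξ : ℝ} {s : ℝ≥0} {A : Set Ω}
    (hA : MeasurableSet[D.preEnlarged ℱ x Ξ s] A) :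
    ∃ B, MeasurableSet[ℱ s] B ∧ ∀ ω, s < D.τ 0 ω → (ω ∈ A ↔ ω ∈ B) := by
  set S := {ω // s < D.τ 0 ω}
  have hle : (D.preEnlarged ℱ x Ξ s : MeasurableSpace Ω).comap (Subtype.val : S → Ω) ≤
      (ℱ s : MeasurableSpace Ω).comap (Subtype.val : S → Ω) := by
    rw [preEnlarged_apply]
    simp only [MeasurableSpace.comap_sup, MeasurableSpace.comap_iSup,
      MeasurableSpace.comap_comp]
    refine sup_le (sup_le le_rfl ?_) ?_
    · refine iSup₂_le fun u hu => Measurable.comap_le ?_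
      have : D.Z x Ξ u ∘ (Subtype.val : S → Ω) = fun _ => 0 :=
        funext fun ω => D.Z_eq_zero_of_lt x Ξ (hu.trans_lt ω.2)
      rw [this]
      exact measurable_const
    · refine iSup_le fun i => iSup₂_le fun u hu => Measurable.comap_le ?_
      have : (fun ω => min (D.τ i ω) u) ∘ (Subtype.val : S → Ω) = fun _ => u :=
        funext fun ω => min_eq_right (hu.trans (ω.2.le.trans
          ((D.τ_strictMono ω.1).monotone (Nat.zero_le i))))
      rw [this]
      exact measurable_const
  obtain ⟨B, hB, h⟩ := hle _ ⟨A, hA, rfl⟩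
  exact ⟨B, hB, fun ω hω => (Set.ext_iff.1 h ⟨ω, hω⟩).symm⟩

/-- The sets found at times s + 1/(n + 1) are combined by a limsup, since on {s < τ_0} all but
finitely many of these times precede τ_0. The resulting set is claimed only to be ℱ_∞-measurable,
which suffices for independence from τ_0. -/
theorem exists_inter_eq_of_enlarged {ℱ : Filtration ℝ≥0 mΩ} {x Ξ : ℝ} {s : ℝ≥0} {A : Set Ω}
    (hA : MeasurableSet[D.enlarged ℱ x Ξ s] A) :
    ∃ B, MeasurableSet[⨆ t, ℱ t] B ∧ ∀ ω, s < D.τ 0 ω → (ω ∈ A ↔ ω ∈ B) := by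
  rw [measurableSet_enlarged_iff] at hA
  have hpos : ∀ n : ℕ, s + 1 / ((n : ℝ≥0) + 1) > s := fun n =>
    lt_add_of_pos_right _ (by positivity)
  choose B hB h using fun n : ℕ => D.exists_inter_eq_of_preEnlarged (hA _ (hpos n))
  refine ⟨limsup B atTop, ?_, fun ω hω => ?_⟩
  · refine measurableSet_limsup_nat fun n => ?_
    exact le_iSup (fun t => (ℱ t : MeasurableSpace Ω)) _ _ (hB n)
  · have h1 : Tendsto (fun n : ℕ => s + 1 / ((n : ℝ≥0) + 1)) atTop (𝓝 (s + 0)) :=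
      tendsto_const_nhds.add tendsto_one_div_add_atTop_nhds_zero_nat
    rw [add_zero] at h1
    have h2 : ∀ᶠ n in atTop, (ω ∈ A ↔ ω ∈ B n) := by
      filter_upwards [h1.eventually_lt_const hω] with n hn using h n ω hn
    rw [mem_limsup_iff_frequently_mem]
    constructor
    · intro hωA
      exact (h2.mono fun n hn => hn.1 hωA).frequently
    · intro hf
      obtain ⟨n, hn1, hn2⟩ := (hf.and_eventually h2).exists
      exact hn2.2 hn1

/-- It is enough to compare generators on {t ≤ τ_0}. The generators (s, ∞) × A are open on the left:
s < t ≤ τ_0 implies s < τ_0, so the agreement includes the time τ_0 itself. -/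
theorem exists_eq_of_predictable {ℱ : Filtration ℝ≥0 mΩ} {x Ξ : ℝ} {ξ : ℝ≥0 → Ω → ℝ}
    (hξ : IsStronglyPredictable (D.enlarged ℱ x Ξ) ξ) :
    ∃ g : ℝ≥0 × Ω → ℝ,
      Measurable[Prod.instMeasurableSpace (m₂ := (⨆ t, ℱ t : MeasurableSpace Ω))] g ∧
      ∀ t ω, t ≤ D.τ 0 ω → ξ t ω = g (t, ω) := by
  set S := {p : ℝ≥0 × Ω // p.1 ≤ D.τ 0 p.2}
  set m' : MeasurableSpace (ℝ≥0 × Ω) :=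
    Prod.instMeasurableSpace (m₂ := (⨆ t, ℱ t : MeasurableSpace Ω)) with hm'
  have hle : (D.enlarged ℱ x Ξ).predictable.comap (Subtype.val : S → ℝ≥0 × Ω) ≤
      m'.comap (Subtype.val : S → ℝ≥0 × Ω) := by
    rw [Filtration.predictable, MeasurableSpace.comap_generateFrom]
    refine MeasurableSpace.generateFrom_le ?_
    rintro _ ⟨_, ⟨A, hA, rfl⟩ | ⟨s, A, hA, rfl⟩, rfl⟩
    · obtain ⟨B, hB, h⟩ := D.exists_inter_eq_of_enlarged hA
      refine ⟨{⊥} ×ˢ B, (measurableSet_singleton _).prod hB, ?_⟩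
      ext ⟨⟨t, ω⟩, hω⟩
      simp only [Set.mem_preimage, Set.mem_prod, Set.mem_singleton_iff]
      exact and_congr_right fun _ => (h ω (D.τ_pos ω)).symm
    · obtain ⟨B, hB, h⟩ := D.exists_inter_eq_of_enlarged hA
      refine ⟨Set.Ioi s ×ˢ B, measurableSet_Ioi.prod hB, ?_⟩
      ext ⟨⟨t, ω⟩, hω⟩
      simp only [Set.mem_preimage, Set.mem_prod, Set.mem_Ioi]
      exact and_congr_right fun hst => (h ω (lt_of_lt_of_le hst hω)).symm
  have h1 : Measurable[m'.comap (Subtype.val : S → ℝ≥0 × Ω)]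
      (Function.uncurry ξ ∘ (Subtype.val : S → ℝ≥0 × Ω)) := by
    refine Measurable.mono ?_ hle le_rfl
    have hξm : Measurable[(D.enlarged ℱ x Ξ).predictable] (Function.uncurry ξ) := hξ.measurable
    exact hξm.comp (comap_measurable _)
  obtain ⟨g, hg, h⟩ := h1.exists_eq_measurable_comp
  exact ⟨g, hg, fun t ω hω => congrFun h ⟨(t, ω), hω⟩⟩

/-- The event ρ < τ_0 occurs exactly when ρ ≤ q < τ_0 for some rational q, and {ρ ≤ q} agrees with
an ℱ_∞-measurable B_q as long as q < τ_0. So r is the infimum of those q with ω in B_q, infinite if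
there are none. -/
theorem exists_eq_of_stoppingTime {ℱ : Filtration ℝ≥0 mΩ} {x Ξ : ℝ} {ρ : Ω → ℝ≥0}
    (hρ : IsStoppingTime (D.enlarged ℱ x Ξ) fun ω => (ρ ω : WithTop ℝ≥0)) :
    ∃ r : Ω → ℝ≥0∞, Measurable[⨆ t, ℱ t] r ∧ ∀ ω, D.τ 0 ω ≤ ρ ω ↔ D.τ 0 ω ≤ r ω := by
  classical
  have hA : ∀ q : ℚ, MeasurableSet[D.enlarged ℱ x Ξ (Real.toNNReal q)]
      {ω | ρ ω ≤ Real.toNNReal q} := fun q => by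
    have := hρ (Real.toNNReal q)
    simpa only [WithTop.coe_le_coe] using this
  choose B hB h using fun q => D.exists_inter_eq_of_enlarged (hA q)
  refine ⟨fun ω => ⨅ q : ℚ, if ω ∈ B q then ((Real.toNNReal q : ℝ≥0) : ℝ≥0∞) else ∞, ?_,
    fun ω => ?_⟩
  · exact measurable_iInf_ite hB _
  · constructor
    · intro hω
      refine le_iInf fun q => ?_
      split_ifs with hq
      · by_contra! hc
        rw [ENNReal.coe_lt_coe] at hc
        have : ρ ω ≤ Real.toNNReal q := (h q ω hc).2 hq
        exact absurd (hω.trans this) (not_le.2 hc)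
      · exact le_top
    · intro hω
      by_contra! hc
      obtain ⟨q, hq1, hq2⟩ := exists_rat_btwn (NNReal.coe_lt_coe.2 hc)
      have hq0 : (0 : ℝ) ≤ q := (ρ ω).2.trans hq1.le
      have e1 : ρ ω ≤ Real.toNNReal q := by
        rw [← NNReal.coe_le_coe, Real.coe_toNNReal _ hq0]; exact hq1.le
      have e2 : Real.toNNReal q < D.τ 0 ω := by
        rw [← NNReal.coe_lt_coe, Real.coe_toNNReal _ hq0]; exact hq2
      have hmem := (h q ω e2).1 e1
      have := hω.trans (iInf_le _ q)
      rw [if_pos hmem, ENNReal.coe_le_coe] at this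
      exact absurd this (not_le.2 e2)

end DarkPool

/-! ### Càdlàg paths and Riemann–Stieltjes sums -/

section Paths

theorem exists_bound_of_cadlag {f : ℝ≥0 → ℝ}
    (hf : ∀ t, ContinuousWithinAt f (Set.Ici t) t ∧ ∃ l, Tendsto f (𝓝[<] t) (𝓝 l)) (T : ℝ≥0) :
    ∃ C, ∀ t ≤ T, |f t| ≤ C := by
  have hloc : ∀ {l : Filter ℝ≥0} {y : ℝ}, Tendsto f l (𝓝 y) → ∀ᶠ s in l, |f s| ≤ |y| + 1 :=
    fun h => (h.abs.eventually_lt_const (lt_add_one _)).mono fun _ h => h.le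
  suffices ∃ C, ∀ t ∈ Set.Iic T, |f t| ≤ C from this
  rw [← Set.Icc_bot]
  refine isCompact_Icc.induction_on (p := fun s => ∃ C, ∀ t ∈ s, |f t| ≤ C) ⟨0, by simp⟩
    (fun s t hst ⟨C, hC⟩ => ⟨C, fun u hu => hC u (hst hu)⟩)
    (fun s t ⟨C, hC⟩ ⟨C', hC'⟩ => ⟨max C C', fun u hu => ?_⟩) fun t _ => ?_
  · rcases hu with hu | hu
    · exact (hC u hu).trans (le_max_left _ _)
    · exact (hC' u hu).trans (le_max_right _ _)
  · obtain ⟨h1, l, h2⟩ := hf t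
    have e1 := hloc h1.tendsto
    have e2 := hloc h2
    refine ⟨{s | |f s| ≤ max (|f t| + 1) (|l| + 1)}, mem_nhdsWithin_of_mem_nhds ?_,
      max (|f t| + 1) (|l| + 1), fun u hu => hu⟩
    rw [← nhdsLT_sup_nhdsGE t]
    refine mem_sup.2 ⟨?_, ?_⟩
    · filter_upwards [e2] with s hs using hs.trans (le_max_right _ _)
    · filter_upwards [e1] with s hs using hs.trans (le_max_left _ _)

/-- The index of the first grid point that is not before `t`. -/
def gridIndex (T : ℝ≥0) (n : ℕ) (t : ℝ≥0) : ℕ := ⌈t * n / T⌉₊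

variable {T : ℝ≥0} {n : ℕ}

theorem gridIndex_le_iff (hT : 0 < T) (hn : n ≠ 0) (t : ℝ≥0) (k : ℕ) :
    gridIndex T n t ≤ k ↔ t ≤ grid T n k := by
  have hn' : (0 : ℝ≥0) < n := by exact_mod_cast Nat.pos_of_ne_zero hn
  rw [gridIndex, Nat.ceil_le, grid, div_le_iff₀ hT, le_div_iff₀ hn', mul_comm (k : ℝ≥0)]

theorem le_grid_gridIndex (hT : 0 < T) (hn : n ≠ 0) (t : ℝ≥0) :
    t ≤ grid T n (gridIndex T n t) := (gridIndex_le_iff hT hn t _).1 le_rfl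

theorem gridIndex_le (hT : 0 < T) (hn : n ≠ 0) {t : ℝ≥0} (ht : t ≤ T) : gridIndex T n t ≤ n := by
  rw [gridIndex_le_iff hT hn, grid_self T hn]; exact ht

theorem grid_gridIndex_le (hT : 0 < T) (hn : n ≠ 0) (t : ℝ≥0) :
    grid T n (gridIndex T n t) ≤ t + T / n := by
  rcases Nat.eq_zero_or_pos (gridIndex T n t) with h | h
  · rw [h, grid_zero]; exact zero_le
  · obtain ⟨k, hk⟩ := Nat.exists_eq_succ_of_ne_zero h.ne'
    have h1 : grid T n k < t := by
      by_contra! hc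
      have := (gridIndex_le_iff hT hn t k).2 hc
      omega
    have h2 : grid T n (k + 1) = grid T n k + T / n := by
      unfold grid; push_cast; rw [mul_add, add_div, mul_one]
    rw [hk, Nat.succ_eq_add_one, h2]
    gcongr

theorem tendsto_grid_gridIndex (hT : 0 < T) (t : ℝ≥0) :
    Tendsto (fun n => grid T n (gridIndex T n t)) atTop (𝓝[≥] t) := by
  refine tendsto_nhdsWithin_iff.2 ⟨?_, ?_⟩
  · have h1 : Tendsto (fun n : ℕ => t + T / (n : ℝ≥0)) atTop (𝓝 (t + 0)) :=
      tendsto_const_nhds.add (tendsto_const_div_atTop_nhds_zero_nat T)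
    rw [add_zero] at h1
    refine tendsto_of_tendsto_of_tendsto_of_le_of_le' tendsto_const_nhds h1 ?_ ?_
    · filter_upwards [eventually_ne_atTop 0] with n hn using le_grid_gridIndex hT hn t
    · filter_upwards [eventually_ne_atTop 0] with n hn using grid_gridIndex_le hT hn t
  · filter_upwards [eventually_ne_atTop 0] with n hn using le_grid_gridIndex hT hn t

theorem gridIndex_eq (hT : 0 < T) (hn : n ≠ 0) {t : ℝ≥0} {k : ℕ} (h1 : grid T n k < t)
    (h2 : t ≤ grid T n (k + 1)) : gridIndex T n t = k + 1 := by
  refine le_antisymm ((gridIndex_le_iff hT hn t _).2 h2) ?_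
  by_contra! hc
  exact absurd ((gridIndex_le_iff hT hn t k).1 (by omega)) (not_le.2 h1)

theorem measurable_gridIndex (T : ℝ≥0) (n : ℕ) : Measurable (gridIndex T n) := by
  unfold gridIndex
  exact Nat.measurable_ceil.comp (by fun_prop)

variable {f : ℝ≥0 → ℝ} {ξ : ℝ → ℝ}

theorem measurable_comp_gridIndex (f : ℝ≥0 → ℝ) (T : ℝ≥0) (n : ℕ) :
    Measurable fun s : ℝ => f (grid T n (gridIndex T n s.toNNReal)) := by
  have h : Measurable fun k : ℕ => f (grid T n k) := measurable_from_nat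
  exact h.comp ((measurable_gridIndex T n).comp measurable_real_toNNReal)

theorem measurable_of_rightContinuous (hf : ∀ t, ContinuousWithinAt f (Set.Ici t) t) :
    Measurable f := by
  refine measurable_of_tendsto_metrizable (f := fun n t => f (grid 1 n (gridIndex 1 n t)))
    (fun n => ?_) (tendsto_pi_nhds.2 fun t => (hf t).tendsto.comp
      (tendsto_grid_gridIndex one_pos t))
  have h : Measurable fun k : ℕ => f (grid 1 n k) := measurable_from_nat
  exact h.comp (measurable_gridIndex 1 n)

theorem intervalIntegrable_mul_cadlag (hξ : IntervalIntegrable ξ volume 0 T)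
    (hf : ∀ t, ContinuousWithinAt f (Set.Ici t) t ∧ ∃ l, Tendsto f (𝓝[<] t) (𝓝 l)) :
    IntervalIntegrable (fun s => ξ s * f s.toNNReal) volume 0 T := by
  obtain ⟨C, hC⟩ := exists_bound_of_cadlag hf T
  rw [intervalIntegrable_iff] at hξ ⊢
  refine hξ.mul_bdd (c := C) ?_ ?_
  · exact ((measurable_of_rightContinuous fun t => (hf t).1).comp
      measurable_real_toNNReal).aestronglyMeasurable
  · filter_upwards [ae_restrict_mem measurableSet_uIoc] with s hs
    rw [Set.uIoc_of_le T.coe_nonneg] at hs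
    exact hC _ (Real.toNNReal_le_iff_le_coe.2 hs.2)

theorem sum_integral_mul_eq (hT : 0 < T) (hn : n ≠ 0) (hξ : IntervalIntegrable ξ volume 0 T) :
    ∑ k ∈ Finset.range n, ((∫ s in (0 : ℝ)..grid T n (k + 1), ξ s) -
        ∫ s in (0 : ℝ)..grid T n k, ξ s) * f (grid T n (k + 1)) =
      ∫ s in (0 : ℝ)..T, ξ s * f (grid T n (gridIndex T n s.toNNReal)) := by
  have hsub : ∀ {a b : ℝ≥0}, a ≤ T → b ≤ T → IntervalIntegrable ξ volume a b := fun ha hb => by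
    refine hξ.mono_set (Set.uIcc_subset_uIcc ?_ ?_) <;> rw [Set.uIcc_of_le T.coe_nonneg]
    · exact ⟨NNReal.coe_nonneg _, by exact_mod_cast ha⟩
    · exact ⟨NNReal.coe_nonneg _, by exact_mod_cast hb⟩
  have heq : ∀ k < n, ∀ s : ℝ, s ∈ Set.uIoc (grid T n k : ℝ) (grid T n (k + 1)) →
      ξ s * f (grid T n (k + 1)) = ξ s * f (grid T n (gridIndex T n s.toNNReal)) := by
    intro k hk s hs
    rw [Set.uIoc_of_le (by exact_mod_cast grid_mono T n k.le_succ)] at hs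
    rw [gridIndex_eq hT hn (k := k)]
    · exact Real.lt_toNNReal_iff_coe_lt.2 hs.1
    · exact Real.toNNReal_le_iff_le_coe.2 hs.2
  have hint : ∀ k < n, IntervalIntegrable
      (fun s => ξ s * f (grid T n (gridIndex T n s.toNNReal))) volume
      (grid T n k) (grid T n (k + 1)) := fun k hk =>
    ((hsub (grid_le T hk.le) (grid_le T hk)).mul_const _).congr fun s hs => heq k hk s hs
  have := intervalIntegral.sum_integral_adjacent_intervals
    (a := fun k => (grid T n k : ℝ)) (n := n) hint
  simp only [grid_zero, NNReal.coe_zero, grid_self T hn] at this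
  rw [← this]
  refine Finset.sum_congr rfl fun k hk => ?_
  have hk := Finset.mem_range.1 hk
  have h0 : IntervalIntegrable ξ volume 0 (grid T n k : ℝ) := by
    simpa using hsub (a := 0) zero_le (grid_le T hk.le)
  have h0' : IntervalIntegrable ξ volume 0 (grid T n (k + 1) : ℝ) := by
    simpa using hsub (a := 0) zero_le (grid_le T hk)
  rw [intervalIntegral.integral_interval_sub_left h0' h0, ← intervalIntegral.integral_mul_const]
  exact intervalIntegral.integral_congr_ae (ae_of_all _ (heq k hk))

/-- The sum is the integral of ξ against f sampled at the next grid point. That point approaches s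
from the right, so right continuity gives the limit, with domination by a bound on f times |ξ|. -/
theorem tendsto_sum_integral_mul (hT : 0 < T) (hξ : IntervalIntegrable ξ volume 0 T)
    (hf : ∀ t, ContinuousWithinAt f (Set.Ici t) t ∧ ∃ l, Tendsto f (𝓝[<] t) (𝓝 l)) :
    Tendsto (fun n : ℕ => ∑ k ∈ Finset.range n, ((∫ s in (0 : ℝ)..grid T n (k + 1), ξ s) -
        ∫ s in (0 : ℝ)..grid T n k, ξ s) * f (grid T n (k + 1))) atTop
      (𝓝 (∫ s in (0 : ℝ)..T, ξ s * f s.toNNReal)) := by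
  obtain ⟨C, hC⟩ := exists_bound_of_cadlag hf T
  have hlim : Tendsto (fun n : ℕ => ∫ s in (0 : ℝ)..T,
      ξ s * f (grid T n (gridIndex T n s.toNNReal))) atTop
      (𝓝 (∫ s in (0 : ℝ)..T, ξ s * f s.toNNReal)) := by
    refine intervalIntegral.tendsto_integral_filter_of_dominated_convergence
      (fun s => |ξ s| * C) (Eventually.of_forall fun n => ?_) ?_ (hξ.abs.mul_const C)
      (ae_of_all _ fun s _ => ?_)
    · exact (intervalIntegrable_iff.1 hξ).1.mul
        (measurable_comp_gridIndex f T n).aestronglyMeasurable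
    · filter_upwards [eventually_ne_atTop 0] with n hn
      refine ae_of_all _ fun s hs => ?_
      rw [Set.uIoc_of_le T.coe_nonneg] at hs
      rw [norm_mul, Real.norm_eq_abs, Real.norm_eq_abs]
      refine mul_le_mul_of_nonneg_left (hC _ (grid_le T (gridIndex_le hT hn ?_))) (abs_nonneg _)
      exact Real.toNNReal_le_iff_le_coe.2 hs.2
    · exact (((hf _).1).tendsto.comp (tendsto_grid_gridIndex hT _)).const_mul _
  refine hlim.congr' ?_
  filter_upwards [eventually_ne_atTop 0] with n hn
  exact (sum_integral_mul_eq hT hn hξ).symm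

theorem sum_jump_mul_eq (hT : 0 < T) (hn : n ≠ 0) {τ : ℝ≥0} (hτ : 0 < τ) (hτT : τ ≤ T) (x : ℝ) :
    ∑ k ∈ Finset.range n, ((if τ ≤ grid T n (k + 1) then x else 0) -
      if τ ≤ grid T n k then x else 0) * f (grid T n (k + 1)) =
      x * f (grid T n (gridIndex T n τ)) := by
  have hpos : 0 < gridIndex T n τ := by
    by_contra! hc
    have := (gridIndex_le_iff hT hn τ 0).1 hc
    rw [grid_zero] at this
    exact absurd this (not_le.2 hτ)
  obtain ⟨c, hc⟩ := Nat.exists_eq_succ_of_ne_zero hpos.ne'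
  have hcn : c < n := by
    have := gridIndex_le hT hn hτT
    omega
  simp_rw [← gridIndex_le_iff hT hn, hc, Nat.succ_eq_add_one]
  rw [Finset.sum_eq_single_of_mem c (Finset.mem_range.2 hcn)]
  · simp
  · intro k _ hk
    rcases lt_or_gt_of_ne hk with h | h
    · rw [if_neg (by omega), if_neg (by omega)]; simp
    · rw [if_pos (by omega), if_pos (by omega)]; simp

theorem continuous_integral_interval (hξ : IntervalIntegrable ξ volume 0 T) :
    ContinuousOn (fun t : ℝ => ∫ s in (0 : ℝ)..t, ξ s) (Set.uIcc 0 T) :=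
  intervalIntegral.continuousOn_primitive_interval' hξ Set.left_mem_uIcc

theorem integral_mul_primitive (hξ : IntervalIntegrable ξ volume 0 T) :
    ∫ t in (0 : ℝ)..T, ξ t * ∫ s in (0 : ℝ)..t, ξ s = (∫ s in (0 : ℝ)..T, ξ s) ^ 2 / 2 := by
  have hac := hξ.absolutelyContinuousOnInterval_intervalIntegral (c := 0) Set.left_mem_uIcc
  have h := hac.integral_deriv_mul_eq_sub hac
  simp only [intervalIntegral.integral_same, mul_zero, sub_zero] at h
  have h2 : ∫ t in (0 : ℝ)..T, 2 * (ξ t * ∫ s in (0 : ℝ)..t, ξ s) =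
      (∫ s in (0 : ℝ)..T, ξ s) * ∫ s in (0 : ℝ)..T, ξ s := by
    rw [← h]
    refine intervalIntegral.integral_congr_ae ?_
    filter_upwards [hξ.ae_hasDerivAt_integral] with t ht hmem
    rw [(ht (Set.uIoc_subset_uIcc hmem) 0 Set.left_mem_uIcc).deriv]
    ring
  rw [intervalIntegral.integral_const_mul] at h2
  linarith

end Paths

/-! ### Decomposition of the costs -/

section Decomposition

variable {Ω : Type*} [mΩ : MeasurableSpace Ω] {P : Measure Ω} (M : AlmgrenChriss P)
  (D : DarkPool Ω) (T : ℝ≥0) (χ : Strategy Ω)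

open Classical in
/-- The position at time `t` when the first incoming order is matched entirely. -/
def inventory (t : ℝ≥0) (ω : Ω) : ℝ :=
  χ.traded t ω + if D.τ 0 ω ≤ t ∧ D.τ 0 ω ≤ χ.ρ ω then χ.x else 0

/-- The costs at the unaffected price. -/
def unaffectedCost (ω : Ω) : ℝ :=
  (∫ t in (0 : ℝ)..T, χ.ξ t.toNNReal ω * M.price t.toNNReal ω) +
    if D.τ 0 ω ≤ χ.ρ ω then χ.x * M.price (D.τ 0 ω) ω else 0

/-- The costs due to permanent impact. -/
def permanentCost (ω : Ω) : ℝ :=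
  M.γ * (χ.traded T ω ^ 2 / 2) +
    if D.τ 0 ω ≤ χ.ρ ω then χ.x * (M.γ * χ.traded (D.τ 0 ω) ω) else 0

/-- The energy `∫ ξ²` of a strategy. -/
def energy (ω : Ω) : ℝ≥0∞ :=
  ∫⁻ t in Set.Ioc (0 : ℝ) T, ENNReal.ofReal (χ.ξ t.toNNReal ω ^ 2)

variable {M D T χ}

theorem tendsto_stieltjesSum_inventory (hT : 0 < T) {ω : Ω}
    (hcad : ∀ t, ContinuousWithinAt (fun s => M.price s ω) (Set.Ici t) t ∧
      ∃ l, Tendsto (fun s => M.price s ω) (𝓝[<] t) (𝓝 l))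
    (hξ : IntervalIntegrable (fun s : ℝ => χ.ξ s.toNNReal ω) volume 0 T) (hρ : χ.ρ ω < T) :
    Tendsto (fun n => stieltjesSum (inventory D χ) M.price T n ω) atTop
      (𝓝 (unaffectedCost M D T χ ω)) := by
  have h1 := tendsto_sum_integral_mul hT hξ hcad
  unfold unaffectedCost
  by_cases hτ : D.τ 0 ω ≤ χ.ρ ω
  · have hτT : D.τ 0 ω ≤ T := hτ.trans hρ.le
    have h2 : Tendsto (fun n => χ.x * M.price (grid T n (gridIndex T n (D.τ 0 ω))) ω) atTop
        (𝓝 (χ.x * M.price (D.τ 0 ω) ω)) :=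
      ((hcad _).1.tendsto.comp (tendsto_grid_gridIndex hT _)).const_mul _
    rw [if_pos hτ]
    refine (h1.add h2).congr' ?_
    filter_upwards [eventually_ne_atTop 0] with n hn
    rw [← sum_jump_mul_eq (f := fun t => M.price t ω) hT hn (D.τ_pos ω) hτT,
      ← Finset.sum_add_distrib]
    refine Finset.sum_congr rfl fun k _ => ?_
    simp only [inventory, hτ, and_true, Strategy.traded]
    ring
  · rw [if_neg hτ, add_zero]
    refine h1.congr fun n => Finset.sum_congr rfl fun k _ => ?_
    simp only [inventory, hτ, and_false, if_false, add_zero, Strategy.traded]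

theorem energy_lt_top_iff {ω : Ω}
    (hξ : IntervalIntegrable (fun s : ℝ => χ.ξ s.toNNReal ω) volume 0 T) :
    energy T χ ω < ∞ ↔
      IntervalIntegrable (fun s : ℝ => χ.ξ s.toNNReal ω ^ 2) volume 0 T := by
  rw [intervalIntegrable_iff, Set.uIoc_of_le T.coe_nonneg]
  rw [intervalIntegrable_iff, Set.uIoc_of_le T.coe_nonneg] at hξ
  constructor
  · intro h
    refine ⟨hξ.1.pow 2, ?_⟩
    rw [hasFiniteIntegral_iff_ofReal (ae_of_all _ fun s => sq_nonneg _)]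
    exact h
  · intro h
    have := h.2
    rwa [hasFiniteIntegral_iff_ofReal (ae_of_all _ fun s => sq_nonneg _)] at this

theorem toReal_energy {ω : Ω}
    (hξ : IntervalIntegrable (fun s : ℝ => χ.ξ s.toNNReal ω) volume 0 T) :
    (energy T χ ω).toReal = ∫ s in (0 : ℝ)..T, χ.ξ s.toNNReal ω ^ 2 := by
  rw [intervalIntegrable_iff, Set.uIoc_of_le T.coe_nonneg] at hξ
  rw [intervalIntegral.integral_of_le T.coe_nonneg, integral_eq_lintegral_of_nonneg_ae
    (ae_of_all _ fun s => sq_nonneg _) (hξ.1.pow 2)]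
  rfl

open Classical in
-- In the integrand ξP the terms from the unaffected price and from permanent impact are integrable
-- on every such path, so integrability on [0, T] is equivalent to finite energy. The
-- permanent-impact term integrates to γX_T²/2.
theorem cost_eq {η : ℝ} (hη : 0 < η) (hα : D.α = 0) (hκ : D.κ = 0) (hβ : D.β = 0)
    (hh : ∀ x, M.h x = η * x) {ω : Ω} (hω : D.Regular ω)
    (hcad : ∀ t, ContinuousWithinAt (fun s => M.price s ω) (Set.Ici t) t ∧
      ∃ l, Tendsto (fun s => M.price s ω) (𝓝[<] t) (𝓝 l))
    (hξ : IntervalIntegrable (fun s : ℝ => χ.ξ s.toNNReal ω) volume 0 T) :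
    cost M D 0 T χ ω = if energy T χ ω < ∞ then
      ((unaffectedCost M D T χ ω + permanentCost M D T χ ω + η * (energy T χ ω).toReal : ℝ) :
        EReal) else ⊤ := by
  set g : ℝ → ℝ := fun s => χ.ξ s.toNNReal ω with hg
  have htr : ∀ s ∈ Set.uIoc (0 : ℝ) T, χ.traded s.toNNReal ω = ∫ u in (0 : ℝ)..s, g u := by
    intro s hs
    rw [Set.uIoc_of_le T.coe_nonneg] at hs
    rw [Strategy.traded, Real.coe_toNNReal _ hs.1.le]
  have e : ∀ s ∈ Set.uIoc (0 : ℝ) T, χ.ξ s.toNNReal ω * exchangePrice M χ s.toNNReal ω =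
      (g s * M.price s.toNNReal ω + M.γ * (g s * ∫ u in (0 : ℝ)..s, g u)) + η * g s ^ 2 := by
    intro s hs
    rw [exchangePrice, htr s hs, hh]
    simp only [hg]; ring
  have i1 : IntervalIntegrable (fun s => g s * M.price s.toNNReal ω) volume 0 T :=
    intervalIntegrable_mul_cadlag (f := fun t => M.price t ω) hξ hcad
  have i2 : IntervalIntegrable (fun s => M.γ * (g s * ∫ u in (0 : ℝ)..s, g u)) volume 0 T :=
    (hξ.mul_continuousOn (continuous_integral_interval hξ)).const_mul _
  have hiff : IntervalIntegrable
      (fun t : ℝ => χ.ξ t.toNNReal ω * exchangePrice M χ t.toNNReal ω) volume 0 T ↔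
      energy T χ ω < ∞ := by
    rw [energy_lt_top_iff hξ]
    constructor
    · intro h
      have h3 := ((h.congr e).sub (i1.add i2)).const_mul η⁻¹
      refine h3.congr fun s _ => ?_
      simp only [hg]
      field_simp
      ring
    · intro h
      exact ((i1.add i2).add (h.const_mul η)).congr fun s hs => (e s hs).symm
  unfold cost
  by_cases hfin : energy T χ ω < ∞
  · rw [if_pos (hiff.2 hfin), if_pos hfin]
    congr 1
    have i3 : IntervalIntegrable (fun s => η * g s ^ 2) volume 0 T :=
      ((energy_lt_top_iff hξ).1 hfin).const_mul η
    rw [intervalIntegral.integral_congr_ae (ae_of_all _ e),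
      intervalIntegral.integral_add (i1.add i2) i3, intervalIntegral.integral_add i1 i2,
      intervalIntegral.integral_const_mul, intervalIntegral.integral_const_mul,
      integral_mul_primitive hξ, ← toReal_energy hξ]
    have hsum := hω.sum_executed χ.x χ.Ξ (χ.ρ ω) fun i => darkPrice M D χ (D.τ i ω) ω
    have hs' : ∑ i ∈ Finset.range (D.count (χ.ρ ω) ω), D.executed χ.x χ.Ξ i ω *
          (darkPrice M D χ (D.τ i ω) ω
            + D.α * M.γ * (∑ j ∈ Finset.range i, D.executed χ.x χ.Ξ j ω)
            + D.β (D.executed χ.x χ.Ξ i ω)) =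
        if D.τ 0 ω ≤ χ.ρ ω then χ.x * darkPrice M D χ (D.τ 0 ω) ω else 0 := by
      rw [← hsum]
      refine Finset.sum_congr rfl fun i _ => ?_
      rw [hα, hβ]; simp
    rw [hs', hα]
    unfold unaffectedCost permanentCost
    simp only [darkPrice, hκ, zero_mul, add_zero, zero_add, Strategy.traded]
    split_ifs <;> ring
  · rw [if_neg (hiff.not.2 hfin), if_neg hfin]

end Decomposition

/-! ### Measurability -/

section Measurability

variable {Ω : Type*} [mΩ : MeasurableSpace Ω]

theorem predictable_le_prod (𝒢 : Filtration ℝ≥0 mΩ) :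
    𝒢.predictable ≤ (Prod.instMeasurableSpace : MeasurableSpace (ℝ≥0 × Ω)) :=
  measurableSpace_le_predictable_of_measurableSet
    (fun _ hA => (measurableSet_singleton _).prod (𝒢.le _ _ hA))
    fun _ _ hA => measurableSet_Ioi.prod (𝒢.le _ _ hA)

/-- Capping the time at t does not alter the integral up to t, but lets the integrand be measurable
using only times up to t, as progressive measurability provides. -/
theorem stronglyMeasurable_primitive {Ω : Type*} {m : MeasurableSpace Ω} {ξ : ℝ≥0 → Ω → ℝ}
    {t : ℝ≥0} (hξ : Measurable fun p : ℝ × Ω => ξ (min p.1.toNNReal t) p.2) :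
    StronglyMeasurable fun ω => ∫ s in (0 : ℝ)..t, ξ s.toNNReal ω := by
  have h := (StronglyMeasurable.integral_prod_left
    (μ := (volume : Measure ℝ).restrict (Set.Ioc 0 (t : ℝ)))
    (f := fun s ω => ξ (min s.toNNReal t) ω) hξ.stronglyMeasurable)
  refine (congrArg (fun f => StronglyMeasurable f) (funext fun ω => ?_)).mp h
  rw [intervalIntegral.integral_of_le t.coe_nonneg]
  refine setIntegral_congr_fun measurableSet_Ioc fun s hs => ?_
  have : min s.toNNReal t = s.toNNReal := min_eq_left (Real.toNNReal_le_iff_le_coe.2 hs.2)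
  simp only [this]

variable {𝒢 : Filtration ℝ≥0 mΩ} {χ : Strategy Ω}

theorem stronglyMeasurable_traded (hξ : IsStronglyPredictable 𝒢 χ.ξ) (t : ℝ≥0) :
    StronglyMeasurable[𝒢 t] (χ.traded t) := by
  have hp := (hξ.isStronglyProgressive t).measurable
  refine stronglyMeasurable_primitive (m := 𝒢 t) ?_
  have hmin : Measurable fun s : ℝ => (⟨min s.toNNReal t, Set.mem_Iic.2 (min_le_right _ _)⟩ : Set.Iic t) :=
    (measurable_real_toNNReal.min measurable_const).subtype_mk
  have hpair : @Measurable (ℝ × Ω) (Set.Iic t × Ω) (Prod.instMeasurableSpace (m₂ := 𝒢 t))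
      (Prod.instMeasurableSpace (m₂ := 𝒢 t))
      fun p => (⟨min p.1.toNNReal t, Set.mem_Iic.2 (min_le_right _ _)⟩, p.2) :=
    (hmin.comp measurable_fst).prodMk measurable_snd
  exact hp.comp hpair

theorem measurable_uncurry_of_predictable (hξ : IsStronglyPredictable 𝒢 χ.ξ) :
    Measurable (Function.uncurry χ.ξ) :=
  (StronglyMeasurable.mono hξ (predictable_le_prod 𝒢)).measurable

theorem measurable_traded_comp (hξ : Measurable (Function.uncurry χ.ξ)) {τ : Ω → ℝ≥0}
    (hτ : Measurable τ) : Measurable fun ω => χ.traded (τ ω) ω := by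
  have hm : Measurable fun p : ℝ × Ω =>
      (Set.Ioc (0 : ℝ) (τ p.2)).indicator (fun s => χ.ξ s.toNNReal p.2) p.1 := by
    have hS : MeasurableSet {p : ℝ × Ω | p.1 ∈ Set.Ioc (0 : ℝ) (τ p.2)} := by
      refine (measurableSet_lt measurable_const measurable_fst).inter
        (measurableSet_le measurable_fst ?_)
      exact hτ.coe_nnreal_real.comp measurable_snd
    have hξ' : Measurable fun p : ℝ × Ω => χ.ξ p.1.toNNReal p.2 :=
      hξ.comp ((measurable_real_toNNReal.comp measurable_fst).prodMk measurable_snd)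
    exact hξ'.indicator hS
  have h := (StronglyMeasurable.integral_prod_left (μ := (volume : Measure ℝ))
    (f := fun s ω => (Set.Ioc (0 : ℝ) (τ ω)).indicator (fun s => χ.ξ s.toNNReal ω) s)
    hm.stronglyMeasurable).measurable
  refine (congrArg (fun f => Measurable f) (funext fun ω => ?_)).mp h
  rw [Strategy.traded, intervalIntegral.integral_of_le (τ ω).coe_nonneg,
    integral_indicator measurableSet_Ioc]

theorem measurable_energy (hξ : Measurable (Function.uncurry χ.ξ)) (T : ℝ≥0) :
    Measurable (energy T χ) := by
  have hξ' : Measurable fun p : ℝ × Ω => ENNReal.ofReal (χ.ξ p.1.toNNReal p.2 ^ 2) :=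
    ((hξ.comp ((measurable_real_toNNReal.comp measurable_fst).prodMk
      measurable_snd)).pow_const 2).ennreal_ofReal
  exact hξ'.lintegral_prod_left'

variable {P : Measure Ω} {M : AlmgrenChriss P} {D : DarkPool Ω} {T : ℝ≥0}

theorem stronglyMeasurable_inventory (hχ : IsAdmissible M D 0 T χ) (t : ℝ≥0) :
    StronglyMeasurable[D.enlarged M.filtration χ.x χ.Ξ t] (inventory D χ t) := by
  have hτ := D.isStoppingTime_τ M.filtration χ.x χ.Ξ 0
  have hS : MeasurableSet[D.enlarged M.filtration χ.x χ.Ξ t]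
      {ω | D.τ 0 ω ≤ t ∧ D.τ 0 ω ≤ χ.ρ ω} := by
    -- The event τ_0 ≤ ρ belongs to the σ-algebra at the stopping time τ_0, hence its intersection
    -- with τ_0 ≤ t is known at time t.
    have := (hτ.measurableSet _).1 (hτ.measurableSet_le_stopping_time hχ.stopping)
    have h2 := this.2 t
    simp only [WithTop.coe_le_coe] at h2
    have e : {ω | D.τ 0 ω ≤ t ∧ D.τ 0 ω ≤ χ.ρ ω} =
        {ω | D.τ 0 ω ≤ χ.ρ ω} ∩ {ω | D.τ 0 ω ≤ t} := by
      ext ω; exact and_comm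
    rw [e]; exact h2
  classical
  refine (stronglyMeasurable_traded hχ.predictable t).add ?_
  exact StronglyMeasurable.ite hS stronglyMeasurable_const stronglyMeasurable_const

theorem measurable_permanentCost (hχ : IsAdmissible M D 0 T χ) :
    Measurable (permanentCost M D T χ) := by
  have hρ : Measurable χ.ρ := by
    refine measurable_of_Iic fun t => ?_
    have := (D.enlarged M.filtration χ.x χ.Ξ).le t _ (hχ.stopping t)
    simp only [WithTop.coe_le_coe] at this
    exact this
  have hξ := measurable_uncurry_of_predictable hχ.predictable
  have h1 := measurable_traded_comp hξ (measurable_const (a := T))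
  have h2 := measurable_traded_comp hξ (D.τ_measurable 0)
  refine Measurable.add (((h1.pow_const 2).div_const 2).const_mul _) ?_
  exact Measurable.ite (measurableSet_le (D.τ_measurable 0) hρ)
    ((h2.const_mul _).const_mul _) measurable_const

end Measurability

/-! ### The expected impact costs are nonnegative -/

section ExponentialClock

open Classical in
/-- The impact costs per unit of time at time `t`, for the trading rate `y`, when the order is
matched at time `s` and cancelled at time `r`. -/
def impactRate (a η : ℝ) (y r s t : ℝ) : ℝ :=
  (if t < s ∧ s ≤ r then a * y else 0) + if t < s ∧ t < r then η * y ^ 2 else 0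

theorem impactRate_of_le {a η y r s t : ℝ} (h : r ≤ t) : impactRate a η y r s t = 0 := by
  unfold impactRate
  rw [if_neg (by rintro ⟨h1, h2⟩; linarith), if_neg (by rintro ⟨_, h2⟩; linarith), add_zero]

theorem abs_impactRate_le (a : ℝ) {η : ℝ} (hη : 0 < η) (y r s t : ℝ) :
    |impactRate a η y r s t| ≤ |a| + (|a| + η) * if t < s ∧ t < r then y ^ 2 else 0 := by
  unfold impactRate
  have hy : |y| ≤ 1 + y ^ 2 := by
    rw [← sq_abs]; nlinarith [abs_nonneg y, sq_nonneg (|y| - 1)]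
  have ha := abs_nonneg a
  refine (abs_add_le _ _).trans ?_
  by_cases h2 : t < s ∧ t < r
  · rw [if_pos h2, if_pos h2, abs_of_nonneg (by positivity : 0 ≤ η * y ^ 2)]
    split_ifs
    · rw [abs_mul]; nlinarith
    · rw [abs_zero]; nlinarith [sq_nonneg y]
  · rw [if_neg h2, if_neg h2, if_neg fun h => h2 ⟨h.1, h.1.trans_le h.2⟩]
    simp

theorem measurable_impactRate (a η : ℝ) :
    Measurable fun p : ℝ × ℝ × ℝ × ℝ => impactRate a η p.1 p.2.1 p.2.2.1 p.2.2.2 := by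
  unfold impactRate
  have m1 : MeasurableSet {p : ℝ × ℝ × ℝ × ℝ | p.2.2.2 < p.2.2.1} :=
    measurableSet_lt (by fun_prop) (by fun_prop)
  have m2 : MeasurableSet {p : ℝ × ℝ × ℝ × ℝ | p.2.2.1 ≤ p.2.1} :=
    measurableSet_le (by fun_prop) (by fun_prop)
  have m3 : MeasurableSet {p : ℝ × ℝ × ℝ × ℝ | p.2.2.2 < p.2.1} :=
    measurableSet_lt (by fun_prop) (by fun_prop)
  exact (Measurable.ite (m1.inter m2) (by fun_prop) measurable_const).add
    (Measurable.ite (m1.inter m3) (by fun_prop) measurable_const)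

/-- The law of `s` has exponential tails. -/
def HasExpTail (ν : Measure ℝ) (θ : ℝ) : Prop := ∀ t, 0 ≤ t → ν.real (Set.Ioi t) = Real.exp (-(θ * t))

variable {ν : Measure ℝ} [IsProbabilityMeasure ν] {θ : ℝ}

theorem HasExpTail.real_Ioc (h : HasExpTail ν θ) {t r : ℝ} (ht : 0 ≤ t) (htr : t ≤ r) :
    ν.real (Set.Ioc t r) = Real.exp (-(θ * t)) - Real.exp (-(θ * r)) := by
  rw [← h t ht, ← h r (ht.trans htr), ← Set.Ioi_sdiff_Ioi,
    measureReal_sdiff (Set.Ioi_subset_Ioi htr) measurableSet_Ioi]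

theorem HasExpTail.real_Iic (h : HasExpTail ν θ) {r : ℝ} (hr : 0 ≤ r) :
    ν.real (Set.Iic r) = 1 - Real.exp (-(θ * r)) := by
  rw [← h r hr, ← Set.compl_Ioi, measureReal_compl measurableSet_Ioi, probReal_univ]

/-- With E = e^{-θt} and E' = e^{-θr}, averaging over the arrival gives ay(E - E') + ηy²E for t < r.
Completing the square bounds it below by -a²(E - E')²/(4ηE) ≥ -a²E/(4η), uniformly in y. -/
theorem integral_impactRate_ge (h : HasExpTail ν θ) (hθ : 0 < θ) (a : ℝ) {η : ℝ} (hη : 0 < η)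
    (y r : ℝ) {t : ℝ} (ht : 0 ≤ t) :
    -(a ^ 2 / (4 * η)) * (if t < r then Real.exp (-(θ * t)) else 0) ≤
      ∫ s, impactRate a η y r s t ∂ν := by
  by_cases htr : t < r
  · rw [if_pos htr]
    have e : ∀ s, impactRate a η y r s t = (Set.Ioc t r).indicator (fun _ => a * y) s +
        (Set.Ioi t).indicator (fun _ => η * y ^ 2) s := fun s => by
      simp only [impactRate, Set.indicator_apply, Set.mem_Ioc, Set.mem_Ioi, htr, and_true]
    simp_rw [e]
    rw [integral_add ((integrable_const _).indicator measurableSet_Ioc)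
      ((integrable_const _).indicator measurableSet_Ioi), integral_indicator_const _
      measurableSet_Ioc, integral_indicator_const _ measurableSet_Ioi, h.real_Ioc ht htr.le,
      h t ht, smul_eq_mul, smul_eq_mul]
    set E := Real.exp (-(θ * t))
    set E' := Real.exp (-(θ * r)) with hE'
    have hE : 0 < E := Real.exp_pos _
    have hE'0 : 0 < E' := Real.exp_pos _
    have hle : E' ≤ E := Real.exp_le_exp.2 (by nlinarith)
    have key : 0 ≤ 4 * η * E * ((E - E') * (a * y) + E * (η * y ^ 2)) + a ^ 2 * E ^ 2 := by
      have h1 : 0 ≤ (2 * η * E * y + a * (E - E')) ^ 2 := sq_nonneg _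
      have h2 : a ^ 2 * (E - E') ^ 2 ≤ a ^ 2 * E ^ 2 :=
        mul_le_mul_of_nonneg_left (by nlinarith) (sq_nonneg _)
      nlinarith
    have h3 : -(a ^ 2 / (4 * η)) * E = -(a ^ 2 * E ^ 2) / (4 * η * E) := by field_simp
    rw [h3, div_le_iff₀ (by positivity)]
    linarith
  · rw [if_neg htr, mul_zero]
    simp_rw [impactRate_of_le (not_lt.1 htr)]
    simp

theorem integral_exp_neg_mul (hθ : 0 < θ) {r T : ℝ} (hr : 0 ≤ r) (hrT : r ≤ T) :
    ∫ t in Set.Ioc 0 T, (if t < r then Real.exp (-(θ * t)) else 0) =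
      (1 - Real.exp (-(θ * r))) / θ := by
  have e : ∀ t, (if t < r then Real.exp (-(θ * t)) else 0) =
      (Set.Iio r).indicator (fun t => Real.exp (-(θ * t))) t := fun t => by
    simp [Set.indicator_apply]
  simp_rw [e]
  rw [setIntegral_indicator measurableSet_Iio]
  have hset : Set.Ioc 0 T ∩ Set.Iio r = Set.Ioo 0 r := by
    ext t
    simp only [Set.mem_inter_iff, Set.mem_Ioc, Set.mem_Iio, Set.mem_Ioo]
    constructor
    · rintro ⟨⟨h1, _⟩, h3⟩; exact ⟨h1, h3⟩
    · rintro ⟨h1, h2⟩; exact ⟨⟨h1, by linarith⟩, h2⟩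
  rw [hset, ← integral_Ioc_eq_integral_Ioo, ← intervalIntegral.integral_of_le hr]
  have hd : ∀ t ∈ Set.uIcc 0 r, HasDerivAt (fun t => -Real.exp (-(θ * t)) / θ)
      (Real.exp (-(θ * t))) t := fun t _ => by
    have h1 : HasDerivAt (fun t => -(θ * t)) (-θ) t := by
      have := (hasDerivAt_id t).const_mul (-θ)
      simpa [neg_mul] using this
    have h2 := (h1.exp.fun_neg).div_const θ
    have e2 : -(Real.exp (-(θ * t)) * -θ) / θ = Real.exp (-(θ * t)) := by field_simp
    rwa [e2] at h2
  rw [intervalIntegral.integral_eq_sub_of_hasDerivAt hd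
    ((by fun_prop : Continuous fun t => Real.exp (-(θ * t))).intervalIntegrable _ _)]
  simp
  ring

variable {Ω β : Type*} {mΩ : MeasurableSpace Ω} {mβ : MeasurableSpace β} {P : Measure Ω}
  [IsProbabilityMeasure P]

/-- The pointwise bound integrates in time to -(γx)²/(4ηθ)·P(s ≤ r), while the matched order
contributes γx²/2·P(s ≤ r). The sum carries the factor 2θη - γ. -/
theorem impact_prod_nonneg {μ : Measure β} [IsProbabilityMeasure μ] (h : HasExpTail ν θ)
    (hθ : 0 < θ) {γ η x T : ℝ} (hγ : 0 < γ) (hη : 0 < η) (hle : γ ≤ 2 * θ * η)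
    {r : β → ℝ} (hr : Measurable r) (hr0 : ∀ b, 0 ≤ r b) (hrT : ∀ b, r b ≤ T)
    {g : β → ℝ → ℝ}
    (hint : Integrable (fun p : (β × ℝ) × ℝ =>
      impactRate (γ * x) η (g p.1.1 p.2) (r p.1.1) p.1.2 p.2)
      ((μ.prod ν).prod (volume.restrict (Set.Ioc 0 T)))) :
    0 ≤ ∫ p : (β × ℝ) × ℝ, impactRate (γ * x) η (g p.1.1 p.2) (r p.1.1) p.1.2 p.2
        ∂((μ.prod ν).prod (volume.restrict (Set.Ioc 0 T))) +
      γ * x ^ 2 / 2 * (μ.prod ν).real {p | p.2 ≤ r p.1} := by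
  set lam := (volume : Measure ℝ).restrict (Set.Ioc 0 T) with hlam
  set c := (γ * x) ^ 2 / (4 * η) with hc
  have hw : Integrable (fun p : β × ℝ => if p.2 < r p.1 then Real.exp (-(θ * p.2)) else 0)
      (μ.prod lam) := by
    have hm : Measurable fun p : β × ℝ => if p.2 < r p.1 then Real.exp (-(θ * p.2)) else 0 :=
      Measurable.ite (measurableSet_lt measurable_snd (hr.comp measurable_fst)) (by fun_prop)
        measurable_const
    have hpos : ∀ᵐ p ∂(μ.prod lam), 0 < p.2 := by
      have h1 : ∀ᵐ t ∂lam, 0 < t := (ae_restrict_mem measurableSet_Ioc).mono fun t ht => ht.1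
      exact Measure.quasiMeasurePreserving_snd.ae h1
    refine (integrable_const (1 : ℝ)).mono hm.aestronglyMeasurable ?_
    filter_upwards [hpos] with p hp
    split_ifs
    · rw [Real.norm_of_nonneg (Real.exp_pos _).le, norm_one]
      exact Real.exp_le_one_iff.2 (by nlinarith)
    · simp
  have hmass : (μ.prod ν).real {p | p.2 ≤ r p.1} = ∫ b, (1 - Real.exp (-(θ * r b))) ∂μ := by
    have hS : MeasurableSet {p : β × ℝ | p.2 ≤ r p.1} :=
      measurableSet_le measurable_snd (hr.comp measurable_fst)
    have h1 := integral_prod (μ := μ) (ν := ν)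
      ({p : β × ℝ | p.2 ≤ r p.1}.indicator (fun _ => (1 : ℝ)))
      ((integrable_const _).indicator hS)
    rw [integral_indicator_const _ hS, smul_eq_mul, mul_one] at h1
    rw [h1]
    refine integral_congr_ae (ae_of_all _ fun b => ?_)
    have e : ∀ s, {p : β × ℝ | p.2 ≤ r p.1}.indicator (fun _ => (1 : ℝ)) (b, s) =
        (Set.Iic (r b)).indicator (fun _ => (1 : ℝ)) s := fun s => by
      simp [Set.indicator_apply]
    simp only [e]
    rw [integral_indicator_const _ measurableSet_Iic, h.real_Iic (hr0 b), smul_eq_mul, mul_one]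
  have hexp : Integrable (fun b => 1 - Real.exp (-(θ * r b))) μ := by
    refine (integrable_const (1 : ℝ)).mono
      (measurable_const.sub (Real.measurable_exp.comp
        (hr.const_mul θ).neg)).aestronglyMeasurable (ae_of_all _ fun b => ?_)
    have h1 : Real.exp (-(θ * r b)) ≤ 1 := Real.exp_le_one_iff.2 (by nlinarith [hr0 b])
    have h2 := Real.exp_pos (-(θ * r b))
    rw [norm_one, Real.norm_eq_abs]
    exact abs_le.2 ⟨by linarith, by linarith⟩
  have hlow : -c * ∫ b, (1 - Real.exp (-(θ * r b))) / θ ∂μ ≤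
      ∫ p : (β × ℝ) × ℝ, impactRate (γ * x) η (g p.1.1 p.2) (r p.1.1) p.1.2 p.2
        ∂((μ.prod ν).prod lam) := by
    -- Time is placed outermost, because the lower bound holds for each fixed t after averaging over
    -- s.
    rw [integral_prod_symm _ hint]
    have e1 : -c * ∫ b, (1 - Real.exp (-(θ * r b))) / θ ∂μ =
        ∫ t, ∫ b, -c * (if t < r b then Real.exp (-(θ * t)) else 0) ∂μ ∂lam := by
      have := integral_prod_symm (μ := μ) (ν := lam)
        (fun p : β × ℝ => -c * if p.2 < r p.1 then Real.exp (-(θ * p.2)) else 0)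
        (hw.const_mul _)
      simp only at this
      rw [← this, integral_const_mul, integral_prod _ hw]
      congr 1
      exact integral_congr_ae (ae_of_all _ fun b =>
        (integral_exp_neg_mul hθ (hr0 b) (hrT b)).symm)
    rw [e1]
    have hint2 := hint.swap.integral_prod_left
    refine integral_mono_ae (hw.const_mul (-c)).swap.integral_prod_left hint2 ?_
    have hae1 := hint.swap.prod_right_ae
    have hae2 := (hw.const_mul (-c)).swap.prod_right_ae
    filter_upwards [hae1, hae2, ae_restrict_mem measurableSet_Ioc] with t h1 h2 ht
    simp only [Function.comp_def, Prod.swap_prod_mk] at h1 h2 ⊢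
    rw [integral_prod _ h1]
    refine integral_mono h2 h1.integral_prod_left fun b => ?_
    exact integral_impactRate_ge h hθ (γ * x) hη (g b t) (r b) ht.1.le
  have hI0 : 0 ≤ ∫ b, (1 - Real.exp (-(θ * r b))) ∂μ := integral_nonneg fun b => by
    simp only [Pi.zero_apply, sub_nonneg]
    exact Real.exp_le_one_iff.2 (by nlinarith [hr0 b])
  rw [integral_div] at hlow
  rw [hmass]
  set I := ∫ b, (1 - Real.exp (-(θ * r b))) ∂μ
  have hfin : 0 ≤ -c * (I / θ) + γ * x ^ 2 / 2 * I := by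
    have e : -c * (I / θ) + γ * x ^ 2 / 2 * I =
        γ * x ^ 2 * I * (2 * θ * η - γ) / (4 * η * θ) := by
      rw [hc]; field_simp; ring
    rw [e]
    refine div_nonneg (mul_nonneg (by positivity) (by linarith)) (by positivity)
  linarith

/-- Independence turns the joint law into a product. The target β keeps its own σ-algebra, so that Z
may be the identity of Ω onto a coarser σ-algebra. -/
theorem impact_nonneg_of_indepFun {Z : Ω → β} (hZ : Measurable Z) {τ : Ω → ℝ}
    (hτ : Measurable τ) (hind : IndepFun Z τ P)
    (hlaw : HasExpTail (P.map τ) θ)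
    (hθ : 0 < θ) {γ η x T : ℝ} (hγ : 0 < γ) (hη : 0 < η) (hle : γ ≤ 2 * θ * η)
    {r : β → ℝ} (hr : Measurable r) (hr0 : ∀ b, 0 ≤ r b) (hrT : ∀ b, r b ≤ T)
    {g : β → ℝ → ℝ} (hg : Measurable (Function.uncurry g))
    (hint : Integrable (fun p : Ω × ℝ =>
      impactRate (γ * x) η (g (Z p.1) p.2) (r (Z p.1)) (τ p.1) p.2)
      (P.prod (volume.restrict (Set.Ioc 0 T)))) :
    0 ≤ (∫ ω, (∫ t in Set.Ioc 0 T, impactRate (γ * x) η (g (Z ω) t) (r (Z ω)) (τ ω) t) ∂P) +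
      γ * x ^ 2 / 2 * P.real {ω | τ ω ≤ r (Z ω)} := by
  have : IsProbabilityMeasure (P.map Z) := Measure.isProbabilityMeasure_map hZ.aemeasurable
  have : IsProbabilityMeasure (P.map τ) := Measure.isProbabilityMeasure_map hτ.aemeasurable
  have hjoint : P.map (fun ω => (Z ω, τ ω)) = (P.map Z).prod (P.map τ) :=
    (indepFun_iff_map_prod_eq_prod_map_map hZ.aemeasurable hτ.aemeasurable).1 hind
  set lam := (volume : Measure ℝ).restrict (Set.Ioc 0 T) with hlam
  have hpm : Measurable fun ω => (Z ω, τ ω) := hZ.prodMk hτ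
  have htriple : (P.prod lam).map (Prod.map (fun ω => (Z ω, τ ω)) id) =
      ((P.map Z).prod (P.map τ)).prod lam := by
    rw [← hjoint, ← Measure.map_prod_map _ _ hpm measurable_id, Measure.map_id]
  have hmeas : Measurable fun p : (β × ℝ) × ℝ =>
      impactRate (γ * x) η (g p.1.1 p.2) (r p.1.1) p.1.2 p.2 := by
    refine (measurable_impactRate (γ * x) η).comp
      (f := fun p : (β × ℝ) × ℝ => (g p.1.1 p.2, r p.1.1, p.1.2, p.2)) ?_
    refine Measurable.prodMk ?_ (Measurable.prodMk ?_ (by fun_prop))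
    · exact hg.comp (f := fun p : (β × ℝ) × ℝ => (p.1.1, p.2)) (by fun_prop)
    · exact hr.comp (by fun_prop)
  have hint' : Integrable (fun p : (β × ℝ) × ℝ =>
      impactRate (γ * x) η (g p.1.1 p.2) (r p.1.1) p.1.2 p.2)
      (((P.map Z).prod (P.map τ)).prod lam) := by
    rw [← htriple, integrable_map_measure hmeas.aestronglyMeasurable
      (hpm.prodMap measurable_id).aemeasurable]
    exact hint
  have hS : MeasurableSet {p : β × ℝ | p.2 ≤ r p.1} :=
    measurableSet_le measurable_snd (hr.comp measurable_fst)
  have h := impact_prod_nonneg hlaw hθ hγ hη hle hr hr0 hrT hint'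
  rw [← htriple, integral_map (hpm.prodMap measurable_id).aemeasurable
    hmeas.aestronglyMeasurable, ← hjoint, map_measureReal_apply hpm hS,
    integral_prod] at h
  · exact h
  · exact hint

end ExponentialClock

/-! ### Impact costs of an arbitrary round trip. -/

section Sufficiency

/-- Only the energy spent after the arrival s or after r is discarded; before s the rates ξ and g
coincide. -/
theorem integral_impactRate_le {ξ g : ℝ → ℝ} {a η T s r : ℝ} (hη : 0 < η) (hT : 0 ≤ T)
    (hs : 0 ≤ s) (hrT : r ≤ T) (hξ : IntervalIntegrable ξ volume 0 T)
    (hξ2 : IntervalIntegrable (fun t => ξ t ^ 2) volume 0 T)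
    (hg : ∀ t ∈ Set.Ioc 0 T, t < s → ξ t = g t) :
    ∫ t in Set.Ioc 0 T, impactRate a η (g t) r s t ≤
      (if s ≤ r then a * ∫ t in (0 : ℝ)..s, ξ t else 0) + η * ∫ t in (0 : ℝ)..T, ξ t ^ 2 := by
  have e : ∀ t ∈ Set.Ioc 0 T, impactRate a η (g t) r s t =
      (if s ≤ r then a else 0) * (Set.Iio s).indicator ξ t +
        (Set.Iio s ∩ Set.Iio r).indicator (fun t => η * ξ t ^ 2) t := by
    intro t ht
    by_cases h : t < s
    · by_cases h1 : s ≤ r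
      · have h2 : t < r := h.trans_le h1
        simp [impactRate, h, h1, h2, hg t ht h]
      · simp [impactRate, Set.indicator_apply, h, h1, hg t ht h]
    · simp [impactRate, h]
  rw [intervalIntegrable_iff, Set.uIoc_of_le hT] at hξ hξ2
  rw [setIntegral_congr_fun measurableSet_Ioc e, integral_add
    ((hξ.indicator measurableSet_Iio).const_mul _)
    ((hξ2.const_mul η).indicator (measurableSet_Iio.inter measurableSet_Iio)),
    integral_const_mul, setIntegral_indicator measurableSet_Iio,
    intervalIntegral.integral_of_le hT]
  refine add_le_add (le_of_eq ?_) ?_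
  · split_ifs with h
    · rw [intervalIntegral.integral_of_le hs, integral_Ioc_eq_integral_Ioo (x := 0) (y := s)]
      congr 3
      ext t
      simp only [Set.mem_inter_iff, Set.mem_Ioc, Set.mem_Iio, Set.mem_Ioo]
      exact ⟨fun ⟨h1, h2⟩ => ⟨h1.1, h2⟩, fun ⟨h1, h2⟩ => ⟨⟨h1, by linarith⟩, h2⟩⟩
    · rw [zero_mul]
  · rw [← integral_const_mul]
    refine integral_mono ((hξ2.const_mul η).indicator (measurableSet_Iio.inter measurableSet_Iio))
      (hξ2.const_mul η) fun t => ?_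
    exact Set.indicator_le_self' (fun _ _ => by positivity) t

variable {Ω : Type*} [mΩ : MeasurableSpace Ω] {P : Measure Ω} [IsProbabilityMeasure P]
  {M : AlmgrenChriss P} {D : DarkPool Ω} {θ : ℝ≥0} {ν : Measure ℝ≥0∞} {T : ℝ≥0} {χ : Strategy Ω}

theorem IsAdmissible.traded_eq (hD : PoissonAssumption M D θ ν) (hν : ν = Measure.dirac ∞)
    (hχ : IsAdmissible M D 0 T χ) :
    ∀ᵐ ω ∂P, χ.traded T ω = -if D.τ 0 ω ≤ χ.ρ ω then χ.x else 0 := by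
  filter_upwards [hχ.liquidation, D.ae_regular hD hν] with ω h1 h2
  rw [h2.Z_eq] at h1
  linarith

theorem IsAdmissible.exists_abs_permanentCost_le (hχ : IsAdmissible M D 0 T χ) :
    ∃ C : ℝ, ∀ᵐ ω ∂P, |permanentCost M D T χ ω| ≤ C := by
  obtain ⟨K, hK⟩ := hχ.bounded
  have hγ := M.γ_pos
  refine ⟨M.γ * (K ^ 2 / 2) + |χ.x| * (M.γ * K), ?_⟩
  filter_upwards [hK, hχ.cancel_lt] with ω h1 h2
  have hK0 : 0 ≤ K := (abs_nonneg _).trans (h1 T le_rfl)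
  unfold permanentCost
  refine (abs_add_le _ _).trans (add_le_add ?_ ?_)
  · rw [abs_of_nonneg (by positivity)]
    have := sq_le_sq' (abs_le.1 (h1 T le_rfl)).1 (abs_le.1 (h1 T le_rfl)).2
    gcongr
  · split_ifs with h
    · rw [abs_mul, abs_mul, abs_of_pos hγ]
      have := h1 _ (h.trans h2.le)
      gcongr
    · rw [abs_zero]; positivity

theorem IsAdmissible.integrable_permanentCost (hχ : IsAdmissible M D 0 T χ) :
    Integrable (permanentCost M D T χ) P := by
  obtain ⟨C, hC⟩ := hχ.exists_abs_permanentCost_le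
  exact Integrable.of_bound (measurable_permanentCost hχ).aestronglyMeasurable C hC

theorem map_arrival_hasExpTail (hD : PoissonAssumption M D θ ν) :
    HasExpTail (P.map fun ω => (D.τ 0 ω : ℝ)) θ := by
  intro t ht
  lift t to ℝ≥0 using ht
  rw [map_measureReal_apply (D.τ_measurable 0).coe_nnreal_real measurableSet_Ioi,
    ← D.measureReal_lt_arrival hD.poisson hD.θ_pos]
  congr 1

theorem integrable_sq_prod (hξ : Measurable (Function.uncurry χ.ξ))
    (hE : ∫⁻ ω, energy T χ ω ∂P ≠ ∞) :
    Integrable (fun p : Ω × ℝ => χ.ξ p.2.toNNReal p.1 ^ 2)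
      (P.prod (volume.restrict (Set.Ioc 0 (T : ℝ)))) := by
  have hm : Measurable fun p : Ω × ℝ => χ.ξ p.2.toNNReal p.1 ^ 2 :=
    (hξ.comp ((measurable_real_toNNReal.comp measurable_snd).prodMk measurable_fst)).pow_const 2
  refine ⟨hm.aestronglyMeasurable, ?_⟩
  rw [hasFiniteIntegral_iff_ofReal (ae_of_all _ fun _ => sq_nonneg _),
    lintegral_prod _ hm.ennreal_ofReal.aemeasurable]
  exact hE.lt_top

theorem measurable_uncurry_toNNReal {Ω : Type*} {m : MeasurableSpace Ω} {g : ℝ≥0 × Ω → ℝ}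
    (hg : Measurable g) : Measurable (Function.uncurry fun ω (t : ℝ) => g (t.toNNReal, ω)) :=
  hg.comp ((measurable_real_toNNReal.comp measurable_snd).prodMk measurable_fst)

/-- Up to τ_0 the strategy is replaced by ℱ_∞-measurable data (g, r), independent of τ_0. What it
does after the arrival enters only through its energy, which is nonnegative. -/
theorem expected_impact_nonneg (hD : PoissonAssumption M D θ ν) (hν : ν = Measure.dirac ∞)
    (hχ : IsAdmissible M D 0 T χ) {η : ℝ} (hη : 0 < η) (hle : M.γ ≤ 2 * θ * η)
    (hE : ∫⁻ ω, energy T χ ω ∂P ≠ ∞) :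
    0 ≤ ∫ ω, permanentCost M D T χ ω ∂P + η * ∫ ω, (energy T χ ω).toReal ∂P := by
  obtain ⟨g, hgm, hg⟩ := D.exists_eq_of_predictable hχ.predictable
  obtain ⟨r, hrm, hr⟩ := D.exists_eq_of_stoppingTime hχ.stopping
  have hξ := measurable_uncurry_of_predictable hχ.predictable
  have hEm := measurable_energy hξ T
  have hle' : (⨆ t, M.filtration t : MeasurableSpace Ω) ≤ mΩ := iSup_le M.filtration.le
  have hminT : ∀ ω, min (r ω) (T : ℝ≥0∞) ≠ ∞ := fun ω =>
    ne_top_of_le_ne_top ENNReal.coe_ne_top (min_le_right _ _)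
  have hind : @IndepFun Ω Ω ℝ mΩ (⨆ t, M.filtration t) _ id (fun ω => (D.τ 0 ω : ℝ)) P := by
    refine (@IndepFun_iff_Indep Ω Ω ℝ mΩ (⨆ t, M.filtration t) _ id _ P).2 ?_
    refine indep_of_indep_of_le_left (indep_of_indep_of_le_right (D.indep_arrivals hD) ?_) ?_
    · exact Measurable.comap_le (measurable_coe_nnreal_real.comp (D.measurable_arrivals_τ hD 0))
    · exact le_of_eq MeasurableSpace.comap_id
  have hgr : @Measurable (Ω × ℝ) ℝ (@Prod.instMeasurableSpace _ _ (⨆ t, M.filtration t) _) _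
      (Function.uncurry fun ω (t : ℝ) => g (t.toNNReal, ω)) := by
    exact @measurable_uncurry_toNNReal Ω (⨆ t, M.filtration t) g hgm
  have heq : ∀ ω (t : ℝ), t < D.τ 0 ω → χ.ξ t.toNNReal ω = g (t.toNNReal, ω) := fun ω t ht =>
    hg _ _ (Real.toNNReal_le_iff_le_coe.2 ht.le)
  have hint : Integrable (fun p : Ω × ℝ => impactRate (M.γ * χ.x) η (g (p.2.toNNReal, p.1))
      (min (r p.1) T).toReal (D.τ 0 p.1) p.2) (P.prod (volume.restrict (Set.Ioc 0 (T : ℝ)))) := by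
    have hsq := integrable_sq_prod hξ hE
    refine ((integrable_const |M.γ * χ.x|).add (hsq.const_mul (|M.γ * χ.x| + η))).mono' ?_ ?_
    · refine ((measurable_impactRate (M.γ * χ.x) η).comp (f := fun p : Ω × ℝ =>
        (g (p.2.toNNReal, p.1), (min (r p.1) (T : ℝ≥0∞)).toReal, (D.τ 0 p.1 : ℝ), p.2))
        ?_).aestronglyMeasurable
      refine Measurable.prodMk ?_ (Measurable.prodMk ?_ (Measurable.prodMk ?_ measurable_snd))
      · exact measurable_uncurry_toNNReal
          (hgm.mono (sup_le_sup le_rfl (MeasurableSpace.comap_mono hle')) le_rfl)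
      · exact (((hrm.mono hle' le_rfl).min measurable_const).ennreal_toReal).comp measurable_fst
      · exact (D.τ_measurable 0).coe_nnreal_real.comp measurable_fst
    · refine ae_of_all _ fun p => (abs_impactRate_le _ hη _ _ _ _).trans ?_
      simp only [Pi.add_apply]
      gcongr
      split_ifs with h
      · rw [heq _ _ h.1]
      · positivity
  -- Here Z is the identity from Ω to Ω with the σ-algebra ℱ_∞.
  have key := @impact_nonneg_of_indepFun θ Ω Ω mΩ (⨆ t, M.filtration t) P _ id
    (measurable_id'' hle') (fun ω => (D.τ 0 ω : ℝ)) (D.τ_measurable 0).coe_nnreal_real hind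
    (map_arrival_hasExpTail hD) (by exact_mod_cast hD.θ_pos) M.γ η χ.x T M.γ_pos hη hle
    (fun ω => (min (r ω) (T : ℝ≥0∞)).toReal)
    ((hrm.min measurable_const).ennreal_toReal) (fun _ => ENNReal.toReal_nonneg)
    (fun ω => ENNReal.toReal_le_of_le_ofReal T.coe_nonneg (by simp))
    (fun ω t => g (t.toNNReal, ω)) hgr hint
  refine key.trans ?_
  have hS : MeasurableSet {ω | (D.τ 0 ω : ℝ) ≤ (min (r ω) (T : ℝ≥0∞)).toReal} :=
    measurableSet_le (D.τ_measurable 0).coe_nnreal_real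
      ((hrm.mono hle' le_rfl).min measurable_const).ennreal_toReal
  have hfin := ae_lt_top hEm hE
  have hQ : Integrable (fun ω => (energy T χ ω).toReal) P :=
    integrable_toReal_of_lintegral_ne_top hEm.aemeasurable hE
  have hind1 := (integrable_const (μ := P) (M.γ * χ.x ^ 2 / 2)).indicator hS
  have e1 : M.γ * χ.x ^ 2 / 2 * P.real {ω | (D.τ 0 ω : ℝ) ≤ (min (r ω) (T : ℝ≥0∞)).toReal} =
      ∫ ω, {ω | (D.τ 0 ω : ℝ) ≤ (min (r ω) (T : ℝ≥0∞)).toReal}.indicator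
        (fun _ => M.γ * χ.x ^ 2 / 2) ω ∂P := by
    rw [integral_indicator_const _ hS, smul_eq_mul, mul_comm]
  simp only [id_eq]
  rw [e1, ← integral_const_mul, ← integral_add hint.integral_prod_left hind1,
    ← integral_add hχ.integrable_permanentCost (hQ.const_mul η)]
  refine integral_mono_ae (hint.integral_prod_left.add hind1)
    (hχ.integrable_permanentCost.add (hQ.const_mul η)) ?_
  filter_upwards [hfin, hχ.integrable, hχ.traded_eq hD hν, hχ.cancel_lt] with ω h1 h2 h3 h4
  -- Capping r, which may be infinite, at T loses nothing because ρ < T.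
  have hiff : (D.τ 0 ω : ℝ) ≤ (min (r ω) (T : ℝ≥0∞)).toReal ↔ D.τ 0 ω ≤ χ.ρ ω := by
    rw [hr ω, ← ENNReal.ofReal_le_iff_le_toReal (hminT ω), ENNReal.ofReal_coe_nnreal, le_min_iff,
      and_iff_left_iff_imp, ← hr ω]
    intro h
    exact_mod_cast h.trans h4.le
  have h5 := integral_impactRate_le (a := M.γ * χ.x) (r := (min (r ω) (T : ℝ≥0∞)).toReal)
    (s := D.τ 0 ω) (g := fun t => g (t.toNNReal, ω)) hη T.coe_nonneg (D.τ 0 ω).coe_nonneg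
    (ENNReal.toReal_le_of_le_ofReal T.coe_nonneg (by simp)) h2 ((energy_lt_top_iff h2).1 h1)
    fun t _ ht => heq ω t ht
  rw [← toReal_energy h2] at h5
  refine (add_le_add_left h5 _).trans (le_of_eq ?_)
  rw [permanentCost, h3, Set.indicator_apply]
  simp only [Set.mem_ofPred_eq, hiff, Strategy.traded]
  split_ifs <;> ring

end Sufficiency

/-! ### Absence of price manipulation when γ ≤ 2θη. -/

section NoManipulation

variable {Ω : Type*} [mΩ : MeasurableSpace Ω] {P : Measure Ω} [IsProbabilityMeasure P]
  {M : AlmgrenChriss P} {D : DarkPool Ω} {θ : ℝ≥0} {ν : Measure ℝ≥0∞} {T : ℝ≥0} {χ : Strategy Ω}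

theorem IsAdmissible.tendsto_stieltjesSum (hχ : IsAdmissible M D 0 T χ) (hT : 0 < T) :
    ∀ᵐ ω ∂P, Tendsto (fun n => stieltjesSum (inventory D χ) M.price T n ω) atTop
      (𝓝 (unaffectedCost M D T χ ω)) := by
  filter_upwards [hχ.integrable, hχ.cancel_lt] with ω h1 h2
  exact tendsto_stieltjesSum_inventory hT (M.price_cadlag ω) h1 h2

theorem IsAdmissible.aestronglyMeasurable_unaffectedCost (hχ : IsAdmissible M D 0 T χ)
    (hT : 0 < T) : AEStronglyMeasurable (unaffectedCost M D T χ) P :=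
  aestronglyMeasurable_of_tendsto_stieltjesSum
    (fun t => (M.price_martingale.stronglyAdapted t).mono (M.filtration.le t))
    (fun t => (stronglyMeasurable_inventory hχ t).mono (Filtration.le _ t))
    (hχ.tendsto_stieltjesSum hT)

theorem tendsto_truncation_unaffectedCost (hD : PoissonAssumption M D θ ν)
    (hν : ν = Measure.dirac ∞) (hχ : IsAdmissible M D 0 T χ) (hT : 0 < T) :
    Tendsto (fun m => ∫ ω, truncation m (unaffectedCost M D T χ ω) ∂P) atTop (𝓝 0) := by
  obtain ⟨K, hK⟩ := hχ.bounded
  refine tendsto_integral_truncation_stieltjes (K := K + |χ.x|)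
    (D.martingale_price hD hν χ.x χ.Ξ) (stronglyMeasurable_inventory hχ) ?_ ?_ ?_
    (hχ.tendsto_stieltjesSum hT)
  · filter_upwards [hK] with ω h t ht
    refine (abs_add_le _ _).trans (add_le_add (h t ht) ?_)
    split_ifs
    · rfl
    · rw [abs_zero]; exact abs_nonneg _
  · refine ae_of_all _ fun ω => ?_
    have := (D.τ_pos ω).not_ge
    simp [inventory, Strategy.traded, this]
  · filter_upwards [hχ.traded_eq hD hν, hχ.cancel_lt] with ω h1 h2
    rw [inventory, h1]
    have h3 : (D.τ 0 ω ≤ T ∧ D.τ 0 ω ≤ χ.ρ ω) ↔ D.τ 0 ω ≤ χ.ρ ω :=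
      and_iff_right_of_imp fun h => h.trans h2.le
    simp only [h3]
    split_ifs <;> ring

open Classical in
theorem ae_cost_eq (hD : PoissonAssumption M D θ ν) (hν : ν = Measure.dirac ∞) {η : ℝ}
    (hη : 0 < η) (hα : D.α = 0) (hκ : D.κ = 0) (hh : ∀ x, M.h x = η * x)
    (hχ : IsAdmissible M D 0 T χ) :
    ∀ᵐ ω ∂P, cost M D 0 T χ ω = if energy T χ ω < ∞ then
      ((unaffectedCost M D T χ ω + permanentCost M D T χ ω + η * (energy T χ ω).toReal : ℝ) :
        EReal) else ⊤ := by
  filter_upwards [D.ae_regular hD hν, hχ.integrable] with ω h1 h2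
  exact cost_eq hη hα hκ hD.β_zero hh h1 (M.price_cadlag ω) h2

theorem negativeExpectation_coe_iff {f : Ω → ℝ} (hf : Integrable f P) {C : Ω → EReal}
    (hC : ∀ᵐ ω ∂P, C ω = f ω) : NegativeExpectation P C ↔ ∫ ω, f ω ∂P < 0 := by
  have h1 : ∫⁻ ω, (C ω).toENNReal ∂P = ∫⁻ ω, ENNReal.ofReal (f ω) ∂P :=
    lintegral_congr_ae <| hC.mono fun ω h => by simp [h]
  have h2 : ∫⁻ ω, (-(C ω)).toENNReal ∂P = ∫⁻ ω, ENNReal.ofReal (-f ω) ∂P :=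
    lintegral_congr_ae <| hC.mono fun ω h => by
      simp only [h]
      rw [← EReal.coe_neg, EReal.real_coe_toENNReal]
  rw [NegativeExpectation, h1, h2, integral_eq_lintegral_pos_part_sub_lintegral_neg_part hf,
    sub_neg]
  exact (ENNReal.toReal_lt_toReal hf.lintegral_lt_top.ne hf.neg.lintegral_lt_top.ne).symm

/-- Negative expected costs force E[C⁺] < ∞, hence almost surely finite energy. Integrability is
then recovered piece by piece before expectations are split. -/
theorem not_isPriceManipulation (hD : PoissonAssumption M D θ ν) (hν : ν = Measure.dirac ∞)
    {η : ℝ} (hη : 0 < η) (hα : D.α = 0) (hκ : D.κ = 0) (hh : ∀ x, M.h x = η * x)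
    (hle : M.γ ≤ 2 * θ * η) (hT : 0 < T) : ¬ IsPriceManipulation M D T χ := by
  rintro ⟨hχ, hneg⟩
  have hcost := ae_cost_eq hD hν hη hα hκ hh hχ
  have hEm := measurable_energy (measurable_uncurry_of_predictable hχ.predictable) T
  have hAm := hχ.aestronglyMeasurable_unaffectedCost hT
  have hb := hχ.integrable_permanentCost
  obtain ⟨C, hC⟩ := hχ.exists_abs_permanentCost_le
  set f : Ω → ℝ := fun ω =>
    unaffectedCost M D T χ ω + permanentCost M D T χ ω + η * (energy T χ ω).toReal with hf
  have hfm : AEStronglyMeasurable f P :=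
    (hAm.add hb.1).add (hEm.ennreal_toReal.const_mul η).aestronglyMeasurable
  have hpos : ∫⁻ ω, (if energy T χ ω < ∞ then ENNReal.ofReal (f ω) else ∞) ∂P ≠ ∞ := by
    refine ne_of_eq_of_ne (lintegral_congr_ae ?_) hneg.ne_top
    filter_upwards [hcost] with ω h
    rw [h]
    split_ifs <;> rfl
  have hfin : ∀ᵐ ω ∂P, energy T χ ω < ∞ := by
    have hm : AEMeasurable
        (fun ω => if energy T χ ω < ∞ then ENNReal.ofReal (f ω) else ∞) P := by
      have e : (fun ω => if energy T χ ω < ∞ then ENNReal.ofReal (f ω) else ∞) =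
          fun ω => ENNReal.ofReal (f ω) + {ω | energy T χ ω = ∞}.indicator (fun _ => ∞) ω := by
        funext ω
        by_cases h : energy T χ ω = ∞ <;> simp [h, lt_top_iff_ne_top]
      rw [e]
      exact hfm.aemeasurable.ennreal_ofReal.add
        (measurable_const.indicator (hEm (measurableSet_singleton _))).aemeasurable
    filter_upwards [ae_lt_top' hm hpos] with ω h
    by_contra hc
    simp [hc] at h
  have hcf : ∀ᵐ ω ∂P, cost M D 0 T χ ω = f ω := by
    filter_upwards [hcost, hfin] with ω h1 h2
    rw [h1, if_pos h2]
  have hfpos : ∫⁻ ω, ENNReal.ofReal (f ω) ∂P ≠ ∞ := by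
    refine ne_of_eq_of_ne (lintegral_congr_ae ?_) hpos
    filter_upwards [hfin] with ω h
    rw [if_pos h]
  have h0 := tendsto_truncation_unaffectedCost hD hν hχ hT
  -- The permanent costs are bounded and the energy is nonnegative, so A⁺ is at most f⁺ plus a
  -- constant, hence integrable.
  have hA : Integrable (unaffectedCost M D T χ) P := by
    refine integrable_of_tendsto_truncation hAm h0 (ne_top_of_le_ne_top
      (b := ∫⁻ ω, ENNReal.ofReal (f ω) ∂P + ENNReal.ofReal C) (by simp [hfpos]) ?_)
    calc ∫⁻ ω, ENNReal.ofReal (unaffectedCost M D T χ ω) ∂P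
        ≤ ∫⁻ ω, (ENNReal.ofReal (f ω) + ENNReal.ofReal C) ∂P := by
          refine lintegral_mono_ae ?_
          filter_upwards [hC] with ω h
          refine (ENNReal.ofReal_le_ofReal ?_).trans ENNReal.ofReal_add_le
          have := (abs_le.1 h).1
          have h2 : 0 ≤ η * (energy T χ ω).toReal := by positivity
          simp only [hf]; linarith
      _ = _ := by rw [lintegral_add_right _ measurable_const]; simp
  have hf1 : Integrable f P := by
    have hgb : Integrable (fun ω => unaffectedCost M D T χ ω + permanentCost M D T χ ω) P :=
      hA.add hb
    refine ⟨hfm, ?_⟩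
    refine lt_of_le_of_lt (b := ∫⁻ ω, ENNReal.ofReal (f ω) ∂P +
      ∫⁻ ω, ‖unaffectedCost M D T χ ω + permanentCost M D T χ ω‖ₑ ∂P) ?_
      (ENNReal.add_lt_top.2 ⟨hfpos.lt_top, hgb.2⟩)
    rw [← lintegral_add_right' _ hgb.1.enorm]
    refine lintegral_mono fun ω => ?_
    rw [← ofReal_norm, ← ofReal_norm]
    rcases le_total 0 (f ω) with h | h
    · rw [Real.norm_of_nonneg h]; exact le_self_add
    · refine le_add_left (ENNReal.ofReal_le_ofReal ?_)
      have h2 : 0 ≤ η * (energy T χ ω).toReal := by positivity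
      rw [Real.norm_of_nonpos h, Real.norm_eq_abs]
      have h3 := neg_abs_le (unaffectedCost M D T χ ω + permanentCost M D T χ ω)
      simp only [hf]; linarith
  have hQ : Integrable (fun ω => η * (energy T χ ω).toReal) P := by
    refine ((hf1.sub hA).sub hb).congr (ae_of_all _ fun ω => ?_)
    simp only [hf, Pi.sub_apply]; ring
  have hE : ∫⁻ ω, energy T χ ω ∂P ≠ ∞ := by
    have h := (hQ.const_mul η⁻¹).lintegral_lt_top
    refine ne_of_eq_of_ne (lintegral_congr_ae ?_) h.ne
    filter_upwards [hfin] with ω h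
    rw [inv_mul_cancel_left₀ hη.ne', ENNReal.ofReal_toReal h.ne]
  have hlt := (negativeExpectation_coe_iff hf1 hcf).1 hneg
  have hAb : Integrable (fun ω => unaffectedCost M D T χ ω + permanentCost M D T χ ω) P :=
    hA.add hb
  rw [hf, integral_add hAb hQ, integral_add hA hb, integral_const_mul,
    integral_eq_zero_of_tendsto_truncation hA h0] at hlt
  have := expected_impact_nonneg hD hν hχ hη hle hE
  linarith

end NoManipulation

/-! ### A price manipulation strategy -/

section Predictable

variable {Ω : Type*} {mΩ : MeasurableSpace Ω} {𝒢 : Filtration ℝ≥0 mΩ}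

theorem measurableSet_predictable_lt {σ : Ω → ℝ≥0}
    (hσ : IsStoppingTime 𝒢 fun ω => (σ ω : WithTop ℝ≥0)) :
    MeasurableSet[𝒢.predictable] {p : ℝ≥0 × Ω | σ p.2 < p.1} := by
  have e : {p : ℝ≥0 × Ω | σ p.2 < p.1} =
      ⋃ q : ℚ, Set.Ioi (Real.toNNReal q) ×ˢ {ω | σ ω ≤ Real.toNNReal q} := by
    ext p
    simp only [Set.mem_ofPred_eq, Set.mem_iUnion, Set.mem_prod, Set.mem_Ioi]
    constructor
    · intro h
      obtain ⟨q, _, h1, h2⟩ := (NNReal.lt_iff_exists_rat_btwn _ _).1 h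
      exact ⟨q, h2, h1.le⟩
    · rintro ⟨q, h1, h2⟩
      exact h2.trans_lt h1
  rw [e]
  refine MeasurableSet.iUnion fun q => measurableSet_predictable_Ioi_prod ?_
  have := hσ (Real.toNNReal q)
  simp only [WithTop.coe_le_coe] at this
  exact this

theorem measurable_predictable_ite_lt {r : ℝ≥0} {V : Ω → ℝ} (hV : Measurable[𝒢 r] V) :
    Measurable[𝒢.predictable] fun p : ℝ≥0 × Ω => if r < p.1 then V p.2 else 0 := by
  intro B hB
  have e : (fun p : ℝ≥0 × Ω => if r < p.1 then V p.2 else 0) ⁻¹' B =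
      Set.Ioi r ×ˢ (V ⁻¹' B) ∪ ((Set.Ioi r ×ˢ Set.univ)ᶜ ∩ {_p | (0 : ℝ) ∈ B}) := by
    ext p
    by_cases h : r < p.1 <;> simp [h]
  rw [e]
  exact (measurableSet_predictable_Ioi_prod (hV hB)).union
    ((measurableSet_predictable_Ioi_prod MeasurableSet.univ).compl.inter (MeasurableSet.const _))

theorem measurable_min_of_isStoppingTime {σ : Ω → ℝ≥0}
    (hσ : IsStoppingTime 𝒢 fun ω => (σ ω : WithTop ℝ≥0)) (r : ℝ≥0) :
    Measurable[𝒢 r] fun ω => min (σ ω) r := by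
  refine measurable_of_Iic fun a => ?_
  by_cases h : r ≤ a
  · have e : (fun ω => min (σ ω) r) ⁻¹' Set.Iic a = Set.univ := by
      ext ω; simp [h]
    rw [e]; exact MeasurableSet.univ
  · have e : (fun ω => min (σ ω) r) ⁻¹' Set.Iic a = {ω | σ ω ≤ a} := by
      ext ω; simp [h]
    rw [e]
    have := hσ a
    simp only [WithTop.coe_le_coe] at this
    exact 𝒢.mono (not_le.1 h).le _ this

end Predictable

/-! ### Piecewise constant trading rates. -/

section StepRate

/-- The trading rate that equals `a` until time `m` and `b` after time `r`. -/
def stepRate (m r : ℝ≥0) (a b : ℝ) (t : ℝ≥0) : ℝ :=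
  (if t ≤ m then a else 0) + if r < t then b else 0

theorem stepRate_toNNReal (m r : ℝ≥0) (a b s : ℝ) : stepRate m r a b s.toNNReal =
    (Set.Iic (m : ℝ)).indicator (fun _ => a) s + (Set.Ioi (r : ℝ)).indicator (fun _ => b) s := by
  simp only [stepRate, Set.indicator_apply, Set.mem_Iic, Set.mem_Ioi,
    Real.toNNReal_le_iff_le_coe, Real.lt_toNNReal_iff_coe_lt]

theorem intervalIntegrable_stepRate (m r : ℝ≥0) (a b : ℝ) (u v : ℝ) :
    IntervalIntegrable (fun s : ℝ => stepRate m r a b s.toNNReal) volume u v := by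
  simp_rw [stepRate_toNNReal, intervalIntegrable_iff, Set.uIoc]
  exact ((integrable_const a).indicator measurableSet_Iic).add
    ((integrable_const b).indicator measurableSet_Ioi)

theorem integral_stepRate (m r : ℝ≥0) (a b : ℝ) (u : ℝ≥0) :
    ∫ s in (0 : ℝ)..u, stepRate m r a b s.toNNReal =
      a * min u m + b * (u - min u r) := by
  simp_rw [stepRate_toNNReal]
  rw [intervalIntegral.integral_of_le u.coe_nonneg,
    integral_add ((integrable_const a).indicator measurableSet_Iic)
      ((integrable_const b).indicator measurableSet_Ioi), setIntegral_indicator measurableSet_Iic,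
    setIntegral_indicator measurableSet_Ioi, Set.Ioc_inter_Iic, Set.Ioc_inter_Ioi,
    setIntegral_const, setIntegral_const, Real.volume_real_Ioc_of_le (by positivity)]
  congr 1
  · simp [mul_comm]
  · rw [Real.volume_real_Ioc, smul_eq_mul, mul_comm]
    congr 1
    rw [max_eq_right (r.coe_nonneg : (0 : ℝ) ≤ r)]
    push_cast
    rcases le_total (u : ℝ) r with h | h
    · rw [min_eq_left h, max_eq_right (by linarith), sub_self]
    · rw [min_eq_right h, max_eq_left (by linarith)]

theorem stepRate_sq {m r : ℝ≥0} (hmr : m ≤ r) (a b : ℝ) (t : ℝ≥0) :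
    stepRate m r a b t ^ 2 = stepRate m r (a ^ 2) (b ^ 2) t := by
  unfold stepRate
  by_cases h1 : t ≤ m
  · have h2 : ¬ r < t := not_lt.2 (h1.trans hmr)
    simp [h1, h2]
  · by_cases h2 : r < t <;> simp [h1, h2]

theorem abs_stepRate_le (m r : ℝ≥0) (a b : ℝ) (t : ℝ≥0) :
    |stepRate m r a b t| ≤ |a| + |b| := by
  unfold stepRate
  refine (abs_add_le _ _).trans (add_le_add ?_ ?_) <;> split_ifs <;> simp

theorem abs_integral_stepRate_sub_le (m r : ℝ≥0) (a b : ℝ) {u v : ℝ≥0} (huv : u ≤ v) :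
    |(∫ s in (0 : ℝ)..v, stepRate m r a b s.toNNReal) -
      ∫ s in (0 : ℝ)..u, stepRate m r a b s.toNNReal| ≤ (|a| + |b|) * (v - u) := by
  rw [intervalIntegral.integral_interval_sub_left (intervalIntegrable_stepRate m r a b _ _)
    (intervalIntegrable_stepRate m r a b _ _)]
  have h := intervalIntegral.norm_integral_le_of_norm_le_const (a := (u : ℝ)) (b := v)
    (f := fun s => stepRate m r a b s.toNNReal) (C := |a| + |b|)
    fun s _ => abs_stepRate_le m r a b _
  rwa [Real.norm_eq_abs, abs_of_nonneg (sub_nonneg.2 (NNReal.coe_le_coe.2 huv))] at h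

end StepRate

section Manipulation

variable {Ω : Type*} [mΩ : MeasurableSpace Ω] {P : Measure Ω} [IsProbabilityMeasure P]
  {M : AlmgrenChriss P} {D : DarkPool Ω} {θ : ℝ≥0} {ν : Measure ℝ≥0∞}

/-- The amount that remains to be bought at time `r` when the first incoming order arrives at
time `s`, shares have been sold at rate `c`, and a dark-pool order for one share has been placed. -/
def buyback (c : ℝ) (r s : ℝ≥0) : ℝ := c * min (s : ℝ) r - if s ≤ r then 1 else 0

variable (D) in
/-- Sell at rate `c` until the dark-pool order is executed or cancelled, and unwind the remaining
position after the cancellation time `r`. -/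
def manipulation (c : ℝ) (r T : ℝ≥0) : Strategy Ω where
  x := 1
  Ξ := 0
  ξ t ω := stepRate (min (D.τ 0 ω) r) r (-c) (buyback c r (D.τ 0 ω) / (T - r)) t
  ρ _ := r

variable {c : ℝ} {r T : ℝ≥0}

theorem abs_buyback_le (hc : 0 ≤ c) (r s : ℝ≥0) : |buyback c r s| ≤ c * r + 1 := by
  unfold buyback
  have h1 : ((min s r : ℝ≥0) : ℝ) ≤ r := NNReal.coe_le_coe.2 (min_le_right _ _)
  have h2 : (0 : ℝ) ≤ (min s r : ℝ≥0) := NNReal.coe_nonneg _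
  push_cast at h1 h2
  have h3 : c * min (s : ℝ) r ≤ c * r := mul_le_mul_of_nonneg_left h1 hc
  have h4 : 0 ≤ c * min (s : ℝ) r := mul_nonneg hc h2
  rw [abs_le]
  split_ifs <;> constructor <;> linarith

theorem traded_manipulation (u : ℝ≥0) (ω : Ω) : (manipulation D c r T).traded u ω =
    -c * min (u : ℝ) (min (D.τ 0 ω) r) +
      buyback c r (D.τ 0 ω) / (T - r) * (u - min (u : ℝ) r) := by
  have := integral_stepRate (min (D.τ 0 ω) r) r (-c) (buyback c r (D.τ 0 ω) / (T - r)) u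
  push_cast at this
  exact this

theorem traded_manipulation_horizon (hrT : r < T) (ω : Ω) :
    (manipulation D c r T).traded T ω = -if D.τ 0 ω ≤ r then 1 else 0 := by
  have h : (r : ℝ) < T := NNReal.coe_lt_coe.2 hrT
  have h2 : min (D.τ 0 ω : ℝ) r ≤ T := (min_le_right _ _).trans h.le
  rw [traded_manipulation, min_eq_right h.le, min_eq_right h2,
    div_mul_cancel₀ _ (sub_pos.2 h).ne', buyback]
  ring

theorem energy_manipulation (hrT : r < T) (ω : Ω) : energy T (manipulation D c r T) ω =
    ENNReal.ofReal (c ^ 2 * min (D.τ 0 ω : ℝ) r + buyback c r (D.τ 0 ω) ^ 2 / (T - r)) := by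
  have h : (r : ℝ) < T := NNReal.coe_lt_coe.2 hrT
  have h2 : min (D.τ 0 ω : ℝ) r ≤ T := (min_le_right _ _).trans h.le
  have hi := intervalIntegrable_stepRate (min (D.τ 0 ω) r) r ((-c) ^ 2)
    ((buyback c r (D.τ 0 ω) / (T - r)) ^ 2) 0 T
  have hv := integral_stepRate (min (D.τ 0 ω) r) r ((-c) ^ 2)
    ((buyback c r (D.τ 0 ω) / (T - r)) ^ 2) T
  have e : c ^ 2 * min (D.τ 0 ω : ℝ) r + buyback c r (D.τ 0 ω) ^ 2 / (T - r) =
      ∫ s in (0 : ℝ)..T, stepRate (min (D.τ 0 ω) r) r ((-c) ^ 2)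
        ((buyback c r (D.τ 0 ω) / (T - r)) ^ 2) s.toNNReal := by
    rw [hv]
    push_cast
    rw [min_eq_right h.le, min_eq_right h2]
    have := (sub_pos.2 h).ne'
    field_simp
  have hsq : ∀ s : ℝ, (manipulation D c r T).ξ s.toNNReal ω ^ 2 =
      stepRate (min (D.τ 0 ω) r) r ((-c) ^ 2)
        ((buyback c r (D.τ 0 ω) / (T - r)) ^ 2) s.toNNReal := fun s =>
    stepRate_sq (min_le_right _ _) _ _ _
  rw [e, intervalIntegral.integral_of_le T.coe_nonneg, energy]
  simp_rw [← hsq] at hi ⊢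
  rw [intervalIntegrable_iff, Set.uIoc_of_le T.coe_nonneg] at hi
  rw [ofReal_integral_eq_lintegral_ofReal hi (ae_of_all _ fun _ => sq_nonneg _)]

theorem predictable_manipulation (c : ℝ) (r T : ℝ≥0) :
    IsStronglyPredictable (D.enlarged M.filtration 1 0) (manipulation D c r T).ξ := by
  set 𝒢 := D.enlarged M.filtration 1 0
  have hτ : IsStoppingTime 𝒢 fun ω => (D.τ 0 ω : WithTop ℝ≥0) :=
    D.isStoppingTime_τ M.filtration 1 0 0
  have hτr : IsStoppingTime 𝒢 fun ω => ((min (D.τ 0 ω) r : ℝ≥0) : WithTop ℝ≥0) := by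
    simpa only [WithTop.coe_min] using hτ.min_const r
  have hS : MeasurableSet[𝒢 r] {ω | D.τ 0 ω ≤ r} := by
    have := hτ r
    simp only [WithTop.coe_le_coe] at this
    exact this
  have hW : Measurable[𝒢 r] fun ω => buyback c r (D.τ 0 ω) / (T - r) := by
    have h1 : Measurable[𝒢 r] fun ω => c * ((min (D.τ 0 ω) r : ℝ≥0) : ℝ) :=
      (measurable_min_of_isStoppingTime hτ r).coe_nnreal_real.const_mul c
    simp only [NNReal.coe_min] at h1
    exact (h1.sub (Measurable.ite hS measurable_const measurable_const)).div_const _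
  have h1 : MeasurableSet[𝒢.predictable] {p : ℝ≥0 × Ω | p.1 ≤ min (D.τ 0 p.2) r} := by
    have := (measurableSet_predictable_lt hτr).compl
    simpa only [Set.compl_ofPred, not_lt] using this
  refine Measurable.stronglyMeasurable ?_
  exact (Measurable.ite h1 measurable_const measurable_const).add
    (measurable_predictable_ite_lt hW)

theorem isAdmissible_manipulation (hD : PoissonAssumption M D θ ν) (hν : ν = Measure.dirac ∞)
    (hc : 0 ≤ c) (hrT : r < T) : IsAdmissible M D 0 T (manipulation D c r T) where
  level_mem := by simp [manipulation]
  stopping := isStoppingTime_const _ r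
  cancel_lt := ae_of_all _ fun _ => hrT
  predictable := predictable_manipulation c r T
  integrable := ae_of_all _ fun _ => intervalIntegrable_stepRate _ _ _ _ _ _
  bounded := by
    have h : (0 : ℝ) < T - r := sub_pos.2 (NNReal.coe_lt_coe.2 hrT)
    refine ⟨(c + (c * r + 1) / (T - r)) * T, ae_of_all _ fun ω t ht => ?_⟩
    have h1 := abs_integral_stepRate_sub_le (min (D.τ 0 ω) r) r (-c)
      (buyback c r (D.τ 0 ω) / (T - r)) (zero_le : 0 ≤ t)
    simp only [NNReal.coe_zero, intervalIntegral.integral_same, sub_zero] at h1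
    refine h1.trans ?_
    have h2 : (t : ℝ) ≤ T := NNReal.coe_le_coe.2 ht
    rw [abs_neg, abs_of_nonneg hc, abs_div, abs_of_pos h]
    have := abs_buyback_le hc r (D.τ 0 ω)
    gcongr
  liquidation := by
    filter_upwards [D.ae_regular hD hν] with ω h
    rw [traded_manipulation_horizon hrT, h.Z_eq]
    simp only [manipulation, zero_add]
    exact neg_add_cancel _

/-- The traded part is Lipschitz in time with constant B, and the dark-pool part is monotone with
total jump at most 1; both bounds telescope. -/
theorem variation_inventory_manipulation (hc : 0 ≤ c) (hrT : r < T) (ω : Ω) (n : ℕ) :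
    ∑ k ∈ Finset.range n, |inventory D (manipulation D c r T) (grid T n (k + 1)) ω -
      inventory D (manipulation D c r T) (grid T n k) ω| ≤
      (c + (c * r + 1) / (T - r)) * T + 1 := by
  classical
  have h : (0 : ℝ) < T - r := sub_pos.2 (NNReal.coe_lt_coe.2 hrT)
  set B := c + (c * r + 1) / (T - r)
  set J : ℕ → ℝ := fun k => if D.τ 0 ω ≤ grid T n k ∧ D.τ 0 ω ≤ r then 1 else 0 with hJ
  have hB : 0 ≤ B := by positivity
  have hb : |(-c)| + |buyback c r (D.τ 0 ω) / (T - r)| ≤ B := by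
    rw [abs_neg, abs_of_nonneg hc, abs_div, abs_of_pos h]
    have := abs_buyback_le hc r (D.τ 0 ω)
    simp only [B]
    gcongr
  have hterm : ∀ k, |inventory D (manipulation D c r T) (grid T n (k + 1)) ω -
      inventory D (manipulation D c r T) (grid T n k) ω| ≤
      (B * grid T n (k + 1) - B * grid T n k) + (J (k + 1) - J k) := by
    intro k
    have hg : grid T n k ≤ grid T n (k + 1) := grid_mono T n k.le_succ
    have h1 : inventory D (manipulation D c r T) (grid T n (k + 1)) ω -
        inventory D (manipulation D c r T) (grid T n k) ω =
        ((manipulation D c r T).traded (grid T n (k + 1)) ω -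
          (manipulation D c r T).traded (grid T n k) ω) + (J (k + 1) - J k) := by
      have e : (manipulation D c r T).ρ ω = r := rfl
      have e' : (manipulation D c r T).x = 1 := rfl
      simp only [inventory, hJ, e, e']; ring
    have h2 : 0 ≤ J (k + 1) - J k := by
      simp only [hJ]
      by_cases hk : D.τ 0 ω ≤ grid T n k ∧ D.τ 0 ω ≤ r
      · rw [if_pos hk, if_pos ⟨hk.1.trans hg, hk.2⟩, sub_self]
      · rw [if_neg hk, sub_zero]; split_ifs <;> simp
    rw [h1]
    refine (abs_add_le _ _).trans (add_le_add ?_ (abs_of_nonneg h2).le)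
    refine (abs_integral_stepRate_sub_le (min (D.τ 0 ω) r) r (-c)
      (buyback c r (D.τ 0 ω) / (T - r)) hg).trans ?_
    rw [← mul_sub]
    exact mul_le_mul_of_nonneg_right hb (sub_nonneg.2 (NNReal.coe_le_coe.2 hg))
  refine (Finset.sum_le_sum fun k _ => hterm k).trans ?_
  rw [Finset.sum_add_distrib, Finset.sum_range_sub (fun k => B * (grid T n k : ℝ)),
    Finset.sum_range_sub J, grid_zero, NNReal.coe_zero, mul_zero, sub_zero]
  have h3 : (grid T n n : ℝ) ≤ T := NNReal.coe_le_coe.2 (grid_le T le_rfl)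
  have h4 : J n ≤ 1 := by simp only [hJ]; split_ifs <;> simp
  have h5 : 0 ≤ J 0 := by simp only [hJ]; split_ifs <;> simp
  have := mul_le_mul_of_nonneg_left h3 hB
  linarith

theorem permanentCost_manipulation (hrT : r < T) (ω : Ω) :
    permanentCost M D T (manipulation D c r T) ω =
      if D.τ 0 ω ≤ r then M.γ / 2 - M.γ * c * min (D.τ 0 ω : ℝ) r else 0 := by
  have e : (manipulation D c r T).ρ ω = r := rfl
  have e' : (manipulation D c r T).x = 1 := rfl
  rw [permanentCost, traded_manipulation_horizon hrT, e, e']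
  split_ifs with h
  · have h' : (D.τ 0 ω : ℝ) ≤ r := NNReal.coe_le_coe.2 h
    rw [traded_manipulation, min_eq_left h', min_self, sub_self]
    ring
  · ring

/-! ### The expected costs of the strategy -/

theorem integral_min_arrival (hD : PoissonAssumption M D θ ν) (r : ℝ≥0) :
    ∫ ω, min (D.τ 0 ω : ℝ) r ∂P = (1 - Real.exp (-(θ * r))) / θ := by
  have hθ : (0 : ℝ) < θ := NNReal.coe_pos.2 hD.θ_pos
  have hi : Integrable (fun ω => min (D.τ 0 ω : ℝ) r) P :=
    Integrable.of_bound (C := r) ((D.τ_measurable 0).coe_nnreal_real.min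
      measurable_const).aestronglyMeasurable (ae_of_all _ fun ω => by
        rw [Real.norm_of_nonneg (by positivity)]; exact min_le_right _ _)
  rw [hi.integral_eq_integral_meas_lt (ae_of_all _ fun ω => by simp),
    ← integral_exp_neg_mul hθ r.coe_nonneg le_rfl]
  have e : ∀ t ∈ Set.Ioi (0 : ℝ), P.real {ω | t < min (D.τ 0 ω : ℝ) r} =
      if t < r then Real.exp (-(θ * t)) else 0 := by
    intro t ht
    by_cases h : t < r
    · lift t to ℝ≥0 using (le_of_lt ht)
      rw [if_pos h, ← D.measureReal_lt_arrival hD.poisson hD.θ_pos]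
      simp [NNReal.coe_lt_coe.1 h]
    · simp [h]
  rw [setIntegral_congr_fun measurableSet_Ioi e]
  refine setIntegral_eq_of_subset_of_forall_sdiff_eq_zero measurableSet_Ioi
    (fun t ht => ht.1) fun t ht => if_neg fun h => ht.2 ⟨ht.1, h.le⟩

/-- The expected costs of the strategy, apart from those of the final unwinding. -/
def roundTripValue (γ η θ r : ℝ) : ℝ :=
  (1 - Real.exp (-(θ * r))) * (γ * (2 * η * θ - γ) / (4 * η * θ)) +
    γ ^ 2 / (2 * η) * (r * Real.exp (-(θ * r)))

/-- As r → ∞ the exponential terms vanish and the value tends to γ(2ηθ - γ)/(4ηθ) < 0. -/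
theorem exists_roundTripValue_neg {γ η θ : ℝ} (hγ : 0 < γ) (hη : 0 < η) (hθ : 0 < θ)
    (h : 2 * η * θ < γ) : ∃ r : ℝ≥0, roundTripValue γ η θ r < 0 := by
  have h1 : Tendsto (fun r : ℝ => Real.exp (-(θ * r))) atTop (𝓝 0) :=
    Real.tendsto_exp_neg_atTop_nhds_zero.comp (tendsto_id.const_mul_atTop hθ)
  have h2 : Tendsto (fun r : ℝ => r * Real.exp (-(θ * r))) atTop (𝓝 0) := by
    have := ((Real.tendsto_pow_mul_exp_neg_atTop_nhds_zero 1).comp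
      (tendsto_id.const_mul_atTop hθ)).const_mul θ⁻¹
    rw [mul_zero] at this
    refine this.congr fun r => ?_
    simp only [Function.comp_apply, id, pow_one]
    field_simp
  have h3 : Tendsto (roundTripValue γ η θ) atTop
      (𝓝 ((1 - 0) * (γ * (2 * η * θ - γ) / (4 * η * θ)) + γ ^ 2 / (2 * η) * 0)) :=
    ((h1.const_sub 1).mul_const _).add (h2.const_mul _)
  have h4 : (1 - 0) * (γ * (2 * η * θ - γ) / (4 * η * θ)) + γ ^ 2 / (2 * η) * 0 < 0 := by
    rw [sub_zero, one_mul, mul_zero, add_zero]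
    exact div_neg_of_neg_of_pos (mul_neg_of_pos_of_neg hγ (by linarith)) (by positivity)
  obtain ⟨r, hr, hr0⟩ := ((h3.eventually_lt_const h4).and (eventually_ge_atTop 0)).exists
  exact ⟨⟨r, hr0⟩, hr⟩

/-- The rate c = γ/(2η) minimises -γc + ηc², the coefficient of (1 - e^{-θr})/θ in the expected
costs. The last term bounds the cost of unwinding at most cr + 1 shares at constant speed over (r,
T]. -/
theorem expected_impact_manipulation_le (hD : PoissonAssumption M D θ ν) {η : ℝ} (hη : 0 < η) (hrT : r < T) :
    ∫ ω, permanentCost M D T (manipulation D (M.γ / (2 * η)) r T) ω ∂P +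
      η * ∫ ω, (energy T (manipulation D (M.γ / (2 * η)) r T) ω).toReal ∂P ≤
      roundTripValue M.γ η θ r + η * ((M.γ / (2 * η) * r + 1) ^ 2 / (T - r)) := by
  have hγ := M.γ_pos
  have hθ : (0 : ℝ) < θ := NNReal.coe_pos.2 hD.θ_pos
  set c := M.γ / (2 * η) with hc
  have hc0 : 0 ≤ c := by positivity
  have h : (0 : ℝ) < T - r := sub_pos.2 (NNReal.coe_lt_coe.2 hrT)
  have hS : MeasurableSet {ω | D.τ 0 ω ≤ r} := measurableSet_le (D.τ_measurable 0) measurable_const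
  have hmin : Integrable (fun ω => min (D.τ 0 ω : ℝ) r) P :=
    Integrable.of_bound (C := r) ((D.τ_measurable 0).coe_nnreal_real.min
      measurable_const).aestronglyMeasurable (ae_of_all _ fun ω => by
        rw [Real.norm_of_nonneg (by positivity)]; exact min_le_right _ _)
  have hcompl : P.real {ω | D.τ 0 ω ≤ r}ᶜ = Real.exp (-(θ * r)) := by
    rw [← D.measureReal_lt_arrival hD.poisson hD.θ_pos]
    simp [Set.compl_ofPred]
  have hprob : P.real {ω | D.τ 0 ω ≤ r} = 1 - Real.exp (-(θ * r)) := by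
    rw [← hcompl, probReal_compl_eq_one_sub hS]; ring
  have hperm : ∫ ω, permanentCost M D T (manipulation D c r T) ω ∂P =
      (1 - Real.exp (-(θ * r))) * (M.γ / 2) -
        M.γ * c * ((1 - Real.exp (-(θ * r))) / θ - r * Real.exp (-(θ * r))) := by
    -- On {τ ≤ r} the permanent cost involves τ, written as min(τ, r) minus r on {τ > r}, so that
    -- only E[min(τ, r)] and P(τ > r) are needed.
    have e : ∀ ω, permanentCost M D T (manipulation D c r T) ω =
        {ω | D.τ 0 ω ≤ r}.indicator (fun _ => M.γ / 2) ω -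
          M.γ * c * (min (D.τ 0 ω : ℝ) r - {ω | D.τ 0 ω ≤ r}ᶜ.indicator (fun _ => (r : ℝ)) ω) := by
      intro ω
      rw [permanentCost_manipulation hrT]
      by_cases hω : D.τ 0 ω ≤ r
      · simp [hω]
      · have h' : (r : ℝ) ≤ D.τ 0 ω := NNReal.coe_le_coe.2 (not_le.1 hω).le
        simp [hω, h']
    have i1 := (integrable_const (μ := P) (M.γ / 2)).indicator hS
    have i2 := (integrable_const (μ := P) (r : ℝ)).indicator hS.compl
    have i3 : Integrable (fun ω => M.γ * c * (min (D.τ 0 ω : ℝ) r -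
        {ω | D.τ 0 ω ≤ r}ᶜ.indicator (fun _ => (r : ℝ)) ω)) P := (hmin.sub i2).const_mul _
    simp_rw [e]
    rw [integral_sub i1 i3, integral_const_mul, integral_sub hmin i2,
      integral_indicator_const _ hS, integral_indicator_const _ hS.compl, hprob, hcompl,
      integral_min_arrival hD, smul_eq_mul, smul_eq_mul, mul_comm (r : ℝ)]
  have hE : ∫ ω, (energy T (manipulation D c r T) ω).toReal ∂P ≤
      c ^ 2 * ((1 - Real.exp (-(θ * r))) / θ) + (c * r + 1) ^ 2 / (T - r) := by
    have e : c ^ 2 * ((1 - Real.exp (-(θ * r))) / θ) + (c * r + 1) ^ 2 / (T - r) =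
        ∫ ω, (c ^ 2 * min (D.τ 0 ω : ℝ) r + (c * r + 1) ^ 2 / (T - r)) ∂P := by
      rw [integral_add (hmin.const_mul _) (integrable_const _), integral_const_mul,
        integral_min_arrival hD]
      simp
    rw [e]
    refine integral_mono_of_nonneg (ae_of_all _ fun _ => ENNReal.toReal_nonneg)
      ((hmin.const_mul _).add (integrable_const _)) (ae_of_all _ fun ω => ?_)
    simp only [energy_manipulation hrT]
    rw [ENNReal.toReal_ofReal (by positivity)]
    have := sq_le_sq' (abs_le.1 (abs_buyback_le hc0 r (D.τ 0 ω))).1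
      (abs_le.1 (abs_buyback_le hc0 r (D.τ 0 ω))).2
    gcongr
  rw [hperm]
  have := mul_le_mul_of_nonneg_left hE hη.le
  refine (add_le_add_right this _).trans (le_of_eq ?_)
  rw [roundTripValue, mul_add, ← add_assoc]
  congr 1
  rw [hc]
  field_simp
  ring

theorem exists_isPriceManipulation (hD : PoissonAssumption M D θ ν) (hν : ν = Measure.dirac ∞)
    {η : ℝ} (hη : 0 < η) (hα : D.α = 0) (hκ : D.κ = 0) (hh : ∀ x, M.h x = η * x)
    (hlt : 2 * θ * η < M.γ) : ∃ T : ℝ≥0, 0 < T ∧ ∃ χ, IsPriceManipulation M D T χ := by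
  have hγ := M.γ_pos
  have hθ : (0 : ℝ) < θ := NNReal.coe_pos.2 hD.θ_pos
  obtain ⟨r, hr⟩ := exists_roundTripValue_neg hγ hη hθ (by linarith)
  set c := M.γ / (2 * η) with hc
  have hc0 : 0 ≤ c := by positivity
  -- With r fixed, the unwinding cost is of order 1/(T - r), so a long horizon keeps the total
  -- negative.
  have hT : ∃ T : ℝ≥0, r < T ∧
      roundTripValue M.γ η θ r + η * ((c * r + 1) ^ 2 / (T - r)) < 0 := by
    have h1 : Tendsto (fun t : ℝ => roundTripValue M.γ η θ r + η * ((c * r + 1) ^ 2 / (t - r)))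
        atTop (𝓝 (roundTripValue M.γ η θ r + η * 0)) :=
      (((tendsto_id.atTop_add tendsto_const_nhds).const_div_atTop _).const_mul _).const_add _
    rw [mul_zero, add_zero] at h1
    obtain ⟨t, ht, ht'⟩ := ((h1.eventually_lt_const hr).and (eventually_gt_atTop (r : ℝ))).exists
    lift t to ℝ≥0 using r.coe_nonneg.trans ht'.le
    exact ⟨t, NNReal.coe_lt_coe.1 ht', ht⟩
  obtain ⟨T, hrT, hneg⟩ := hT
  have hT0 : 0 < T := zero_le.trans_lt hrT
  refine ⟨T, hT0, manipulation D c r T, ?_⟩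
  have hχ := isAdmissible_manipulation (M := M) hD hν hc0 hrT
  refine ⟨hχ, ?_⟩
  -- No bound on the costs is available in advance here; the bounded variation of the inventory
  -- supplies integrability instead.
  have hA : Integrable (unaffectedCost M D T (manipulation D c r T)) P :=
    integrable_of_tendsto_stieltjesSum_of_variation_le (D.martingale_price hD hν _ _)
      (stronglyMeasurable_inventory hχ)
      (ae_of_all _ fun ω n => variation_inventory_manipulation hc0 hrT ω n)
      (hχ.tendsto_stieltjesSum hT0)
  have hA0 := integral_eq_zero_of_tendsto_truncation hA
    (tendsto_truncation_unaffectedCost hD hν hχ hT0)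
  have hb := hχ.integrable_permanentCost
  have hAb : Integrable (fun ω => unaffectedCost M D T (manipulation D c r T) ω +
      permanentCost M D T (manipulation D c r T) ω) P := hA.add hb
  have hfin : ∀ ω, energy T (manipulation D c r T) ω < ∞ := fun ω => by
    rw [energy_manipulation hrT]; exact ENNReal.ofReal_lt_top
  have hQ : Integrable (fun ω => η * (energy T (manipulation D c r T) ω).toReal) P := by
    have h : (0 : ℝ) < T - r := sub_pos.2 (NNReal.coe_lt_coe.2 hrT)
    refine Integrable.const_mul (Integrable.of_bound
      (C := c ^ 2 * r + (c * r + 1) ^ 2 / (T - r)) (measurable_energy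
        (measurable_uncurry_of_predictable hχ.predictable) T).ennreal_toReal.aestronglyMeasurable
      (ae_of_all _ fun ω => ?_)) η
    rw [energy_manipulation hrT, ENNReal.toReal_ofReal (by positivity),
      Real.norm_of_nonneg (by positivity)]
    have h1 := sq_le_sq' (abs_le.1 (abs_buyback_le hc0 r (D.τ 0 ω))).1
      (abs_le.1 (abs_buyback_le hc0 r (D.τ 0 ω))).2
    have h2 : min (D.τ 0 ω : ℝ) r ≤ r := min_le_right _ _
    gcongr
  refine (negativeExpectation_coe_iff (hAb.add hQ) ?_).2 ?_
  · filter_upwards [ae_cost_eq hD hν hη hα hκ hh hχ] with ω h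
    rw [h, if_pos (hfin ω)]
    rfl
  · simp only [Pi.add_apply]
    rw [integral_add hAb hQ, integral_add hA hb, integral_const_mul, hA0, zero_add]
    exact (expected_impact_manipulation_le hD hη hrT).trans_lt hneg

end Manipulation

end DarkPoolModel

end

theorem mainTheorem11 {Ω : Type*} [MeasurableSpace Ω] (P : Measure Ω) [IsProbabilityMeasure P]
    (M : DarkPoolModel.AlmgrenChriss P) (D : DarkPoolModel.DarkPool Ω)
    (θ : ℝ≥0) (ν : Measure ℝ≥0∞) (hD : DarkPoolModel.PoissonAssumption M D θ ν)
    (η : ℝ) (hα : D.α = 0) (hκ : D.κ = 0) (hh : ∀ x, M.h x = η * x)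
    (hν : ν = Measure.dirac ∞) :
    (∀ T : ℝ≥0, 0 < T →
        ¬ ∃ χ : DarkPoolModel.Strategy Ω, DarkPoolModel.IsPriceManipulation M D T χ) ↔
      M.γ / η ≤ 2 * θ := by
  have hη : 0 < η := by
    have := M.h_impact.strictMono (zero_lt_one (α := ℝ))
    rwa [hh, hh, mul_zero, mul_one] at this
  rw [div_le_iff₀ hη]
  constructor
  · intro h
    by_contra! hlt
    obtain ⟨T, hT, χ, hχ⟩ := DarkPoolModel.exists_isPriceManipulation hD hν hη hα hκ hh hlt
    exact h T hT ⟨χ, hχ⟩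
  · rintro hle T hT ⟨χ, hχ⟩
    exact DarkPoolModel.not_isPriceManipulation hD hν hη hα hκ hh hle hT hχ
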